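/- Let $L>0$, $0<\alpha\le\beta\le 2\alpha$ and $c_1,c_2>0$. Let $\mathcal H^2(0,L)$ be the space of piecewise-$H^2$ functions on $(0,L)$, that is, those $u$ for which there is a finite set $P$ with $u\in H^2((0,L)\setminus P)$; functions are identified when they agree almost everywhere, and $u',u''$ denote the piecewise weak derivatives, regarded as functions on the whole of $(0,L)$. For $u\in\mathcal H^2(0,L)$ let $S(u)\subset(0,L)$ be the (finite) set of discontinuity points of $u$, let $S(u')\subset(0,L)$ be the (finite) set of points where $u$ is continuous but $u'$ is discontinuous, and let $$\mathcal F(u)=\int_0^L|u''|^2\,dt+\alpha\,\#S(u')+\beta\,\#S(u).$$ For $n\ge 1$ put $\lambda_n=L/n$ and $x_n^i=i\lambda_n$ $(i=0,\dots,n)$, and let $\mathcal A_n$ be the space of functions $u:\{x_n^0,\dots,x_n^n\}\to\mathbb R$, each identified with the function on $(0,L)$ that takes the value $u(x_n^i)$ on $[x_n^i,x_n^{i+1})$. Let $$\Psi_n(z)=\begin{cases} z^2 & \text{if } |z|\le c_1/\sqrt{\lambda_n},\\ \alpha/\lambda_n & \text{if } c_1/\sqrt{\lambda_n}<|z|\le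 c_2/(\lambda_n\sqrt{\lambda_n}),\\ \beta/(2\lambda_n) & \text{otherwise,}\end{cases}$$ $$E_n(u)=\sum_{i=1}^{n-1}\lambda_n\Psi_n\Bigl(\frac{u(x_n^{i+1})+u(x_n^{i-1})-2u(x_n^i)}{\lambda_n^2}\Bigr)\qquad(u\in\mathcal A_n).$$ Then $E_n$ $\Gamma$-converges to $\mathcal F$ with respect to $L^1(0,L)$ convergence on bounded sets of $L^2(0,L)$, in the following sense, where $u_n\in\mathcal A_n$ throughout. (i) If $(u_n)$ is bounded in $L^2(0,L)$ and $\sup_nE_n(u_n)<+\infty$, then $(u_n)$ is precompact in $L^1(0,L)$. (ii) If $(u_n)$ is bounded in $L^2(0,L)$, $u_n\to u$ in $L^1(0,L)$ and $\liminf_nE_n(u_n)<+\infty$, then $u\in\mathcal H^2(0,L)$ and $\mathcal F(u)\le\liminf_nE_n(u_n)$. (iii) For every $u\in\mathcal H^2(0,L)$ there exist $u_n\in\mathcal A_n$ with $u_n\to u$ in $L^2(0,L)$ and $\limsup_nE_n(u_n)\le\mathcal F(u)$. Moreover, let $g\in L^2(0,L)$. Then the minimum $$m=\min\Bigl\{\mathcal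 F(u)+\int_0^L|g-u|^2\,dt:\ u\in\mathcal H^2(0,L)\Bigr\}$$ exists, the values $$m_n=\inf\Bigl\{E_n(u)+\int_0^L|g-u|^2\,dt:\ u\in\mathcal A_n\Bigr\}$$ converge to $m$ as $n\to\infty$, and every sequence $(u_n)$ of minimizers of the problems for $m_n$ has a subsequence that converges in $L^1(0,L)$ to a minimizer of the problem for $m$. The same holds for every sequence of asymptotic minimizers, i.e. $u_n\in\mathcal A_n$ with $E_n(u_n)+\int_0^L|g-u_n|^2\,dt-m_n\to 0$. -/

import Mathlib

open MeasureTheory Set Filter Topology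
open scoped ContDiff

noncomputable section

namespace BlakeZisserman

/-- Lebesgue measure on the interval `(0, L)`. -/
def vol (L : ℝ) : Measure ℝ := volume.restrict (Ioo 0 L)

/-! ### Piecewise-`H²` functions -/

/-- `v` is a weak derivative of `u` on the open set `Ω ⊆ ℝ`. -/
def HasWeakDeriv (Ω : Set ℝ) (u v : ℝ → ℝ) : Prop :=
  ∀ φ : ℝ → ℝ, ContDiff ℝ ∞ φ → HasCompactSupport φ → tsupport φ ⊆ Ω →
    ∫ x in Ω, u x * deriv φ x = -∫ x in Ω, v x * φ x

/-- The Sobolev space `H²(Ω)` for an open set `Ω ⊆ ℝ`. -/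
def MemH2 (Ω : Set ℝ) (u : ℝ → ℝ) : Prop :=
  MemLp u 2 (volume.restrict Ω) ∧
    ∃ v w : ℝ → ℝ, MemLp v 2 (volume.restrict Ω) ∧ MemLp w 2 (volume.restrict Ω) ∧
      HasWeakDeriv Ω u v ∧ HasWeakDeriv Ω v w

/-- The space `𝓗²(0, L)` of piecewise-`H²` functions: `u` is `H²` on each of the open intervals
into which finitely many points divide `(0, L)`. -/
def MemPiecewiseH2 (L : ℝ) (u : ℝ → ℝ) : Prop :=
  ∃ P : Finset ℝ, MemH2 (Ioo 0 L \ (P : Set ℝ)) u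

/-- `v ∈ L²(0, L)` is the weak derivative of `u` on `(0, L)` away from finitely many points. -/
def IsPiecewiseDeriv (L : ℝ) (u v : ℝ → ℝ) : Prop :=
  MemLp v 2 (vol L) ∧ ∃ P : Finset ℝ, HasWeakDeriv (Ioo 0 L \ (P : Set ℝ)) u v

open Classical in
/-- The piecewise derivative `u'`, regarded as defined (almost everywhere) on the whole of
`(0, L)`. It is unique up to null sets; the value is `0` if there is none. -/
def pwDeriv (L : ℝ) (u : ℝ → ℝ) : ℝ → ℝ :=
  if h : ∃ v, IsPiecewiseDeriv L u v then Classical.choose h else 0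

/-- `u` has an essential (finite) limit at `t`, that is, up to modification on a null set `u` is
continuous at `t`. -/
def HasEssLimit (u : ℝ → ℝ) (t : ℝ) : Prop :=
  ∃ l : ℝ, Tendsto u (𝓝 t ⊓ ae volume) (𝓝 l)

/-- The jump points `S(u)` in `(0, L)`. -/
def jumpSet (L : ℝ) (u : ℝ → ℝ) : Set ℝ :=
  {t | t ∈ Ioo 0 L ∧ ¬ HasEssLimit u t}

/-- The crease points `S(u')` in `(0, L)`: `u` is continuous there but `u'` is not. -/
def creaseSet (L : ℝ) (u : ℝ → ℝ) : Set ℝ :=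
  {t | t ∈ Ioo 0 L ∧ HasEssLimit u t ∧ ¬ HasEssLimit (pwDeriv L u) t}

/-- The Blake–Zisserman functional `𝓕(u) = ∫₀ᴸ |u''|² + α #S(u') + β #S(u)`, meant for `u` in
`𝓗²(0, L)` (the two sets are then finite and `u''` is square integrable). -/
def energy (L α β : ℝ) (u : ℝ → ℝ) : ℝ :=
  (∫ x, (pwDeriv L (pwDeriv L u) x) ^ 2 ∂vol L)
    + α * (creaseSet L u).ncard + β * (jumpSet L u).ncard

/-! ### The discrete energies -/

/-- The mesh size `λ_n = L / n`. -/
def mesh (L : ℝ) (n : ℕ) : ℝ := L / n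

/-- The space `𝓐_n` of functions on the grid `{x_n^0, …, x_n^n}`, `x_n^i = i λ_n`; `u i` is the
value at `x_n^i`. -/
abbrev Grid (n : ℕ) : Type := Fin (n + 1) → ℝ

/-- The three-level truncated quadratic `Ψ_n`. -/
def psi (L α β c₁ c₂ : ℝ) (n : ℕ) (z : ℝ) : ℝ :=
  if |z| ≤ c₁ / √(mesh L n) then z ^ 2
  else if |z| ≤ c₂ / (mesh L n * √(mesh L n)) then α / mesh L n
  else β / (2 * mesh L n)

/-- The discrete energy `E_n`; the term of index `i` is the one centred at the grid point
`x_n^{i+1}`, so that the interior grid points `x_n^1, …, x_n^{n-1}` are the centres. -/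
def discreteEnergy (L α β c₁ c₂ : ℝ) (n : ℕ) (u : Grid n) : ℝ :=
  ∑ i : Fin (n - 1), mesh L n * psi L α β c₁ c₂ n
    ((u ⟨i + 2, by omega⟩ + u ⟨i, by omega⟩ - 2 * u ⟨i + 1, by omega⟩) / mesh L n ^ 2)

/-- A grid function as a piecewise constant function: value `u(x_n^i)` on
`[x_n^i, x_n^{i+1})`. -/
def step (L : ℝ) (n : ℕ) (u : Grid n) : ℝ → ℝ := fun x =>
  ∑ i : Fin n, (Ico (i * mesh L n) ((i + 1) * mesh L n)).indicator (fun _ => u i.castSucc) x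

/-! ### Boundedness, convergence and precompactness -/

/-- The sequence `f` is bounded in `L²(0, L)`. -/
def BoundedL2 (L : ℝ) (f : ℕ → ℝ → ℝ) : Prop :=
  ∃ C : ℝ, ∀ n, eLpNorm (f n) 2 (vol L) ≤ ENNReal.ofReal C

/-- `f n → u` in `Lᵖ(0, L)`. -/
def TendstoLp (p : ENNReal) (L : ℝ) (f : ℕ → ℝ → ℝ) (u : ℝ → ℝ) : Prop :=
  Tendsto (fun n => eLpNorm (f n - u) p (vol L)) atTop (𝓝 0)

/-- The sequence `f` is precompact in `L¹(0, L)`: each of its subsequences has a further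
subsequence that converges in `L¹(0, L)`. -/
def PrecompactL1 (L : ℝ) (f : ℕ → ℝ → ℝ) : Prop :=
  ∀ φ : ℕ → ℕ, StrictMono φ → ∃ ψ : ℕ → ℕ, StrictMono ψ ∧
    ∃ u : ℝ → ℝ, MemLp u 1 (vol L) ∧ TendstoLp 1 L (fun k => f (φ (ψ k))) u

/-! ### The minimum problems -/

/-- `E_n(u) + ∫₀ᴸ |g - u|²` for `u ∈ 𝓐_n`. -/
def discreteTotal (L α β c₁ c₂ : ℝ) (g : ℝ → ℝ) (n : ℕ) (u : Grid n) : ℝ :=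
  discreteEnergy L α β c₁ c₂ n u + ∫ x, (g x - step L n u x) ^ 2 ∂vol L

/-- `m_n = inf {E_n(u) + ∫₀ᴸ |g - u|² : u ∈ 𝓐_n}`, an infimum of nonnegative numbers. -/
def discreteInf (L α β c₁ c₂ : ℝ) (g : ℝ → ℝ) (n : ℕ) : ℝ :=
  ⨅ u : Grid n, discreteTotal L α β c₁ c₂ g n u

/-- `𝓕(u) + ∫₀ᴸ |g - u|²`. -/
def total (L α β : ℝ) (g u : ℝ → ℝ) : ℝ :=
  energy L α β u + ∫ x, (g x - u x) ^ 2 ∂vol L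

end BlakeZisserman

end

open BlakeZisserman

noncomputable section

namespace BlakeZisserman

/-! ### Primitives and piecewise functions -/

/-! Compactness and the lower bound rest on a discrete second-order Taylor formula: a grid function
is an affine function plus, for each interior centre, its second difference times a hinge `max (y -
τ) 0`. The second differences in the quadratic regime are collected in a cellwise constant function
F, whose squared L² norm is their share of the energy; their hinges add up to a discrete second
primitive of F. Each remaining one costs at least β/2, because β ≤ 2α, so an energy bound limits
their number (`exists_decomposition`). After extraction this number is fixed, the knots converge,
and F converges weakly in L² to some w. The discrete second primitives then converge pointwise to
`doublePrim w`. The L² bound on the functions controls the affine pieces away from the limit knots,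
so the sums of the remaining hinges converge to a piecewise affine function
(`exists_subseq_tendsto_hinge`, `exists_hinge_limit`). The limit is piecewise H² with second
derivative w.

Counting knots tells the two kinds of singularity apart. If a single knot accumulates at p, the
limit is continuous there and the slope change δ converges; hence |δ|√λ → 0, which rules out the
third regime and makes the knot cost at least α. A jump therefore needs two knots, which pay at
least β/2 each, and since α ≤ β two knots also pay for a crease (`eventually_sum_cost_ge`). With
weak lower semicontinuity of the L² norm this is the liminf inequality (`exists_subseq_limit`).

For the upper bound, a piecewise-H² function is given almost everywhere by w, finitely many points
with jumps s and slope jumps d, and initial data (`MemPiecewiseH2.exists_isRep`); its energy is read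
off from these (`IsRep.energy_eq`). Moving the singular points to the grid gives the recovery
sequence: its second differences are λ times cell integrals of w, kept quadratic by Jensen's
inequality, except for at most two per jump, costing β/2 each, and at most one per crease, costing
at most α (`exists_recovery`).

For the minimum problems, the fidelity term is continuous in L² and, by Fatou, lower semicontinuous
under almost everywhere convergence; bounded totals bound the L² norms, so compactness applies
(`exists_subseq_minimizer`). Lower bounds are phrased as "every e below the limit value is
eventually exceeded", a form that adds up without side conditions on liminf. -/

/-- `f` is a primitive of the locally integrable function `f'`. -/
structure IsPrimitive (f f' : ℝ → ℝ) : Prop where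
  integrable : ∀ a b, IntervalIntegrable f' volume a b
  sub_eq : ∀ x y, f y - f x = ∫ t in x..y, f' t

namespace IsPrimitive

variable {f f' g g' : ℝ → ℝ}

lemma eq (hf : IsPrimitive f f') (c : ℝ) : f = fun x => f c + ∫ t in c..x, f' t := by
  ext x
  rw [← hf.sub_eq]; ring

lemma continuous (hf : IsPrimitive f f') : Continuous f := by
  rw [hf.eq 0]
  exact continuous_const.add (intervalIntegral.continuous_primitive hf.integrable 0)

lemma absolutelyContinuous (hf : IsPrimitive f f') (a b : ℝ) :
    AbsolutelyContinuousOnInterval f a b := by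
  rw [hf.eq a]
  have h0 : AbsolutelyContinuousOnInterval (fun _ : ℝ => f a) a b :=
    (contDiff_const (n := 1)).contDiffOn.absolutelyContinuousOnInterval
  exact h0.add ((hf.integrable a b).absolutelyContinuousOnInterval_intervalIntegral
    (c := a) (by simp))

lemma ae_deriv_eq (hf : IsPrimitive f f') (a b : ℝ) :
    ∀ᵐ x, x ∈ uIcc a b → deriv f x = f' x := by
  filter_upwards [(hf.integrable a b).ae_hasDerivAt_integral] with x hx hx'
  have h := (hx hx' a (by simp)).const_add (f a)
  rw [hf.eq a]
  exact h.deriv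

/-- Integration by parts for primitives. -/
lemma integral_mul_add (hf : IsPrimitive f f') (hg : IsPrimitive g g') (a b : ℝ) :
    ∫ x in a..b, f x * g' x = f b * g b - f a * g a - ∫ x in a..b, f' x * g x := by
  have h := (hf.absolutelyContinuous a b).integral_mul_deriv_eq_deriv_mul
    (hg.absolutelyContinuous a b)
  have h1 : ∫ x in a..b, f x * deriv g x = ∫ x in a..b, f x * g' x := by
    apply intervalIntegral.integral_congr_ae
    filter_upwards [hg.ae_deriv_eq a b] with x hx hx'
    rw [hx (uIoc_subset_uIcc hx')]
  have h2 : ∫ x in a..b, deriv f x * g x = ∫ x in a..b, f' x * g x := by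
    apply intervalIntegral.integral_congr_ae
    filter_upwards [hf.ae_deriv_eq a b] with x hx hx'
    rw [hx (uIoc_subset_uIcc hx')]
  rw [← h1, ← h2, h]

lemma const (c : ℝ) : IsPrimitive (fun _ => c) (fun _ => 0) :=
  ⟨fun _ _ => by simp, fun _ _ => by simp⟩

lemma add (hf : IsPrimitive f f') (hg : IsPrimitive g g') :
    IsPrimitive (fun x => f x + g x) (fun x => f' x + g' x) where
  integrable a b := (hf.integrable a b).add (hg.integrable a b)
  sub_eq x y := by
    rw [intervalIntegral.integral_add (hf.integrable x y) (hg.integrable x y), ← hf.sub_eq,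
      ← hg.sub_eq]
    ring

lemma of_integrable (h : ∀ a b, IntervalIntegrable f' volume a b) :
    IsPrimitive (fun x => ∫ t in (0:ℝ)..x, f' t) f' where
  integrable := h
  sub_eq x y := intervalIntegral.integral_interval_sub_left (h 0 y) (h 0 x)

lemma of_contDiff (hf : ContDiff ℝ 1 f) : IsPrimitive f (deriv f) where
  integrable _ _ := (hf.continuous_deriv le_rfl).intervalIntegrable _ _
  sub_eq x y := by
    rw [intervalIntegral.integral_deriv_eq_sub]
    · exact fun z _ => hf.differentiable one_ne_zero z
    · exact (hf.continuous_deriv le_rfl).intervalIntegrable _ _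

end IsPrimitive

lemma isPrimitive_affine (p s d : ℝ) : IsPrimitive (fun x => s + d * (x - p)) (fun _ => d) where
  integrable _ _ := by simp
  sub_eq x y := by simp; ring

/-- The function that equals `g` plus, to the right of each `p ∈ P`, the function `h p`. -/
def pieced (g : ℝ → ℝ) (P : Finset ℝ) (h : ℝ → ℝ → ℝ) (x : ℝ) : ℝ :=
  g x + ∑ p ∈ P, if p < x then h p x else 0

instance (L : ℝ) : IsFiniteMeasure (vol L) := by
  unfold vol; infer_instance

/-- A finite set is null, so removing `P` affects only which test functions are admissible; every
integral may be taken over `vol L`. -/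
lemma restrict_diff_finset (L : ℝ) (P : Finset ℝ) :
    volume.restrict (Ioo 0 L \ (P : Set ℝ)) = vol L :=
  Measure.restrict_congr_set (sdiff_null_ae_eq_self (P.finite_toSet.measure_zero _))

lemma isOpen_diff_finset (L : ℝ) (P : Finset ℝ) : IsOpen (Ioo 0 L \ (P : Set ℝ)) :=
  isOpen_Ioo.sdiff P.finite_toSet.isClosed

/-- Weak differentiation off a finite set, with all integrals over `(0, L)`. -/
lemma hasWeakDeriv_iff {L : ℝ} {P : Finset ℝ} {u v : ℝ → ℝ} :
    HasWeakDeriv (Ioo 0 L \ (P : Set ℝ)) u v ↔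
      ∀ φ : ℝ → ℝ, ContDiff ℝ ∞ φ → HasCompactSupport φ → tsupport φ ⊆ Ioo 0 L \ (P : Set ℝ) →
        ∫ x, u x * deriv φ x ∂vol L = -∫ x, v x * φ x ∂vol L := by
  unfold HasWeakDeriv
  rw [restrict_diff_finset]

lemma integrable_mul_of_continuous {L : ℝ} {u φ : ℝ → ℝ} (hu : Integrable u (vol L))
    (hφ : Continuous φ) : Integrable (fun x => u x * φ x) (vol L) := by
  obtain ⟨C, hC⟩ := (isCompact_Icc (a := (0:ℝ)) (b := L)).exists_bound_of_continuousOn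
    hφ.continuousOn
  refine hu.mul_bdd (c := C) hφ.aestronglyMeasurable ?_
  refine ae_restrict_of_forall_mem measurableSet_Ioo fun x hx => hC x ⟨hx.1.le, hx.2.le⟩

lemma integrable_vol_of_intervalIntegrable {L : ℝ} (hL : 0 ≤ L) {f : ℝ → ℝ}
    (hf : ∀ a b, IntervalIntegrable f volume a b) : Integrable f (vol L) :=
  ((intervalIntegrable_iff_integrableOn_Ioo_of_le hL).1 (hf 0 L))

lemma integral_vol_eq {L : ℝ} (hL : 0 ≤ L) (f : ℝ → ℝ) :
    ∫ x, f x ∂vol L = ∫ x in (0:ℝ)..L, f x := by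
  rw [intervalIntegral.integral_of_le hL, integral_Ioc_eq_integral_Ioo]; rfl

lemma integral_ite_vol {L p : ℝ} (hp : 0 ≤ p) (hpL : p ≤ L) (f : ℝ → ℝ) :
    ∫ x, (if p < x then f x else 0) ∂vol L = ∫ x in p..L, f x := by
  have h : (fun x => if p < x then f x else 0) = (Ioi p).indicator f := by
    ext x; simp [indicator_apply]
  rw [h, integral_indicator measurableSet_Ioi, vol, Measure.restrict_restrict measurableSet_Ioi,
    intervalIntegral.integral_of_le hpL, integral_Ioc_eq_integral_Ioo]
  congr 2
  ext x; simp only [mem_inter_iff, mem_Ioi, mem_Ioo]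
  constructor
  · rintro ⟨h1, h2, h3⟩; exact ⟨h1, h3⟩
  · rintro ⟨h1, h2⟩; exact ⟨h1, hp.trans_lt h1, h2⟩

lemma integrable_ite {L p : ℝ} {f : ℝ → ℝ} (hf : Integrable f (vol L)) :
    Integrable (fun x => if p < x then f x else 0) (vol L) := by
  have h : (fun x => if p < x then f x else 0) = (Ioi p).indicator f := by
    ext x; simp [indicator_apply]
  rw [h]; exact hf.indicator measurableSet_Ioi

/-- Splits the pairing into one interval integral per break point, ready for integration by parts on
each `[p, L]`. -/
lemma integral_pieced_mul {L : ℝ} (hL : 0 ≤ L) {g : ℝ → ℝ} {P : Finset ℝ} {h : ℝ → ℝ → ℝ}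
    {φ : ℝ → ℝ} (hP : ∀ p ∈ P, p ∈ Ioo 0 L) (hφ : Continuous φ)
    (hg : ∀ a b, IntervalIntegrable g volume a b)
    (hh : ∀ p ∈ P, ∀ a b, IntervalIntegrable (h p) volume a b) :
    ∫ x, pieced g P h x * φ x ∂vol L =
      (∫ x in (0:ℝ)..L, g x * φ x) + ∑ p ∈ P, ∫ x in p..L, h p x * φ x := by
  have e : ∀ x, pieced g P h x * φ x =
      g x * φ x + ∑ p ∈ P, if p < x then h p x * φ x else 0 := by
    intro x
    simp only [pieced, add_mul, Finset.sum_mul, ite_mul, zero_mul]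
  simp_rw [e]
  have hi : ∀ p ∈ P, Integrable (fun x => if p < x then h p x * φ x else 0) (vol L) :=
    fun p hp => integrable_ite (integrable_mul_of_continuous
      (integrable_vol_of_intervalIntegrable hL (hh p hp)) hφ)
  rw [integral_add (integrable_mul_of_continuous (integrable_vol_of_intervalIntegrable hL hg) hφ)
    (integrable_finsetSum _ hi), integral_finsetSum _ hi, integral_vol_eq hL]
  congr 1
  exact Finset.sum_congr rfl fun p hp => integral_ite_vol (hP p hp).1.le (hP p hp).2.le _

/-- Piecewise differentiation of a piecewise absolutely continuous function. -/
lemma hasWeakDeriv_pieced {L : ℝ} (hL : 0 ≤ L) {g g' : ℝ → ℝ} {P : Finset ℝ} {h h' : ℝ → ℝ → ℝ}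
    (hP : ∀ p ∈ P, p ∈ Ioo 0 L) (hg : IsPrimitive g g') (hh : ∀ p ∈ P, IsPrimitive (h p) (h' p)) :
    HasWeakDeriv (Ioo 0 L \ (P : Set ℝ)) (pieced g P h) (pieced g' P h') := by
  rw [hasWeakDeriv_iff]
  intro φ hφ _ hsupp
  have hφ1 : ContDiff ℝ 1 φ := hφ.of_le (by exact_mod_cast le_top)
  have hzero : ∀ x, x ∉ Ioo 0 L \ (P : Set ℝ) → φ x = 0 := fun x hx =>
    image_eq_zero_of_notMem_tsupport fun hx' => hx (hsupp hx')
  -- The test function vanishes at the end points and at every break point, which removes all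
  -- boundary terms.
  have hφL : φ L = 0 := hzero L (by simp)
  have hφ0 : φ 0 = 0 := hzero 0 (by simp)
  have hφp : ∀ p ∈ P, φ p = 0 := fun p hp => hzero p (by simp [hp])
  rw [integral_pieced_mul hL hP (hφ1.continuous_deriv le_rfl)
      (fun a b => hg.continuous.intervalIntegrable a b)
      (fun p hp a b => (hh p hp).continuous.intervalIntegrable a b),
    integral_pieced_mul hL hP hφ.continuous hg.integrable (fun p hp => (hh p hp).integrable),
    hg.integral_mul_add (.of_contDiff hφ1), neg_add, ← Finset.sum_neg_distrib, hφL, hφ0]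
  congr 1
  · ring
  · refine Finset.sum_congr rfl fun p hp => ?_
    rw [(hh p hp).integral_mul_add (.of_contDiff hφ1), hφL, hφp p hp]
    ring

/-! ### Uniqueness of piecewise derivatives -/

lemma HasWeakDeriv.mono {L : ℝ} {P Q : Finset ℝ} {u v : ℝ → ℝ}
    (h : HasWeakDeriv (Ioo 0 L \ (P : Set ℝ)) u v) (hPQ : P ⊆ Q) :
    HasWeakDeriv (Ioo 0 L \ (Q : Set ℝ)) u v := by
  rw [hasWeakDeriv_iff] at h ⊢
  exact fun φ h1 h2 h3 => h φ h1 h2 (h3.trans (sdiff_subset_sdiff_right (by exact_mod_cast hPQ)))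

lemma HasWeakDeriv.congr {L : ℝ} {P : Finset ℝ} {u u' v v' : ℝ → ℝ}
    (h : HasWeakDeriv (Ioo 0 L \ (P : Set ℝ)) u v) (hu : u =ᵐ[vol L] u') (hv : v =ᵐ[vol L] v') :
    HasWeakDeriv (Ioo 0 L \ (P : Set ℝ)) u' v' := by
  rw [hasWeakDeriv_iff] at h ⊢
  intro φ h1 h2 h3
  have e1 : ∫ x, u' x * deriv φ x ∂vol L = ∫ x, u x * deriv φ x ∂vol L :=
    integral_congr_ae (hu.symm.mul .rfl)
  have e2 : ∫ x, v' x * φ x ∂vol L = ∫ x, v x * φ x ∂vol L :=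
    integral_congr_ae (hv.symm.mul .rfl)
  rw [e1, e2]
  exact h φ h1 h2 h3

lemma integrable_of_memLp_two {L : ℝ} {u : ℝ → ℝ} (hu : MemLp u 2 (vol L)) :
    Integrable u (vol L) := hu.integrable (by norm_num)

/-- The fundamental lemma of the calculus of variations on an open subset of `(0, L)`. -/
lemma ae_eq_zero_of_forall_integral {L : ℝ} {U : Set ℝ} (hU : IsOpen U) (hUL : U ⊆ Ioo 0 L)
    {f : ℝ → ℝ} (hf : Integrable f (vol L))
    (h : ∀ φ : ℝ → ℝ, ContDiff ℝ ∞ φ → HasCompactSupport φ → tsupport φ ⊆ U →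
      ∫ x, f x * φ x ∂vol L = 0) : ∀ᵐ x, x ∈ U → f x = 0 := by
  have hfU : IntegrableOn f U := IntegrableOn.mono_set (t := Ioo 0 L) hf hUL
  refine hU.ae_eq_zero_of_integral_contDiff_smul_eq_zero hfU.locallyIntegrableOn ?_
  intro φ h1 h2 h3
  rw [← h φ h1 h2 h3, vol, setIntegral_eq_integral_of_forall_compl_eq_zero]
  · simp [mul_comm]
  · intro x hx
    rw [image_eq_zero_of_notMem_tsupport fun hx' => hx (hUL (h3 hx')), mul_zero]

lemma ae_vol_of_ae_diff {L : ℝ} {P : Finset ℝ} {p : ℝ → Prop}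
    (h : ∀ᵐ x, x ∈ Ioo 0 L \ (P : Set ℝ) → p x) : ∀ᵐ x ∂vol L, p x := by
  rw [← restrict_diff_finset L P]
  exact (ae_restrict_iff' (isOpen_diff_finset L P).measurableSet).2 h

/-- Off `P ∪ Q` both candidates act in the same way on test functions, so the fundamental lemma
applies to their difference. -/
lemma HasWeakDeriv.unique {L : ℝ} {P Q : Finset ℝ} {u v v' : ℝ → ℝ}
    (h : HasWeakDeriv (Ioo 0 L \ (P : Set ℝ)) u v) (h' : HasWeakDeriv (Ioo 0 L \ (Q : Set ℝ)) u v')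
    (hv : MemLp v 2 (vol L)) (hv' : MemLp v' 2 (vol L)) : v =ᵐ[vol L] v' := by
  classical
  have h1 := hasWeakDeriv_iff.1 (h.mono (Finset.subset_union_left (s₂ := Q)))
  have h2 := hasWeakDeriv_iff.1 (h'.mono (Finset.subset_union_right (s₁ := P)))
  have iv := integrable_of_memLp_two hv
  have iv' := integrable_of_memLp_two hv'
  have := ae_vol_of_ae_diff (ae_eq_zero_of_forall_integral (isOpen_diff_finset L (P ∪ Q))
    sdiff_subset (iv.sub iv') ?_)
  · filter_upwards [this] with x hx
    simpa [sub_eq_zero] using hx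
  · intro φ c1 c2 c3
    simp_rw [Pi.sub_apply, sub_mul]
    rw [integral_sub (integrable_mul_of_continuous iv c1.continuous)
      (integrable_mul_of_continuous iv' c1.continuous)]
    have := (h1 φ c1 c2 c3).symm.trans (h2 φ c1 c2 c3)
    linarith

/-- `pwDeriv` is an arbitrary choice of witness; uniqueness lets any explicit derivative replace it.
-/
lemma IsPiecewiseDeriv.pwDeriv_ae_eq {L : ℝ} {u v : ℝ → ℝ} (h : IsPiecewiseDeriv L u v) :
    pwDeriv L u =ᵐ[vol L] v := by
  have hex : ∃ v, IsPiecewiseDeriv L u v := ⟨v, h⟩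
  have hc : IsPiecewiseDeriv L u (pwDeriv L u) := by
    unfold pwDeriv
    rw [dif_pos hex]
    exact Classical.choose_spec hex
  obtain ⟨m1, P, h1⟩ := hc
  obtain ⟨m2, Q, h2⟩ := h
  exact h1.unique h2 m1 m2

/-! ### Essential limits of piecewise functions -/

lemma HasEssLimit.congr {L : ℝ} {u v : ℝ → ℝ} (huv : u =ᵐ[vol L] v) {t : ℝ} (ht : t ∈ Ioo 0 L)
    (hu : HasEssLimit u t) : HasEssLimit v t := by
  obtain ⟨l, hl⟩ := hu
  refine ⟨l, hl.congr' ?_⟩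
  have h1 : ∀ᵐ x, x ∈ Ioo 0 L → u x = v x := (ae_restrict_iff' measurableSet_Ioo).1 huv
  filter_upwards [mem_inf_of_right h1, mem_inf_of_left (Ioo_mem_nhds ht.1 ht.2)] with x a b
  exact a b

lemma hasEssLimit_congr {L : ℝ} {u v : ℝ → ℝ} (huv : u =ᵐ[vol L] v) {t : ℝ} (ht : t ∈ Ioo 0 L) :
    HasEssLimit u t ↔ HasEssLimit v t :=
  ⟨.congr huv ht, .congr huv.symm ht⟩

lemma nhds_inf_ae_le (t : ℝ) : 𝓝 t ⊓ ae volume ≤ 𝓝[<] t ⊔ 𝓝[>] t := by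
  rw [nhdsLT_sup_nhdsGT]
  refine inf_le_inf_left _ ?_
  rw [le_principal_iff, mem_ae_iff]
  simp

/-- One-sided intervals have positive measure, so both one-sided filters stay nontrivial after
intersection with `ae volume`; uniqueness of limits then identifies `l` and `r` with the essential
limit. -/
lemma hasEssLimit_iff_of_tendsto {u : ℝ → ℝ} {t l r : ℝ} (hl : Tendsto u (𝓝[<] t) (𝓝 l))
    (hr : Tendsto u (𝓝[>] t) (𝓝 r)) : HasEssLimit u t ↔ l = r := by
  constructor
  · rintro ⟨m, hm⟩
    have key : ∀ s : Set ℝ, (∀ U ∈ 𝓝 t, 0 < volume (U ∩ s)) → (𝓝[s] t ⊓ ae volume).NeBot := by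
      intro s hs
      rw [nhdsWithin, inf_right_comm]
      rw [inf_principal_neBot_iff]
      intro V hV
      obtain ⟨U, hU, A, hA, rfl⟩ := mem_inf_iff.1 hV
      by_contra hne
      rw [not_nonempty_iff_eq_empty] at hne
      refine (hs U hU).ne' (measure_mono_null ?_ (mem_ae_iff.1 hA))
      intro x hx hxA
      have : x ∈ (U ∩ A) ∩ s := ⟨⟨hx.1, hxA⟩, hx.2⟩
      rw [hne] at this; exact this
    have h1 : (𝓝[<] t ⊓ ae volume).NeBot := by
      apply key
      intro U hU
      obtain ⟨ε, hε, hb⟩ := Metric.mem_nhds_iff.1 hU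
      refine lt_of_lt_of_le ?_ (measure_mono (s := Ioo (t - ε) t) ?_)
      · simp [hε]
      · intro x hx
        refine ⟨hb ?_, hx.2⟩
        rw [Metric.mem_ball, Real.dist_eq, abs_lt]
        constructor <;> linarith [hx.1, hx.2]
    have h2 : (𝓝[>] t ⊓ ae volume).NeBot := by
      apply key
      intro U hU
      obtain ⟨ε, hε, hb⟩ := Metric.mem_nhds_iff.1 hU
      refine lt_of_lt_of_le ?_ (measure_mono (s := Ioo t (t + ε)) ?_)
      · simp [hε]
      · intro x hx
        refine ⟨hb ?_, hx.1⟩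
        rw [Metric.mem_ball, Real.dist_eq, abs_lt]
        constructor <;> linarith [hx.1, hx.2]
    have e1 : l = m := tendsto_nhds_unique (hl.mono_left inf_le_left)
      (hm.mono_left (inf_le_inf_right _ nhdsWithin_le_nhds))
    have e2 : r = m := tendsto_nhds_unique (hr.mono_left inf_le_left)
      (hm.mono_left (inf_le_inf_right _ nhdsWithin_le_nhds))
    rw [e1, e2]
  · rintro rfl
    exact ⟨l, (hl.sup hr).mono_left (nhds_inf_ae_le t)⟩

lemma hasEssLimit_pieced_iff {g : ℝ → ℝ} {P : Finset ℝ} {h : ℝ → ℝ → ℝ} (hg : Continuous g)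
    (hh : ∀ p ∈ P, Continuous (h p)) (t : ℝ) :
    HasEssLimit (pieced g P h) t ↔ (t ∈ P → h t t = 0) := by
  classical
  have hl : Tendsto (pieced g P h) (𝓝[<] t) (𝓝 (g t + ∑ p ∈ P, if p < t then h p t else 0)) := by
    refine ((hg.tendsto t).mono_left nhdsWithin_le_nhds).add (tendsto_finsetSum _ fun p hp => ?_)
    by_cases hpt : p < t
    · simp only [hpt, if_true]
      refine (((hh p hp).tendsto t).mono_left nhdsWithin_le_nhds).congr' ?_
      filter_upwards [nhdsWithin_le_nhds (Ioi_mem_nhds hpt)] with x hx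
      rw [if_pos (show p < x from hx)]
    · simp only [hpt, if_false]
      refine tendsto_const_nhds.congr' ?_
      filter_upwards [self_mem_nhdsWithin] with x hx
      rw [if_neg]
      exact fun h' => hpt (h'.trans hx)
  have hr : Tendsto (pieced g P h) (𝓝[>] t) (𝓝 (g t + ∑ p ∈ P, if p ≤ t then h p t else 0)) := by
    refine ((hg.tendsto t).mono_left nhdsWithin_le_nhds).add (tendsto_finsetSum _ fun p hp => ?_)
    by_cases hpt : p ≤ t
    · simp only [hpt, if_true]
      refine (((hh p hp).tendsto t).mono_left nhdsWithin_le_nhds).congr' ?_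
      filter_upwards [self_mem_nhdsWithin] with x hx
      rw [if_pos (lt_of_le_of_lt hpt hx)]
    · simp only [hpt, if_false]
      refine tendsto_const_nhds.congr' ?_
      filter_upwards [nhdsWithin_le_nhds (Iio_mem_nhds (not_le.1 hpt))] with x hx
      rw [if_neg]
      exact fun h' => lt_asymm h' hx
  rw [hasEssLimit_iff_of_tendsto hl hr]
  -- The two one-sided limits differ only by the summand at `p = t`.
  have e : (∑ p ∈ P, if p ≤ t then h p t else 0) =
      (∑ p ∈ P, if p < t then h p t else 0) + if t ∈ P then h t t else 0 := by
    rw [← Finset.sum_ite_eq' P t (fun p => h p t), ← Finset.sum_add_distrib]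
    refine Finset.sum_congr rfl fun p _ => ?_
    rcases lt_trichotomy p t with h1 | h1 | h1
    · simp [h1, h1.le, h1.ne]
    · simp [h1]
    · simp [h1.not_gt, h1.not_ge, h1.ne']
  rw [e]
  by_cases ht : t ∈ P
  · simp only [ht, if_true, true_imp_iff]
    constructor
    · intro h'; linarith
    · intro h'; rw [h']; ring
  · simp [ht]

end BlakeZisserman
end

noncomputable section

namespace BlakeZisserman

/-! ### Canonical representatives of piecewise-`H²` functions -/

/-- The second primitive of `w` that vanishes at `0` together with its derivative. -/
def doublePrim (w : ℝ → ℝ) (x : ℝ) : ℝ := ∫ y in (0:ℝ)..x, ∫ r in (0:ℝ)..y, w r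

/-- The function with second derivative `w` away from `P`, with jumps `s p` and slope
jumps `d p` at the points `p` of `P`, and with value `a` and slope `b` at `0`. -/
def repFun (w : ℝ → ℝ) (P : Finset ℝ) (s d : ℝ → ℝ) (a b : ℝ) : ℝ → ℝ :=
  pieced (fun x => doublePrim w x + (a + b * (x - 0))) P (fun p x => s p + d p * (x - p))

/-- The piecewise derivative of `repFun`. -/
def repDeriv (w : ℝ → ℝ) (P : Finset ℝ) (d : ℝ → ℝ) (b : ℝ) : ℝ → ℝ :=
  pieced (fun x => (∫ r in (0:ℝ)..x, w r) + b) P (fun p _ => d p)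

/-- `v` is represented almost everywhere on `(0, L)` by a canonical piecewise-`H²` function. -/
structure IsRep (L : ℝ) (v w : ℝ → ℝ) (P : Finset ℝ) (s d : ℝ → ℝ) (a b : ℝ) : Prop where
  memLp : MemLp w 2 (vol L)
  integrable : Integrable w
  mem_Ioo : ∀ p ∈ P, p ∈ Ioo 0 L
  ae_eq : v =ᵐ[vol L] repFun w P s d a b

variable {L : ℝ} {v w : ℝ → ℝ} {P : Finset ℝ} {s d : ℝ → ℝ} {a b : ℝ}

lemma isPrimitive_prim (hw : Integrable w) : IsPrimitive (fun x => ∫ r in (0:ℝ)..x, w r) w :=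
  .of_integrable fun _ _ => hw.intervalIntegrable

lemma isPrimitive_doublePrim (hw : Integrable w) :
    IsPrimitive (doublePrim w) (fun x => ∫ r in (0:ℝ)..x, w r) :=
  .of_integrable fun _ _ => (isPrimitive_prim hw).continuous.intervalIntegrable _ _

lemma isPrimitive_repFun_base (hw : Integrable w) (a b : ℝ) :
    IsPrimitive (fun x => doublePrim w x + (a + b * (x - 0)))
      (fun x => (∫ r in (0:ℝ)..x, w r) + b) :=
  (isPrimitive_doublePrim hw).add (isPrimitive_affine 0 a b)

lemma isPrimitive_repDeriv_base (hw : Integrable w) (b : ℝ) :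
    IsPrimitive (fun x => (∫ r in (0:ℝ)..x, w r) + b) (fun x => w x + 0) :=
  (isPrimitive_prim hw).add (.const b)

lemma measurable_pieced {g : ℝ → ℝ} {h : ℝ → ℝ → ℝ} (hg : Continuous g)
    (hh : ∀ p ∈ P, Continuous (h p)) : Measurable (pieced g P h) := by
  unfold pieced
  refine hg.measurable.add (Finset.measurable_fun_sum _ fun p hp => ?_)
  exact Measurable.ite measurableSet_Ioi (hh p hp).measurable measurable_const

/-- A piecewise continuous function is bounded on `[0, L]`. -/
lemma exists_bound_pieced (L : ℝ) {g : ℝ → ℝ} {h : ℝ → ℝ → ℝ} (hg : Continuous g)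
    (hh : ∀ p ∈ P, Continuous (h p)) : ∃ C, ∀ x ∈ Icc 0 L, ‖pieced g P h x‖ ≤ C := by
  obtain ⟨C, hC⟩ := (isCompact_Icc (a := (0:ℝ)) (b := L)).exists_bound_of_continuousOn
    hg.continuousOn
  have : ∀ p ∈ P, ∃ D, ∀ x ∈ Icc 0 L, ‖h p x‖ ≤ D := fun p hp =>
    (isCompact_Icc (a := (0:ℝ)) (b := L)).exists_bound_of_continuousOn (hh p hp).continuousOn
  choose! D hD using this
  refine ⟨C + ∑ p ∈ P, D p, fun x hx => (norm_add_le _ _).trans (add_le_add (hC x hx) ?_)⟩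
  refine (norm_sum_le _ _).trans (Finset.sum_le_sum fun p hp => ?_)
  split_ifs
  · exact hD p hp x hx
  · simpa using (norm_nonneg _).trans (hD p hp x hx)

lemma memLp_pieced {g : ℝ → ℝ} {h : ℝ → ℝ → ℝ} (hg : Continuous g)
    (hh : ∀ p ∈ P, Continuous (h p)) (q : ENNReal) : MemLp (pieced g P h) q (vol L) := by
  obtain ⟨C, hC⟩ := exists_bound_pieced L hg hh
  refine MemLp.of_bound (measurable_pieced hg hh).aestronglyMeasurable C ?_
  exact ae_restrict_of_forall_mem measurableSet_Ioo fun x hx => hC x ⟨hx.1.le, hx.2.le⟩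

lemma memLp_repFun (hw : Integrable w) (q : ENNReal) : MemLp (repFun w P s d a b) q (vol L) :=
  memLp_pieced (isPrimitive_repFun_base hw a b).continuous (fun _ _ => by fun_prop) q

lemma memLp_repDeriv (hw : Integrable w) (q : ENNReal) : MemLp (repDeriv w P d b) q (vol L) :=
  memLp_pieced (isPrimitive_repDeriv_base hw b).continuous (fun _ _ => by fun_prop) q

namespace IsRep

lemma hasWeakDeriv (hL : 0 ≤ L) (h : IsRep L v w P s d a b) :
    HasWeakDeriv (Ioo 0 L \ (P : Set ℝ)) v (repDeriv w P d b) :=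
  (hasWeakDeriv_pieced hL h.mem_Ioo (isPrimitive_repFun_base h.integrable a b)
    (fun p _ => isPrimitive_affine p (s p) (d p))).congr h.ae_eq.symm .rfl

lemma hasWeakDeriv_repDeriv (hL : 0 ≤ L) (h : IsRep L v w P s d a b) :
    HasWeakDeriv (Ioo 0 L \ (P : Set ℝ)) (repDeriv w P d b) w :=
  (hasWeakDeriv_pieced hL h.mem_Ioo (isPrimitive_repDeriv_base h.integrable b)
    (fun p _ => IsPrimitive.const (d p))).congr .rfl (.of_forall fun x => by simp [pieced])

lemma memPiecewiseH2 (hL : 0 ≤ L) (h : IsRep L v w P s d a b) : MemPiecewiseH2 L v := by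
  refine ⟨P, ?_⟩
  unfold MemH2
  rw [restrict_diff_finset]
  exact ⟨(memLp_congr_ae h.ae_eq).2 (memLp_repFun h.integrable 2), _, _,
    memLp_repDeriv h.integrable 2, h.memLp, h.hasWeakDeriv hL, h.hasWeakDeriv_repDeriv hL⟩

lemma pwDeriv_ae_eq (hL : 0 ≤ L) (h : IsRep L v w P s d a b) :
    pwDeriv L v =ᵐ[vol L] repDeriv w P d b :=
  IsPiecewiseDeriv.pwDeriv_ae_eq ⟨memLp_repDeriv h.integrable 2, P, h.hasWeakDeriv hL⟩

lemma pwDeriv_pwDeriv_ae_eq (hL : 0 ≤ L) (h : IsRep L v w P s d a b) :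
    pwDeriv L (pwDeriv L v) =ᵐ[vol L] w :=
  IsPiecewiseDeriv.pwDeriv_ae_eq ⟨h.memLp, P,
    (h.hasWeakDeriv_repDeriv hL).congr (h.pwDeriv_ae_eq hL).symm .rfl⟩

/-- The slope term `d p * (x - p)` vanishes at `p`, so only the value jump `s p` can destroy
continuity. -/
lemma hasEssLimit_iff (h : IsRep L v w P s d a b) {t : ℝ} (ht : t ∈ Ioo 0 L) :
    HasEssLimit v t ↔ (t ∈ P → s t = 0) := by
  rw [hasEssLimit_congr h.ae_eq ht, repFun, hasEssLimit_pieced_iff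
    (isPrimitive_repFun_base h.integrable a b).continuous (fun _ _ => by fun_prop)]
  simp

lemma hasEssLimit_pwDeriv_iff (hL : 0 ≤ L) (h : IsRep L v w P s d a b) {t : ℝ}
    (ht : t ∈ Ioo 0 L) : HasEssLimit (pwDeriv L v) t ↔ (t ∈ P → d t = 0) := by
  rw [hasEssLimit_congr (h.pwDeriv_ae_eq hL) ht, repDeriv, hasEssLimit_pieced_iff
    (isPrimitive_repDeriv_base h.integrable b).continuous (fun _ _ => by fun_prop)]

open Classical in
lemma jumpSet_eq (h : IsRep L v w P s d a b) :
    jumpSet L v = (P.filter fun p => s p ≠ 0 : Finset ℝ) := by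
  ext t
  simp only [jumpSet, mem_ofPred_eq, Finset.coe_filter]
  constructor
  · rintro ⟨h1, h2⟩
    rw [h.hasEssLimit_iff h1] at h2
    push Not at h2
    exact h2
  · rintro ⟨h1, h2⟩
    refine ⟨h.mem_Ioo t h1, ?_⟩
    rw [h.hasEssLimit_iff (h.mem_Ioo t h1)]
    exact fun h' => h2 (h' h1)

open Classical in
lemma creaseSet_eq (hL : 0 ≤ L) (h : IsRep L v w P s d a b) :
    creaseSet L v = (P.filter fun p => s p = 0 ∧ d p ≠ 0 : Finset ℝ) := by
  ext t
  simp only [creaseSet, mem_ofPred_eq, Finset.coe_filter]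
  constructor
  · rintro ⟨h1, h2, h3⟩
    rw [h.hasEssLimit_iff h1] at h2
    rw [h.hasEssLimit_pwDeriv_iff hL h1] at h3
    push Not at h3
    exact ⟨h3.1, h2 h3.1, h3.2⟩
  · rintro ⟨h1, h2, h3⟩
    refine ⟨h.mem_Ioo t h1, ?_, ?_⟩
    · rw [h.hasEssLimit_iff (h.mem_Ioo t h1)]
      exact fun _ => h2
    · rw [h.hasEssLimit_pwDeriv_iff hL (h.mem_Ioo t h1)]
      exact fun h' => h3 (h' h1)

-- `P` may contain points where nothing happens, hence the nested case distinction: a jump takes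
-- precedence, a crease counts only when `s p = 0`.
open Classical in
lemma energy_eq (hL : 0 ≤ L) (h : IsRep L v w P s d a b) (α β : ℝ) :
    energy L α β v = (∫ x, w x ^ 2 ∂vol L) +
      ∑ p ∈ P, if s p ≠ 0 then β else if d p ≠ 0 then α else 0 := by
  have e : ∫ x, (pwDeriv L (pwDeriv L v) x) ^ 2 ∂vol L = ∫ x, w x ^ 2 ∂vol L :=
    integral_congr_ae ((h.pwDeriv_pwDeriv_ae_eq hL).fun_comp (· ^ 2))
  rw [energy, e, h.jumpSet_eq, h.creaseSet_eq hL, ncard_coe_finset, ncard_coe_finset, add_assoc]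
  congr 1
  rw [Finset.card_filter, Finset.card_filter]
  push_cast
  rw [Finset.mul_sum, Finset.mul_sum, ← Finset.sum_add_distrib]
  refine Finset.sum_congr rfl fun p _ => ?_
  by_cases h1 : s p = 0 <;> by_cases h2 : d p = 0 <;> simp [h1, h2]

end IsRep

/-! ### Existence of representatives -/

/-- A function with vanishing weak derivative on an open interval is constant there. -/
lemma exists_ae_eq_const {U : Set ℝ} (hU : IsOpen U) (hc : U.OrdConnected) (hUL : U ⊆ Ioo 0 L)
    {f : ℝ → ℝ} (hf : Integrable f (vol L))
    (h : ∀ φ : ℝ → ℝ, ContDiff ℝ ∞ φ → HasCompactSupport φ → tsupport φ ⊆ U →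
      ∫ x, f x * deriv φ x ∂vol L = 0) : ∃ c : ℝ, ∀ᵐ x, x ∈ U → f x = c := by
  rcases U.eq_empty_or_nonempty with rfl | ⟨x₀, hx₀⟩
  · exact ⟨0, by simp⟩
  obtain ⟨η, hη1, hη2, hη3, hη4, hη5⟩ :=
    exists_contDiff_tsupport_subset (n := ⊤) (hU.mem_nhds hx₀)
  have hη : ContDiff ℝ ∞ η := by simpa using hη3
  have hηi : Integrable η := hη.continuous.integrable_of_hasCompactSupport hη2
  have hη0 : 0 < ∫ x, η x := by
    refine hη.continuous.integral_pos_of_hasCompactSupport_nonneg_nonzero hη2 ?_ (x := x₀) ?_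
    · exact fun x => (hη4 ⟨x, rfl⟩).1
    · rw [hη5]; norm_num
  set I := ∫ x, η x with hI
  refine ⟨(∫ x, f x * η x ∂vol L) / I, ?_⟩
  -- The candidate constant is the mean of `f` weighted by the bump `η`.
  set c := (∫ x, f x * η x ∂vol L) / I with hcdef
  have := ae_eq_zero_of_forall_integral hU hUL (f := fun x => f x - c)
    (hf.sub (integrable_const c)) ?_
  · filter_upwards [this] with x hx hxU
    linarith [hx hxU]
  intro ψ hψ1 hψ2 hψ3
  have hψi : Integrable ψ := hψ1.continuous.integrable_of_hasCompactSupport hψ2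
  set J := ∫ x, ψ x with hJ
  -- Du Bois-Reymond: removing the right multiple of `η` leaves mean zero, so the primitive of `θ`
  -- is again compactly supported, and order-connectedness keeps its support inside `U`. It is
  -- therefore an admissible test function with derivative `θ`.
  set θ : ℝ → ℝ := fun x => ψ x - J / I * η x with hθ
  have hθc : ContDiff ℝ ∞ θ := hψ1.sub (contDiff_const.mul hη)
  have hθi : Integrable θ := hψi.sub (hηi.const_mul _)
  have hθ0 : ∫ x, θ x = 0 := by
    rw [hθ, integral_sub hψi (hηi.const_mul _), integral_const_mul, ← hI, ← hJ]
    field_simp; ring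
  -- a compact interval inside `U` that contains both supports
  obtain ⟨m, M, hmU, hMU, hθsupp⟩ : ∃ m M, m ∈ U ∧ M ∈ U ∧ ∀ x, x ∉ Icc m M → θ x = 0 := by
    set K : Set ℝ := insert x₀ (tsupport ψ ∪ tsupport η) with hK
    have hKc : IsCompact K := (hψ2.isCompact.union hη2.isCompact).insert x₀
    have hKU : K ⊆ U := insert_subset hx₀ (union_subset hψ3 hη1)
    have hKn : K.Nonempty := ⟨x₀, mem_insert _ _⟩
    refine ⟨sInf K, sSup K, hKU (hKc.sInf_mem hKn), hKU (hKc.sSup_mem hKn), fun x hx => ?_⟩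
    have hxK : x ∉ K := fun h' => hx ⟨csInf_le hKc.bddBelow h', le_csSup hKc.bddAbove h'⟩
    have h1 : ψ x = 0 := image_eq_zero_of_notMem_tsupport fun h' => hxK (.inr (.inl h'))
    have h2 : η x = 0 := image_eq_zero_of_notMem_tsupport fun h' => hxK (.inr (.inr h'))
    simp [hθ, h1, h2]
  set φ : ℝ → ℝ := fun x => ∫ t in m..x, θ t with hφ
  have hφd : ∀ x, HasDerivAt φ (θ x) x := fun x =>
    intervalIntegral.integral_hasDerivAt_right (hθi.intervalIntegrable)
      (hθc.continuous.stronglyMeasurableAtFilter _ _) hθc.continuous.continuousAt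
  have hφd' : deriv φ = θ := funext fun x => (hφd x).deriv
  have hφc : ContDiff ℝ ∞ φ := by
    rw [contDiff_infty_iff_deriv, hφd']
    exact ⟨fun x => (hφd x).differentiableAt, hθc⟩
  have hφ0 : ∀ x, x ∉ Icc m M → φ x = 0 := by
    intro x hx
    rw [mem_Icc, not_and_or, not_le, not_le] at hx
    rcases hx with hx | hx
    · rw [hφ]
      simp only
      rw [intervalIntegral.integral_symm, intervalIntegral.integral_of_le hx.le,
        integral_Ioc_eq_integral_Ioo, setIntegral_eq_zero_of_forall_eq_zero, neg_zero]
      exact fun t ht => hθsupp t fun h' => absurd ht.2 (not_lt.2 h'.1)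
    · rw [hφ]
      simp only
      by_cases hmx : m ≤ x
      · rw [intervalIntegral.integral_of_le hmx, ← integral_Icc_eq_integral_Ioc,
          setIntegral_eq_integral_of_forall_compl_eq_zero, hθ0]
        intro t ht
        exact hθsupp t fun h' => ht ⟨h'.1, h'.2.trans hx.le⟩
      · rw [intervalIntegral.integral_symm, intervalIntegral.integral_of_le (not_le.1 hmx).le,
          integral_Ioc_eq_integral_Ioo, setIntegral_eq_zero_of_forall_eq_zero, neg_zero]
        exact fun t ht => hθsupp t fun h' => absurd ht.2 (not_lt.2 h'.1)
  have hsub : tsupport φ ⊆ Icc m M := by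
    refine closure_minimal (fun x hx => ?_) isClosed_Icc
    by_contra h'
    exact hx (hφ0 x h')
  have hcs : HasCompactSupport φ := HasCompactSupport.of_support_subset_isCompact isCompact_Icc
    (subset_closure.trans hsub)
  have key := h φ hφc hcs (hsub.trans (hc.out hmU hMU))
  rw [hφd'] at key
  have hfψ := integrable_mul_of_continuous hf hψ1.continuous
  have hfη := integrable_mul_of_continuous hf hη.continuous
  have hψJ : ∫ x, ψ x ∂vol L = J := by
    rw [vol, setIntegral_eq_integral_of_forall_compl_eq_zero]
    exact fun x hx => image_eq_zero_of_notMem_tsupport fun h' => hx (hUL (hψ3 h'))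
  have e1 : ∫ x, f x * θ x ∂vol L =
      (∫ x, f x * ψ x ∂vol L) - J / I * ∫ x, f x * η x ∂vol L := by
    rw [← integral_const_mul, ← integral_sub hfψ (hfη.const_mul _)]
    congr 1; ext x; simp only [hθ]; ring
  simp_rw [sub_mul]
  rw [integral_sub hfψ ((integrable_mul_of_continuous (integrable_const c) hψ1.continuous)),
    integral_const_mul, hψJ]
  rw [e1] at key
  rw [hcdef]
  linear_combination key

/-- Telescoping of a step function over its jumps. -/
lemma telescope_step {lo hi : ℝ → ℝ} {P : Finset ℝ} {c e : ℝ}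
    (hstep : ∀ x y, c ≤ x → x < y → y ≤ e → (∀ p ∈ P, ¬ (x < p ∧ p < y)) → lo y = hi x)
    (hPc : ∀ p ∈ P, c < p) {x : ℝ} (hx : c < x) (hxe : x ≤ e) :
    lo x = hi c + ∑ p ∈ P, if p < x then hi p - lo p else 0 := by
  -- Induction on the number of points of `P` to the left of `x`: peel off the largest one, `q`,
  -- after which nothing changes up to `x`.
  induction h : (P.filter (· < x)).card using Nat.strong_induction_on generalizing x with
  | _ n ih =>
    rw [← Finset.sum_filter]
    rcases (P.filter (· < x)).eq_empty_or_nonempty with he | hne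
    · rw [he, Finset.sum_empty, add_zero]
      refine hstep c x le_rfl hx hxe fun p hp hpx => ?_
      have : p ∈ P.filter (· < x) := Finset.mem_filter.2 ⟨hp, hpx.2⟩
      rw [he] at this
      exact absurd this (Finset.notMem_empty p)
    · set q := (P.filter (· < x)).max' hne with hq
      have hqm := Finset.max'_mem _ hne
      rw [← hq, Finset.mem_filter] at hqm
      have hfil : P.filter (· < x) = insert q (P.filter (· < q)) := by
        ext p
        simp only [Finset.mem_filter, Finset.mem_insert]
        constructor
        · rintro ⟨h1, h2⟩
          have : p ≤ q := Finset.le_max' _ p (Finset.mem_filter.2 ⟨h1, h2⟩)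
          rcases this.lt_or_eq with h3 | h3
          · exact .inr ⟨h1, h3⟩
          · exact .inl h3
        · rintro (rfl | ⟨h1, h2⟩)
          · exact hqm
          · exact ⟨h1, h2.trans hqm.2⟩
      have hnot : q ∉ P.filter (· < q) := by simp
      have hi1 : lo x = hi q := by
        refine hstep q x (hPc q hqm.1).le hqm.2 hxe fun p hp hpx => ?_
        exact absurd (Finset.le_max' _ p (Finset.mem_filter.2 ⟨hp, hpx.2⟩)) (not_le.2 hpx.1)
      have := ih (P.filter (· < q)).card (by
        rw [← h, hfil, Finset.card_insert_of_notMem hnot]; omega) (hPc q hqm.1) (hqm.2.le.trans hxe) rfl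
      rw [← Finset.sum_filter] at this
      rw [hfil, Finset.sum_insert hnot, hi1]
      linarith

lemma integrable_indicator_of_memLp (hw : MemLp w 2 (vol L)) :
    Integrable ((Ioo 0 L).indicator w) :=
  (integrable_indicator_iff measurableSet_Ioo).2 (integrable_of_memLp_two hw)

lemma indicator_ae_eq_vol (w : ℝ → ℝ) : (Ioo 0 L).indicator w =ᵐ[vol L] w :=
  indicator_ae_eq_restrict measurableSet_Ioo

/-- A function with vanishing weak derivative off `P` depends only on the points of `P` to the
left of its argument. -/
lemma exists_ae_eq_of_hasWeakDeriv_zero {P : Finset ℝ} {f : ℝ → ℝ} (hf : Integrable f (vol L))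
    (h : HasWeakDeriv (Ioo 0 L \ (P : Set ℝ)) f 0) :
    ∃ c : Finset ℝ → ℝ, f =ᵐ[vol L] fun x => c (P.filter (· < x)) := by
  classical
  rw [hasWeakDeriv_iff] at h
  -- The complement of `P` is cut into pieces labelled by the set of points of `P` to their left.
  -- Each piece is open and order-connected, so `f` is constant on it, and no sorting of `P` is
  -- needed.
  have key : ∀ S : Finset ℝ, ∃ c : ℝ,
      ∀ᵐ x, x ∈ (Ioo 0 L \ (P : Set ℝ)) ∩ {x | P.filter (· < x) = S} → f x = c := by
    intro S
    refine exists_ae_eq_const ?_ ?_ (inter_subset_left.trans sdiff_subset) hf ?_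
    · rw [isOpen_iff_mem_nhds]
      rintro x ⟨hx, hxS⟩
      refine inter_mem ((isOpen_diff_finset L P).mem_nhds hx) ?_
      have : ∀ᶠ y in 𝓝 x, ∀ p ∈ P, (p < y ↔ p < x) := by
        rw [Finset.eventually_all]
        intro p hp
        have hne : p ≠ x := fun h' => hx.2 (by simpa [h'] using hp)
        rcases hne.lt_or_gt with h' | h'
        · filter_upwards [Ioi_mem_nhds h'] with y hy
          exact ⟨fun _ => h', fun _ => hy⟩
        · filter_upwards [Iio_mem_nhds h'] with y hy
          exact ⟨fun h2 => absurd h2 (not_lt.2 (le_of_lt hy)), fun h2 => absurd h2 h'.not_gt⟩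
      filter_upwards [this] with y hy
      exact (Finset.filter_congr hy).trans hxS
    · refine ⟨fun x hx y hy z hz => ?_⟩
      have hsub : ∀ p ∈ P, (p < z ↔ p < x) := by
        intro p hp
        constructor
        · intro h1
          have : p ∈ P.filter (· < y) := Finset.mem_filter.2 ⟨hp, h1.trans_le hz.2⟩
          rw [hy.2.trans hx.2.symm] at this
          exact (Finset.mem_filter.1 this).2
        · exact fun h1 => h1.trans_le hz.1
      refine ⟨⟨⟨hx.1.1.1.trans_le hz.1, hz.2.trans_lt hy.1.1.2⟩, fun hzP => ?_⟩, ?_⟩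
      · have hzy : z < y := lt_of_le_of_ne hz.2 fun h' => hy.1.2 (h' ▸ hzP)
        have : z ∈ P.filter (· < y) := Finset.mem_filter.2 ⟨hzP, hzy⟩
        rw [hy.2.trans hx.2.symm] at this
        exact absurd (Finset.mem_filter.1 this).2 (not_lt.2 hz.1)
      · rw [mem_ofPred_eq, ← hx.2]
        exact Finset.filter_congr hsub
    · intro φ h1 h2 h3
      rw [h φ h1 h2 (h3.trans inter_subset_left)]
      simp
  choose c hc using key
  refine ⟨c, ae_vol_of_ae_diff (P := P) ?_⟩
  have := (ae_ball_iff (P.powerset.countable_toSet)).2 fun S _ => hc S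
  filter_upwards [this] with x hx hxU
  exact hx (P.filter (· < x))
    (Finset.mem_coe.2 (Finset.mem_powerset.2 (Finset.filter_subset _ _))) ⟨hxU, rfl⟩

lemma HasWeakDeriv.sub {u u' z z' : ℝ → ℝ}
    (h : HasWeakDeriv (Ioo 0 L \ (P : Set ℝ)) u u') (h' : HasWeakDeriv (Ioo 0 L \ (P : Set ℝ)) z z')
    (hu : Integrable u (vol L)) (hu' : Integrable u' (vol L))
    (hz : Integrable z (vol L)) (hz' : Integrable z' (vol L)) :
    HasWeakDeriv (Ioo 0 L \ (P : Set ℝ)) (fun x => u x - z x) (fun x => u' x - z' x) := by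
  rw [hasWeakDeriv_iff] at h h' ⊢
  intro φ h1 h2 h3
  have hd : Continuous (deriv φ) := h1.continuous_deriv (by exact_mod_cast le_top)
  simp_rw [sub_mul]
  rw [integral_sub (integrable_mul_of_continuous hu hd) (integrable_mul_of_continuous hz hd),
    integral_sub (integrable_mul_of_continuous hu' h1.continuous)
      (integrable_mul_of_continuous hz' h1.continuous), h φ h1 h2 h3, h' φ h1 h2 h3]
  ring

lemma step_filter_eq {P : Finset ℝ} {x y : ℝ} (hxy : x < y)
    (h : ∀ p ∈ P, ¬ (x < p ∧ p < y)) : P.filter (· < y) = P.filter (· ≤ x) := by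
  refine Finset.filter_congr fun p hp => ?_
  constructor
  · intro h1
    by_contra h2
    exact h p hp ⟨not_le.1 h2, h1⟩
  · exact fun h1 => h1.trans_lt hxy

/-- Functions of the points of `P` to the left are sums of jumps. -/
lemma apply_filter_eq {P : Finset ℝ} (hP : ∀ p ∈ P, 0 < p) (c : Finset ℝ → ℝ) {x : ℝ}
    (hx : 0 < x) :
    c (P.filter (· < x)) = c (P.filter (· ≤ 0)) +
      ∑ p ∈ P, if p < x then c (P.filter (· ≤ p)) - c (P.filter (· < p)) else 0 :=
  telescope_step (lo := fun x => c (P.filter (· < x))) (hi := fun x => c (P.filter (· ≤ x)))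
    (fun _ _ _ hxy _ h => congrArg c (step_filter_eq hxy h)) hP hx le_rfl

/-- Every piecewise-`H²` function has a canonical representative. -/
theorem MemPiecewiseH2.exists_isRep (hL : 0 ≤ L) (hv : MemPiecewiseH2 L v) :
    ∃ w P s d a b, IsRep L v w P s d a b := by
  classical
  obtain ⟨Q, hQ⟩ := hv
  set P := Q.filter (· ∈ Ioo 0 L) with hPdef
  have hset : Ioo 0 L \ (Q : Set ℝ) = Ioo 0 L \ (P : Set ℝ) := by
    ext x; simp only [Set.mem_sdiff, hPdef, Finset.coe_filter, mem_ofPred_eq, Finset.mem_coe]; tauto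
  have hP : ∀ p ∈ P, p ∈ Ioo 0 L := fun p hp => (Finset.mem_filter.1 hp).2
  have hP0 : ∀ p ∈ P, 0 < p := fun p hp => (hP p hp).1
  unfold MemH2 at hQ
  rw [hset, restrict_diff_finset] at hQ
  obtain ⟨hv2, v', w₀, hv', hw₀, hd1, hd2⟩ := hQ
  -- Extension by zero makes `w` integrable on ℝ, so that its primitives live on the whole line.
  set w := (Ioo 0 L).indicator w₀ with hwdef
  have hww : w =ᵐ[vol L] w₀ := indicator_ae_eq_vol w₀
  have hw : MemLp w 2 (vol L) := (memLp_congr_ae hww).2 hw₀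
  have hwi : Integrable w := integrable_indicator_of_memLp hw₀
  have hd2' := hd2.congr .rfl hww.symm
  -- the derivative
  have base : IsRep L (repFun w P 0 0 0 0) w P 0 0 0 0 := ⟨hw, hwi, hP, .rfl⟩
  -- The representative without singularities has the same second derivative, so `v'` minus its
  -- derivative is a step function; its jumps are the slope jumps `d`.
  have hz := hd2'.sub (base.hasWeakDeriv_repDeriv hL) (integrable_of_memLp_two hv')
    (integrable_of_memLp_two hw) (integrable_of_memLp_two (memLp_repDeriv hwi 2))
    (integrable_of_memLp_two hw)
  obtain ⟨c, hc⟩ := exists_ae_eq_of_hasWeakDeriv_zero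
    ((integrable_of_memLp_two hv').sub (integrable_of_memLp_two (memLp_repDeriv hwi 2)))
    (hz.congr .rfl (.of_forall fun x => by simp))
  set d : ℝ → ℝ := fun p => c (P.filter (· ≤ p)) - c (P.filter (· < p)) with hd
  set b := c (P.filter (· ≤ 0)) with hb
  have hv'eq : v' =ᵐ[vol L] repDeriv w P d b := by
    have hpos : ∀ᵐ x ∂vol L, x ∈ Ioo 0 L := ae_restrict_mem measurableSet_Ioo
    filter_upwards [hc, hpos] with x hx hx0
    rw [Pi.sub_apply, apply_filter_eq hP0 c hx0.1] at hx
    simp only [repDeriv, pieced] at hx ⊢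
    simp only [Pi.zero_apply, ite_self, Finset.sum_const_zero, add_zero] at hx
    linear_combination hx
  have hd1' := hd1.congr .rfl hv'eq
  have base' : IsRep L (repFun w P 0 d 0 b) w P 0 d 0 b := ⟨hw, hwi, hP, .rfl⟩
  -- Second round: with all slopes matched, `v` minus this representative is itself a step function,
  -- whose jumps are the values `s`.
  have hz' := hd1'.sub (base'.hasWeakDeriv hL) (integrable_of_memLp_two hv2)
    (integrable_of_memLp_two (memLp_repDeriv hwi 2)) (integrable_of_memLp_two (memLp_repFun hwi 2))
    (integrable_of_memLp_two (memLp_repDeriv hwi 2))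
  obtain ⟨e, he⟩ := exists_ae_eq_of_hasWeakDeriv_zero
    ((integrable_of_memLp_two hv2).sub (integrable_of_memLp_two (memLp_repFun hwi 2)))
    (hz'.congr .rfl (.of_forall fun x => by simp))
  refine ⟨w, P, fun p => e (P.filter (· ≤ p)) - e (P.filter (· < p)), d, e (P.filter (· ≤ 0)), b,
    hw, hwi, hP, ?_⟩
  have hpos : ∀ᵐ x ∂vol L, x ∈ Ioo 0 L := ae_restrict_mem measurableSet_Ioo
  filter_upwards [he, hpos] with x hx hx0
  rw [Pi.sub_apply, apply_filter_eq hP0 e hx0.1] at hx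
  simp only [repFun, pieced, Pi.zero_apply] at hx ⊢
  have : ∀ p, (if p < x then e (P.filter (· ≤ p)) - e (P.filter (· < p)) + d p * (x - p) else 0) =
      (if p < x then e (P.filter (· ≤ p)) - e (P.filter (· < p)) else 0) +
        if p < x then 0 + d p * (x - p) else 0 := by
    intro p; split_ifs <;> ring
  simp_rw [this, Finset.sum_add_distrib]
  linear_combination hx

end BlakeZisserman
end

noncomputable section

namespace BlakeZisserman

/-! ### Weak compactness and convergence in `L¹` -/

lemma integral_sq_toLp {L : ℝ} {f g : ℝ → ℝ} (hf : MemLp f 2 (vol L)) (hg : MemLp g 2 (vol L)) :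
    inner ℝ (hf.toLp f) (hg.toLp g) = ∫ x, f x * g x ∂vol L := by
  rw [L2.inner_def]
  refine integral_congr_ae ?_
  filter_upwards [hf.coeFn_toLp, hg.coeFn_toLp] with x h1 h2
  rw [h1, h2]
  simp [mul_comm]

/-- Bounded sequences in `L²(0, L)` have weakly convergent subsequences. -/
theorem exists_subseq_weak_tendsto {L : ℝ} {f : ℕ → ℝ → ℝ} (hf : ∀ k, MemLp (f k) 2 (vol L))
    {C : ℝ} (hC : ∀ k, ∫ x, f k x ^ 2 ∂vol L ≤ C) :
    ∃ ψ : ℕ → ℕ, StrictMono ψ ∧ ∃ w : ℝ → ℝ, MemLp w 2 (vol L) ∧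
      ∀ g : ℝ → ℝ, MemLp g 2 (vol L) →
        Tendsto (fun k => ∫ x, f (ψ k) x * g x ∂vol L) atTop (𝓝 (∫ x, w x * g x ∂vol L)) := by
  have hnorm : ∀ k, ‖(hf k).toLp (f k)‖ ≤ √C := by
    intro k
    apply Real.le_sqrt_of_sq_le
    rw [← real_inner_self_eq_norm_sq, integral_sq_toLp]
    simpa [sq] using hC k
  let T : ℕ → WeakDual ℝ (Lp ℝ 2 (vol L)) := fun k =>
    StrongDual.toWeakDual (innerSL ℝ ((hf k).toLp (f k)))
  have hT : ∀ k, T k ∈ WeakDual.toStrongDual ⁻¹'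
      Metric.closedBall (0 : StrongDual ℝ (Lp ℝ 2 (vol L))) (√C) := by
    intro k
    rw [mem_preimage, mem_closedBall_zero_iff]
    exact (innerSL_apply_norm (𝕜 := ℝ) ((hf k).toLp (f k))).le.trans (hnorm k)
  -- A finite exponent makes `Lp` separable, so balls of the dual are weak-* sequentially compact;
  -- the Riesz isomorphism turns the limit functional into a function.
  have : Fact ((2 : ENNReal) ≠ ⊤) := ⟨by norm_num⟩
  obtain ⟨S, -, ψ, hψ, hlim⟩ := WeakDual.isSeqCompact_closedBall ℝ (Lp ℝ 2 (vol L)) 0 (√C) hT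
  set F : Lp ℝ 2 (vol L) := (InnerProductSpace.toDual ℝ _).symm (WeakDual.toStrongDual S) with hF
  refine ⟨ψ, hψ, F, Lp.memLp F, fun g hg => ?_⟩
  have h1 := ((WeakBilin.eval_continuous (topDualPairing ℝ (Lp ℝ 2 (vol L)))
    (hg.toLp g)).tendsto S).comp hlim
  have e1 : ∀ k, ∫ x, f (ψ k) x * g x ∂vol L = T (ψ k) (hg.toLp g) := by
    intro k
    rw [← integral_sq_toLp (hf (ψ k)) hg]
    rfl
  have e2 : ∫ x, F x * g x ∂vol L = S (hg.toLp g) := by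
    rw [← integral_sq_toLp (Lp.memLp F) hg, Lp.toLp_coeFn, hF,
      InnerProductSpace.toDual_symm_apply]
    rfl
  simp_rw [e1, e2]
  exact h1

/-- By Hölder the L¹ norm on a set `s` is at most the L² norm times the square root of the measure
of `s`, which dictates the squared choice of the threshold; the `+ 1` only avoids a zero
denominator. -/
lemma unifIntegrable_one_of_bounded_two {L : ℝ} {f : ℕ → ℝ → ℝ}
    (hf : ∀ k, AEStronglyMeasurable (f k) (vol L)) {C : ℝ}
    (hC : ∀ k, eLpNorm (f k) 2 (vol L) ≤ ENNReal.ofReal C) : UnifIntegrable f 1 (vol L) := by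
  intro ε hε
  refine ⟨(ε / (|C| + 1)) ^ 2, by positivity, fun k s hs hμ => ?_⟩
  rw [eLpNorm_indicator_eq_eLpNorm_restrict hs]
  refine (eLpNorm_le_eLpNorm_mul_rpow_measure_univ (p := 1) (q := 2) (by norm_num)
    (hf k).restrict).trans ?_
  rw [Measure.restrict_apply_univ]
  have h1 : eLpNorm (f k) 2 ((vol L).restrict s) ≤ ENNReal.ofReal (|C| + 1) :=
    ((eLpNorm_mono_measure _ Measure.restrict_le_self).trans (hC k)).trans
      (ENNReal.ofReal_le_ofReal (by linarith [le_abs_self C]))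
  have h2 : (vol L s) ^ (1 / (1 : ENNReal).toReal - 1 / (2 : ENNReal).toReal) ≤
      ENNReal.ofReal (ε / (|C| + 1)) := by
    have he : (1 / (1 : ENNReal).toReal - 1 / (2 : ENNReal).toReal) = (1 / 2 : ℝ) := by norm_num
    rw [he]
    refine (ENNReal.rpow_le_rpow hμ (by norm_num)).trans ?_
    rw [ENNReal.ofReal_rpow_of_nonneg (by positivity) (by norm_num), ← Real.sqrt_eq_rpow,
      Real.sqrt_sq (by positivity)]
  refine (mul_le_mul' h1 h2).trans ?_
  rw [← ENNReal.ofReal_mul (by positivity)]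
  apply le_of_eq
  congr 1
  field_simp

/-- On `L²`-bounded sets almost everywhere convergence implies convergence in `L¹`. -/
lemma tendstoLp_one_of_ae {L : ℝ} {f : ℕ → ℝ → ℝ} {v : ℝ → ℝ}
    (hf : ∀ k, AEStronglyMeasurable (f k) (vol L)) {C : ℝ}
    (hC : ∀ k, eLpNorm (f k) 2 (vol L) ≤ ENNReal.ofReal C) (hv : MemLp v 1 (vol L))
    (h : ∀ᵐ x ∂vol L, Tendsto (fun k => f k x) atTop (𝓝 (v x))) : TendstoLp 1 L f v :=
  tendsto_Lp_finite_of_tendsto_ae le_rfl (by simp) hf hv (unifIntegrable_one_of_bounded_two hf hC) h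

/-! ### Grid functions -/

lemma mesh_pos {L : ℝ} (hL : 0 < L) {n : ℕ} (hn : 0 < n) : 0 < mesh L n :=
  div_pos hL (by exact_mod_cast hn)

lemma mul_mesh {L : ℝ} {n : ℕ} (hn : 0 < n) : n * mesh L n = L := by
  have : (n : ℝ) ≠ 0 := by exact_mod_cast hn.ne'
  unfold mesh; field_simp

lemma tendsto_mesh (L : ℝ) : Tendsto (mesh L) atTop (𝓝 0) :=
  tendsto_const_div_atTop_nhds_zero_nat L

/-- The index of the grid cell of `x`. -/
def cell (L : ℝ) (n : ℕ) (x : ℝ) : ℕ := ⌊x / mesh L n⌋₊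

/-- The last grid point not to the right of `x`. -/
def gridFloor (L : ℝ) (n : ℕ) (x : ℝ) : ℝ := cell L n x * mesh L n

section Cell

variable {L : ℝ} {n : ℕ} {x y : ℝ}

lemma gridFloor_le (hL : 0 < L) (hn : 0 < n) (hx : 0 ≤ x) : gridFloor L n x ≤ x := by
  have h := mesh_pos hL hn
  have := Nat.floor_le (div_nonneg hx h.le)
  rw [le_div_iff₀ h] at this
  exact this

lemma lt_gridFloor_add (hL : 0 < L) (hn : 0 < n) (x : ℝ) :
    x < gridFloor L n x + mesh L n := by
  have h := mesh_pos hL hn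
  have := Nat.lt_floor_add_one (x / mesh L n)
  rw [div_lt_iff₀ h, add_mul, one_mul] at this
  exact this

lemma gridFloor_nonneg (hL : 0 < L) (hn : 0 < n) (x : ℝ) : 0 ≤ gridFloor L n x :=
  mul_nonneg (Nat.cast_nonneg _) (mesh_pos hL hn).le

lemma cell_eq_iff (hL : 0 < L) (hn : 0 < n) (hx : 0 ≤ x) (i : ℕ) :
    cell L n x = i ↔ x ∈ Ico (i * mesh L n) ((i + 1) * mesh L n) := by
  have h := mesh_pos hL hn
  rw [cell, Nat.floor_eq_iff (div_nonneg hx h.le), le_div_iff₀ h, div_lt_iff₀ h]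
  rfl

lemma cell_lt (hL : 0 < L) (hn : 0 < n) (hx : x < L) : cell L n x < n := by
  have h := mesh_pos hL hn
  rw [cell, Nat.floor_lt' hn.ne', div_lt_iff₀ h, mul_mesh hn]
  exact hx

lemma cell_mono (hL : 0 < L) (hn : 0 < n) (hxy : x ≤ y) : cell L n x ≤ cell L n y :=
  Nat.floor_mono (div_le_div_of_nonneg_right hxy (mesh_pos hL hn).le)

lemma measurable_comp_cell (F : ℕ → ℝ) : Measurable fun x => F (cell L n x) :=
  (measurable_from_nat (f := F)).comp (Nat.measurable_floor.comp (measurable_id.div_const _))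

lemma abs_comp_cell_le (hL : 0 < L) (hn : 0 < n) (F : ℕ → ℝ) (hx : x < L) :
    |F (cell L n x)| ≤ ∑ i ∈ Finset.range n, |F i| :=
  Finset.single_le_sum (f := fun i => |F i|) (fun _ _ => abs_nonneg _)
    (Finset.mem_range.2 (cell_lt hL hn hx))

lemma memLp_comp_cell (hL : 0 < L) (hn : 0 < n) (F : ℕ → ℝ) (q : ENNReal) :
    MemLp (fun x => F (cell L n x)) q (vol L) :=
  MemLp.of_bound (measurable_comp_cell F).aestronglyMeasurable _
    (ae_restrict_of_forall_mem measurableSet_Ioo fun _ hx => abs_comp_cell_le hL hn F hx.2)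

lemma vol_eq_Ico (L : ℝ) : vol L = volume.restrict (Ico 0 L) :=
  Measure.restrict_congr_set Ioo_ae_eq_Ico

lemma Ico_subset_Ico (hL : 0 < L) (hn : 0 < n) {i : ℕ} (hi : i < n) :
    Ico (i * mesh L n) ((i + 1) * mesh L n) ⊆ Ico 0 L := by
  have h := mesh_pos hL hn
  refine Set.Ico_subset_Ico (by positivity) ?_
  have hi' : (i : ℝ) + 1 ≤ n := by exact_mod_cast hi
  calc ((i : ℝ) + 1) * mesh L n ≤ n * mesh L n := by gcongr
    _ = L := mul_mesh hn

lemma sum_indicator_eq (hL : 0 < L) (hn : 0 < n) (F : ℕ → ℝ) (hx : x ∈ Ico 0 L) :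
    (∑ i ∈ Finset.range n, (Ico (i * mesh L n) ((i + 1) * mesh L n)).indicator
      (fun _ => F i) x) = F (cell L n x) := by
  rw [Finset.sum_eq_single (cell L n x)]
  · rw [indicator_of_mem ((cell_eq_iff hL hn hx.1 _).1 rfl)]
  · intro i _ hi
    rw [indicator_of_notMem fun h => hi ((cell_eq_iff hL hn hx.1 i).2 h).symm]
  · intro h
    exact absurd (Finset.mem_range.2 (cell_lt hL hn hx.2)) h

/-- Integrals over `(0, L)` against cellwise constant functions. -/
lemma integral_comp_cell_mul (hL : 0 < L) (hn : 0 < n) (F : ℕ → ℝ) {w : ℝ → ℝ}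
    (hw : Integrable w (vol L)) :
    ∫ x, F (cell L n x) * w x ∂vol L = ∑ i ∈ Finset.range n,
      F i * ∫ x in Ico (i * mesh L n) ((i + 1) * mesh L n), w x := by
  rw [vol_eq_Ico] at hw ⊢
  have e : ∀ x ∈ Ico 0 L, F (cell L n x) * w x = ∑ i ∈ Finset.range n,
      (Ico (i * mesh L n) ((i + 1) * mesh L n)).indicator (fun x => F i * w x) x := by
    intro x hx
    rw [← sum_indicator_eq hL hn F hx, Finset.sum_mul]
    refine Finset.sum_congr rfl fun i _ => ?_
    by_cases h : x ∈ Ico (i * mesh L n) ((i + 1) * mesh L n) <;> simp only [h, indicator_of_mem,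
      indicator_of_notMem, not_false_eq_true, zero_mul]
  rw [setIntegral_congr_fun measurableSet_Ico e, integral_finsetSum]
  · refine Finset.sum_congr rfl fun i hi => ?_
    rw [integral_indicator measurableSet_Ico, Measure.restrict_restrict measurableSet_Ico,
      inter_eq_left.2 (Ico_subset_Ico hL hn (Finset.mem_range.1 hi)), integral_const_mul]
  · exact fun i _ => (hw.const_mul _).indicator measurableSet_Ico

lemma integral_comp_cell (hL : 0 < L) (hn : 0 < n) (F : ℕ → ℝ) :
    ∫ x, F (cell L n x) ∂vol L = mesh L n * ∑ i ∈ Finset.range n, F i := by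
  have h := integral_comp_cell_mul hL hn F (w := fun _ => 1) (integrable_const 1)
  simp only [mul_one] at h
  rw [h, Finset.mul_sum]
  refine Finset.sum_congr rfl fun i _ => ?_
  have hm := mesh_pos hL hn
  simp only [integral_const, MeasurableSet.univ, measureReal_restrict_apply, univ_inter,
    Real.volume_real_Ico, smul_eq_mul, mul_one]
  rw [max_eq_left (by nlinarith)]
  ring

lemma abs_max_gridFloor_sub_le (hL : 0 < L) (hn : 0 < n) (hx : 0 ≤ x) (hy : 0 ≤ y) :
    |max (gridFloor L n x - gridFloor L n y) 0 - max (x - y) 0| ≤ mesh L n := by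
  refine (abs_max_sub_max_le_abs _ _ _).trans ?_
  rw [abs_le]
  constructor <;> linarith [gridFloor_le hL hn hx, gridFloor_le hL hn hy,
    lt_gridFloor_add hL hn x, lt_gridFloor_add hL hn y]

end Cell

/-! ### Second differences and the discrete Taylor formula. -/

/-- The values of a grid function, extended by zero. -/
def gridExt {n : ℕ} (u : Grid n) (i : ℕ) : ℝ := if h : i < n + 1 then u ⟨i, h⟩ else 0

/-- Second differences. -/
def secondDiff (U : ℕ → ℝ) (i : ℕ) : ℝ := U (i + 2) + U i - 2 * U (i + 1)

lemma discreteEnergy_eq (L α β c₁ c₂ : ℝ) {n : ℕ} (u : Grid n) :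
    discreteEnergy L α β c₁ c₂ n u = ∑ i ∈ Finset.range (n - 1),
      mesh L n * psi L α β c₁ c₂ n (secondDiff (gridExt u) i / mesh L n ^ 2) := by
  rw [discreteEnergy, ← Fin.sum_univ_eq_sum_range (fun i => mesh L n *
    psi L α β c₁ c₂ n (secondDiff (gridExt u) i / mesh L n ^ 2))]
  refine Finset.sum_congr rfl fun i _ => ?_
  have hi := i.2
  simp only [secondDiff, gridExt]
  rw [dif_pos (by omega), dif_pos (by omega), dif_pos (by omega)]

lemma step_eq {L : ℝ} (hL : 0 < L) {n : ℕ} (hn : 0 < n) (u : Grid n) {x : ℝ} (hx : x ∈ Ico 0 L) :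
    step L n u x = gridExt u (cell L n x) := by
  rw [← sum_indicator_eq hL hn (gridExt u) hx, step,
    ← Fin.sum_univ_eq_sum_range (fun i => (Ico (i * mesh L n) ((i + 1) * mesh L n)).indicator
      (fun _ => gridExt u i) x)]
  refine Finset.sum_congr rfl fun i _ => ?_
  have hi : gridExt u i = u i.castSucc := by
    simp only [gridExt]
    rw [dif_pos (by omega)]
    rfl
  rw [hi]

lemma measurable_step (L : ℝ) {n : ℕ} (u : Grid n) : Measurable (step L n u) := by
  unfold step
  exact Finset.measurable_fun_sum _ fun i _ => measurable_const.indicator measurableSet_Ico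

lemma memLp_step (L : ℝ) {n : ℕ} (u : Grid n) (q : ENNReal) : MemLp (step L n u) q (vol L) := by
  unfold step
  exact memLp_finsetSum _ fun i _ => (memLp_const _).indicator measurableSet_Ico

lemma sub_eq_sum_secondDiff (U : ℕ → ℝ) (i : ℕ) :
    U (i + 1) - U i = U 1 - U 0 + ∑ j ∈ Finset.range i, secondDiff U j := by
  induction i with
  | zero => simp
  | succ i ih =>
    rw [Finset.sum_range_succ, ← add_assoc, ← ih, secondDiff]
    ring

/-- Discrete second-order Taylor expansion. -/
lemma eq_sum_secondDiff (U : ℕ → ℝ) {m i : ℕ} (hi : i ≤ m + 1) :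
    U i = U 0 + i * (U 1 - U 0) +
      ∑ j ∈ Finset.range m, secondDiff U j * ((i - (j + 1) : ℕ) : ℝ) := by
  induction i with
  | zero => simp
  | succ i ih =>
    have h1 := sub_eq_sum_secondDiff U i
    have h2 : ∑ j ∈ Finset.range m, secondDiff U j * ((i + 1 - (j + 1) : ℕ) : ℝ) =
        ∑ j ∈ Finset.range m, secondDiff U j * ((i - (j + 1) : ℕ) : ℝ) +
          ∑ j ∈ Finset.range i, secondDiff U j := by
      have : Finset.range i = (Finset.range m).filter (· < i) := by
        ext j; simp only [Finset.mem_range, Finset.mem_filter]; omega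
      rw [this, Finset.sum_filter, ← Finset.sum_add_distrib]
      refine Finset.sum_congr rfl fun j _ => ?_
      split_ifs with h
      · rw [show i + 1 - (j + 1) = (i - (j + 1)) + 1 by omega]
        push_cast; ring
      · rw [show i + 1 - (j + 1) = 0 by omega, show i - (j + 1) = 0 by omega]
        simp
    rw [h2]
    push_cast
    linarith [ih (by omega)]

/-- Truncated subtraction of indices is the positive part, which turns the Taylor remainder into
hinges. -/
lemma natCast_sub_mul {l : ℝ} (hl : 0 ≤ l) (i j : ℕ) :
    ((i - j : ℕ) : ℝ) * l = max (i * l - j * l) 0 := by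
  rcases le_total j i with h | h
  · rw [Nat.cast_sub h, max_eq_left, sub_mul]
    have : (j : ℝ) ≤ i := by exact_mod_cast h
    nlinarith
  · rw [Nat.sub_eq_zero_of_le h, max_eq_right]
    · simp
    · have : (i : ℝ) ≤ j := by exact_mod_cast h
      nlinarith

/-- The second primitive as a convolution. -/
lemma doublePrim_eq_integral {L : ℝ} {w : ℝ → ℝ} (hw : Integrable w) {x : ℝ}
    (hx : x ∈ Icc 0 L) : doublePrim w x = ∫ s, w s * max (x - s) 0 ∂vol L := by
  -- Integration by parts against `s ↦ x - s`, which vanishes at `s = x`.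
  have hp : IsPrimitive (fun s => x + (-1) * (s - 0)) (fun _ => -1) := isPrimitive_affine 0 x (-1)
  have h := hp.integral_mul_add (isPrimitive_prim hw) 0 x
  have h1 : ∫ s, w s * max (x - s) 0 ∂vol L =
      ∫ s in (0:ℝ)..x, (x + (-1) * (s - 0)) * w s := by
    rw [integral_vol_eq (hx.1.trans hx.2), ← intervalIntegral.integral_add_adjacent_intervals
      (b := x)]
    · have h0 : ∫ s in x..L, w s * max (x - s) 0 = 0 := by
        rw [intervalIntegral.integral_of_le hx.2, setIntegral_eq_zero_of_forall_eq_zero]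
        intro s hs
        rw [max_eq_right (by linarith [hs.1]), mul_zero]
      rw [h0, add_zero]
      refine intervalIntegral.integral_congr fun s hs => ?_
      rw [uIcc_of_le hx.1] at hs
      rw [max_eq_left (by linarith [hs.2])]
      ring
    all_goals exact hw.intervalIntegrable.mul_continuousOn (by fun_prop)
  rw [h1, h, doublePrim]
  simp

end BlakeZisserman
end

noncomputable section

namespace BlakeZisserman

/-! ### Decomposition of a grid function -/

/-- Since `β ≤ 2 * α`, the value `β / 2` is the least price outside the quadratic regime; `α` is
guaranteed only up to the second threshold. -/
lemma le_mesh_mul_psi {L α β c₁ c₂ : ℝ} {n : ℕ} (hl : 0 < mesh L n) (hβα : β ≤ 2 * α) {z : ℝ}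
    (hz : ¬ |z| ≤ c₁ / √(mesh L n)) :
    β / 2 ≤ mesh L n * psi L α β c₁ c₂ n z ∧
      (|z| ≤ c₂ / (mesh L n * √(mesh L n)) → α ≤ mesh L n * psi L α β c₁ c₂ n z) := by
  unfold psi
  rw [if_neg hz]
  split_ifs with h
  · have e : mesh L n * (α / mesh L n) = α := by field_simp
    rw [e]
    exact ⟨by linarith, fun _ => le_rfl⟩
  · have e : mesh L n * (β / (2 * mesh L n)) = β / 2 := by field_simp
    rw [e]
    exact ⟨le_rfl, fun h' => absurd h' h⟩

/-- A grid function is the sum of an affine function, of hinges at the (few) centres of large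
second differences, and of the second primitive of a function controlled by the energy. -/
lemma exists_decomposition {L α β c₁ c₂ : ℝ} (hL : 0 < L) (hβα : β ≤ 2 * α) {n : ℕ} (hn : 0 < n)
    (u : Grid n) :
    ∃ (K : ℕ) (a b : ℝ) (τ δ cost : Fin K → ℝ) (F : ℕ → ℝ),
      (∀ i, τ i ∈ Icc 0 L) ∧ (∀ i, β / 2 ≤ cost i) ∧
      (∀ i, |δ i| * √(mesh L n) ≤ c₂ → α ≤ cost i) ∧
      discreteEnergy L α β c₁ c₂ n u = (∫ x, F (cell L n x) ^ 2 ∂vol L) + ∑ i, cost i ∧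
      ∀ x ∈ Ico 0 L, step L n u x = (a + b * gridFloor L n x +
        ∑ i, δ i * max (gridFloor L n x - τ i) 0) +
        ∫ s, F (cell L n s) * max (gridFloor L n x - gridFloor L n s) 0 ∂vol L := by
  classical
  have hl := mesh_pos hL hn
  set l := mesh L n with hldef
  set U := gridExt u with hU
  set z : ℕ → ℝ := fun j => secondDiff U j / l ^ 2 with hz
  set B := (Finset.range (n - 1)).filter fun j => ¬ |z j| ≤ c₁ / √l with hB
  set G := (Finset.range (n - 1)).filter fun j => |z j| ≤ c₁ / √l with hG
  have hsplit : ∀ g : ℕ → ℝ, ∑ j ∈ Finset.range (n - 1), g j = ∑ j ∈ G, g j + ∑ j ∈ B, g j :=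
    fun g => (Finset.sum_filter_add_sum_filter_not _ _ _).symm
  -- The index shift places the quotient `z j` on the cell starting at its centre, the grid point of
  -- index `j + 1`; large quotients and cell 0 contribute 0.
  set F : ℕ → ℝ := fun i => if i = 0 then 0 else if i - 1 ∈ G then z (i - 1) else 0 with hF
  have hFsum : ∀ g : ℕ → ℝ → ℝ, (∀ i, g i 0 = 0) →
      ∑ i ∈ Finset.range n, g i (F i) = ∑ j ∈ G, g (j + 1) (z j) := by
    intro g hg
    obtain ⟨m, rfl⟩ : ∃ m, n = m + 1 := ⟨n - 1, by omega⟩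
    rw [Finset.sum_range_succ']
    have h0 : g 0 (F 0) = 0 := by simp [hF, hg]
    rw [h0, add_zero]
    have hG' : G = (Finset.range m).filter (· ∈ G) := by
      ext j
      simp only [hG, Finset.mem_filter, Finset.mem_range, Nat.add_sub_cancel]
      tauto
    rw [hG', Finset.sum_filter]
    refine Finset.sum_congr rfl fun j _ => ?_
    by_cases hj : j ∈ G
    · simp [hF, hj]
    · simp [hF, hj, hg]
  let e : Fin B.card ≃ B := B.equivFin.symm
  have hesum : ∀ g : ℕ → ℝ, ∑ j ∈ B, g j = ∑ i, g (e i) := by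
    intro g
    rw [← Finset.sum_coe_sort B g]
    exact (e.sum_comp (fun j : B => g j)).symm
  have hmem : ∀ i, (e i : ℕ) < n - 1 ∧ ¬ |z (e i)| ≤ c₁ / √l := fun i => by
    have := Finset.mem_filter.1 (e i).2
    exact ⟨Finset.mem_range.1 this.1, this.2⟩
  refine ⟨B.card, U 0, (U 1 - U 0) / l, fun i => ((e i : ℕ) + 1 : ℕ) * l,
    fun i => secondDiff U (e i) / l, fun i => l * psi L α β c₁ c₂ n (z (e i)), F, ?_, ?_, ?_, ?_, ?_⟩
  · intro i
    refine ⟨by positivity, ?_⟩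
    have h1 : (((e i : ℕ) + 1 : ℕ) : ℝ) ≤ n := by exact_mod_cast (by have := (hmem i).1; omega)
    calc (((e i : ℕ) + 1 : ℕ) : ℝ) * l ≤ n * l := by gcongr
      _ = L := mul_mesh hn
  · exact fun i => (le_mesh_mul_psi hl hβα (hmem i).2).1
  · intro i hi
    -- The slope change is the second difference divided by `l`, so the bound by `c₂` says precisely
    -- that the quotient stays below the second threshold.
    refine (le_mesh_mul_psi hl hβα (hmem i).2).2 ?_
    have hs : 0 < √l := Real.sqrt_pos.2 hl
    rw [le_div_iff₀ (by positivity), hz]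
    simp only
    rw [abs_div, abs_of_pos (show 0 < l ^ 2 by positivity)]
    simp only [abs_div, abs_of_pos hl] at hi
    calc |secondDiff U (e i)| / l ^ 2 * (l * √l) = |secondDiff U (e i)| / l * √l := by
          field_simp
      _ ≤ c₂ := hi
  · have h1 : ∫ x, F (cell L n x) ^ 2 ∂vol L = ∑ j ∈ G, l * z j ^ 2 := by
      rw [integral_comp_cell hL hn (fun i => F i ^ 2), hFsum (fun _ y => y ^ 2) (by simp),
        Finset.mul_sum]
    rw [discreteEnergy_eq, hsplit, h1, ← hesum (fun j => l * psi L α β c₁ c₂ n (z j))]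
    congr 1
    refine Finset.sum_congr rfl fun j hj => ?_
    rw [hG, Finset.mem_filter] at hj
    change l * psi L α β c₁ c₂ n (z j) = _
    rw [psi, if_pos hj.2]
  · intro x hx
    have hcell := cell_lt hL hn hx.2
    have h1 : ∫ s, F (cell L n s) * max (gridFloor L n x - gridFloor L n s) 0 ∂vol L =
        ∑ j ∈ G, secondDiff U j * ((cell L n x - (j + 1) : ℕ) : ℝ) := by
      have := integral_comp_cell hL hn (fun i => F i * max (gridFloor L n x - i * l) 0)
      refine this.trans ?_
      rw [hFsum (fun i y => y * max (gridFloor L n x - i * l) 0) (by simp), Finset.mul_sum]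
      refine Finset.sum_congr rfl fun j _ => ?_
      rw [gridFloor, ← natCast_sub_mul hl.le, hz]
      simp only
      rw [← hldef]
      field_simp
    rw [h1, step_eq hL hn u hx, eq_sum_secondDiff (gridExt u) (m := n - 1) (by omega), hsplit,
      hesum]
    have h2 : ∀ i, secondDiff U (e i) / l * max (gridFloor L n x - ((e i : ℕ) + 1 : ℕ) * l) 0 =
        secondDiff U (e i) * ((cell L n x - ((e i : ℕ) + 1) : ℕ) : ℝ) := by
      intro i
      rw [gridFloor, ← natCast_sub_mul hl.le]
      field_simp
    simp_rw [h2]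
    rw [gridFloor, ← hldef]
    have h3 : (U 1 - U 0) / l * (cell L n x * l) = cell L n x * (U 1 - U 0) := by
      field_simp
    rw [h3]
    ring

/-! ### Limits of piecewise affine functions -/

/-- Chebyshev: otherwise `|f|` dominates on `(p, q)` a constant of L² norm `|M| + 1`, which exceeds
the bound. -/
lemma exists_abs_le_of_eLpNorm {L M p q : ℝ} {f : ℝ → ℝ} (hf : eLpNorm f 2 (vol L) ≤ ENNReal.ofReal M)
    (hp : 0 ≤ p) (hpq : p < q) (hq : q ≤ L) :
    ∃ x ∈ Ioo p q, |f x| ≤ (|M| + 1) / √(q - p) := by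
  by_contra! hcon
  set c := (|M| + 1) / √(q - p) with hc
  have hs : 0 < √(q - p) := Real.sqrt_pos.2 (by linarith)
  have hc0 : 0 < c := by positivity
  have h1 : eLpNorm ((Ioo p q).indicator fun _ => c) 2 (vol L) ≤ eLpNorm f 2 (vol L) := by
    refine eLpNorm_mono fun x => ?_
    by_cases hx : x ∈ Ioo p q
    · rw [indicator_of_mem hx, Real.norm_of_nonneg hc0.le]
      exact (hcon x hx).le
    · rw [indicator_of_notMem hx, norm_zero]
      exact norm_nonneg _
  rw [eLpNorm_indicator_const measurableSet_Ioo (by norm_num) (by norm_num), vol,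
    Measure.restrict_apply measurableSet_Ioo,
    inter_eq_left.2 (Ioo_subset_Ioo hp hq), Real.volume_Ioo,
    ENNReal.ofReal_rpow_of_pos (by linarith), Real.enorm_eq_ofReal hc0.le,
    ← ENNReal.ofReal_mul hc0.le] at h1
  have h2 := h1.trans hf
  have e : c * (q - p) ^ (1 / (2 : ENNReal).toReal) = |M| + 1 := by
    rw [show (1 / (2 : ENNReal).toReal) = (1 / 2 : ℝ) by norm_num, ← Real.sqrt_eq_rpow, hc]
    field_simp
  rw [e] at h2
  rcases ENNReal.ofReal_le_ofReal_iff'.1 h2 with h3 | h3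
  · linarith [le_abs_self M]
  · linarith [abs_nonneg M]

section Hinges

variable {K : ℕ}

/-- Affine part to the right of the hinges in `S`: value at `0`. -/
def hingeValue (a : ℝ) (τ δ : Fin K → ℝ) (S : Finset (Fin K)) : ℝ := a - ∑ i ∈ S, δ i * τ i

/-- Affine part to the right of the hinges in `S`: slope. -/
def hingeSlope (b : ℝ) (δ : Fin K → ℝ) (S : Finset (Fin K)) : ℝ := b + ∑ i ∈ S, δ i

/-- A sum of hinges. -/
def hingeSum (a b : ℝ) (τ δ : Fin K → ℝ) (y : ℝ) : ℝ :=
  a + b * y + ∑ i, δ i * max (y - τ i) 0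

lemma hingeSum_eq {a b : ℝ} {τ δ : Fin K → ℝ} {S : Finset (Fin K)} {y : ℝ}
    (h1 : ∀ i ∈ S, τ i ≤ y) (h2 : ∀ i ∉ S, y ≤ τ i) :
    hingeSum a b τ δ y = hingeValue a τ δ S + hingeSlope b δ S * y := by
  have e : ∑ i, δ i * max (y - τ i) 0 = ∑ i ∈ S, δ i * (y - τ i) := by
    rw [← Finset.sum_subset (Finset.subset_univ S)]
    · refine Finset.sum_congr rfl fun i hi => ?_
      rw [max_eq_left (by linarith [h1 i hi])]
    · intro i _ hi
      rw [max_eq_right (by linarith [h2 i hi]), mul_zero]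
  rw [hingeSum, e, hingeValue, hingeSlope]
  simp_rw [mul_sub, Finset.sum_sub_distrib, ← Finset.sum_mul]
  ring

variable {L : ℝ} {a b l : ℕ → ℝ} {τ δ : ℕ → Fin K → ℝ} {t : Fin K → ℝ} {fl : ℕ → ℝ → ℝ}

/-- Near a point off the limits of the knots, sums of hinges are eventually affine. -/
lemma eventually_hingeSum_eq (hl : Tendsto l atTop (𝓝 0))
    (hfl : ∀ k, ∀ x, 0 ≤ x → fl k x ≤ x ∧ x < fl k x + l k)
    (hτ : ∀ i, Tendsto (fun k => τ k i) atTop (𝓝 (t i))) {x₀ η : ℝ} (hη : 0 < η) (hηx : η ≤ x₀)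
    (ht : ∀ i, η < |t i - x₀|) :
    ∀ᶠ k in atTop, l k < η / 4 ∧ ∀ x, |x - x₀| ≤ η / 2 → hingeSum (a k) (b k) (τ k) (δ k) (fl k x) =
      hingeValue (a k) (τ k) (δ k) (Finset.univ.filter (t · < x₀)) +
        hingeSlope (b k) (δ k) (Finset.univ.filter (t · < x₀)) * fl k x := by
  have h1 : ∀ᶠ k in atTop, l k < η / 4 := hl.eventually_lt_const (by linarith)
  have h2 : ∀ᶠ k in atTop, ∀ i, |τ k i - t i| < η / 4 := by
    rw [eventually_all]
    intro i
    exact (Metric.tendsto_nhds.1 (hτ i)) (η / 4) (by linarith)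
  filter_upwards [h1, h2] with k hk1 hk2
  refine ⟨hk1, fun x hx => hingeSum_eq ?_ ?_⟩
  · intro i hi
    have hi' := (Finset.mem_filter.1 hi).2
    have h3 := ht i
    rw [abs_of_neg (by linarith)] at h3
    have h4 := abs_lt.1 (hk2 i)
    have h5 := abs_le.1 hx
    linarith [(hfl k x (by linarith)).2]
  · intro i hi
    have hi' : x₀ ≤ t i := by simpa using hi
    have h3 := ht i
    rw [abs_of_nonneg (by linarith)] at h3
    have h4 := abs_lt.1 (hk2 i)
    have h5 := abs_le.1 hx
    linarith [(hfl k x (by linarith)).1]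

lemma exists_gap {x₀ : ℝ} (hx₀ : x₀ ∈ Ioo 0 L) (ht : ∀ i, t i ≠ x₀) :
    ∃ η, 0 < η ∧ η ≤ x₀ ∧ x₀ + η ≤ L ∧ ∀ i, η < |t i - x₀| := by
  have h1 : ∀ᶠ η in 𝓝[>] (0:ℝ), ∀ i, η < |t i - x₀| := by
    rw [eventually_all]
    intro i
    exact nhdsWithin_le_nhds (Iio_mem_nhds (abs_pos.2 (sub_ne_zero.2 (ht i))))
  have h2 : ∀ᶠ η in 𝓝[>] (0:ℝ), η < x₀ := nhdsWithin_le_nhds (Iio_mem_nhds hx₀.1)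
  have h3 : ∀ᶠ η in 𝓝[>] (0:ℝ), η < L - x₀ :=
    nhdsWithin_le_nhds (Iio_mem_nhds (sub_pos.2 hx₀.2))
  have h4 : ∀ᶠ η in 𝓝[>] (0:ℝ), 0 < η := self_mem_nhdsWithin
  obtain ⟨η, a1, a2, a3, a4⟩ := (h1.and (h2.and (h3.and h4))).exists
  exact ⟨η, a4, a2.le, by linarith, a1⟩

/-- On a window free of limit knots the sum of hinges is eventually affine in `fl k x`. The L² bound
yields one point in each outer quarter where its value is at most `m` in modulus, and two values at
well separated points control slope and intercept. -/
lemma eventually_bounded_hinge (hl : Tendsto l atTop (𝓝 0))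
    (hfl : ∀ k, ∀ x, 0 ≤ x → fl k x ≤ x ∧ x < fl k x + l k)
    (hfl0 : ∀ k x, 0 ≤ fl k x)
    (hτ : ∀ i, Tendsto (fun k => τ k i) atTop (𝓝 (t i)))
    {f r : ℕ → ℝ → ℝ} {M C : ℝ} (hf : ∀ k, eLpNorm (f k) 2 (vol L) ≤ ENNReal.ofReal M)
    (hr : ∀ k, ∀ x ∈ Ioo 0 L, |r k x| ≤ C)
    (hfr : ∀ k, ∀ x ∈ Ioo 0 L, f k x = hingeSum (a k) (b k) (τ k) (δ k) (fl k x) + r k x)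
    {x₀ : ℝ} (hx₀ : x₀ ∈ Ioo 0 L) (ht : ∀ i, t i ≠ x₀) :
    ∃ D, ∀ᶠ k in atTop,
      |hingeValue (a k) (τ k) (δ k) (Finset.univ.filter (t · < x₀))| ≤ D ∧
      |hingeSlope (b k) (δ k) (Finset.univ.filter (t · < x₀))| ≤ D := by
  obtain ⟨η, hη, hη0, hηL, htη⟩ := exists_gap hx₀ ht
  set m := (|M| + 1) / √(η / 4) + C with hm
  refine ⟨m + 8 * m / η * L + 8 * m / η, ?_⟩
  filter_upwards [eventually_hingeSum_eq (a := a) (b := b) (δ := δ) hl hfl hτ hη hη0 htη]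
    with k ⟨hk, hkx⟩
  set A := hingeValue (a k) (τ k) (δ k) (Finset.univ.filter (t · < x₀))
  set B := hingeSlope (b k) (δ k) (Finset.univ.filter (t · < x₀))
  have point : ∀ p, x₀ - η / 2 ≤ p → p + η / 4 ≤ x₀ + η / 2 →
      ∃ x ∈ Ioo p (p + η / 4), |A + B * fl k x| ≤ m := by
    intro p hp1 hp2
    obtain ⟨x, hx, hxm⟩ := exists_abs_le_of_eLpNorm (hf k) (p := p) (q := p + η / 4)
      (by linarith) (by linarith) (by linarith)
    have hxI : x ∈ Ioo 0 L := ⟨by linarith [hx.1], by linarith [hx.2]⟩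
    refine ⟨x, hx, ?_⟩
    rw [← hkx x (abs_le.2 ⟨by linarith [hx.1], by linarith [hx.2]⟩)]
    rw [show hingeSum (a k) (b k) (τ k) (δ k) (fl k x) = f k x - r k x by
      rw [hfr k x hxI]; ring]
    refine (abs_sub _ _).trans ?_
    rw [add_sub_cancel_left] at hxm
    exact add_le_add hxm (hr k x hxI)
  obtain ⟨x₁, hx₁, h1⟩ := point (x₀ - η / 2) le_rfl (by linarith)
  obtain ⟨x₂, hx₂, h2⟩ := point (x₀ + η / 4) (by linarith) (by linarith)
  have hm0 : 0 ≤ m := (abs_nonneg _).trans h1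
  have g1 := hfl k x₁ (by linarith [hx₁.1])
  have g2 := hfl k x₂ (by linarith [hx₂.1])
  -- The points are at least `η / 2` apart and rounding to the grid loses less than `η / 4`.
  have hgap : η / 4 ≤ fl k x₂ - fl k x₁ := by linarith [hx₁.2, hx₂.1]
  have hB : |B| ≤ 8 * m / η := by
    rw [le_div_iff₀ hη]
    have h3 : |B| * (fl k x₂ - fl k x₁) ≤ 2 * m := by
      rw [← abs_of_pos (show 0 < fl k x₂ - fl k x₁ by linarith), ← abs_mul,
        show B * (fl k x₂ - fl k x₁) = (A + B * fl k x₂) - (A + B * fl k x₁) by ring]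
      exact (abs_sub _ _).trans (by linarith)
    nlinarith [abs_nonneg B]
  have hA : |A| ≤ m + 8 * m / η * L := by
    rw [show A = (A + B * fl k x₁) - B * fl k x₁ by ring]
    refine (abs_sub _ _).trans (add_le_add h1 ?_)
    rw [abs_mul, abs_of_nonneg (hfl0 k x₁)]
    refine mul_le_mul hB ?_ (hfl0 k x₁) (by positivity)
    linarith [hx₁.2]
  have hL0 : 0 ≤ L := (hx₀.1.trans hx₀.2).le
  exact ⟨hA.trans (by have : 0 ≤ 8 * m / η := by positivity
                      linarith), hB.trans (by
    have : 0 ≤ 8 * m / η * L := by positivity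
    linarith)⟩

/-- Sums of boundedly many hinges with convergent knots that are bounded in `L²` up to a bounded
remainder have subsequences with convergent affine pieces. -/
lemma exists_subseq_tendsto_hinge (hl : Tendsto l atTop (𝓝 0))
    (hfl : ∀ k, ∀ x, 0 ≤ x → fl k x ≤ x ∧ x < fl k x + l k)
    (hfl0 : ∀ k x, 0 ≤ fl k x)
    (hτ : ∀ i, Tendsto (fun k => τ k i) atTop (𝓝 (t i)))
    {f r : ℕ → ℝ → ℝ} {M C : ℝ} (hf : ∀ k, eLpNorm (f k) 2 (vol L) ≤ ENNReal.ofReal M)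
    (hr : ∀ k, ∀ x ∈ Ioo 0 L, |r k x| ≤ C)
    (hfr : ∀ k, ∀ x ∈ Ioo 0 L, f k x = hingeSum (a k) (b k) (τ k) (δ k) (fl k x) + r k x) :
    ∃ ψ : ℕ → ℕ, StrictMono ψ ∧ ∃ A B : Finset (Fin K) → ℝ,
      ∀ x₀ ∈ Ioo 0 L, (∀ i, t i ≠ x₀) →
        Tendsto (fun k => hingeValue (a (ψ k)) (τ (ψ k)) (δ (ψ k))
          (Finset.univ.filter (t · < x₀))) atTop (𝓝 (A (Finset.univ.filter (t · < x₀)))) ∧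
        Tendsto (fun k => hingeSlope (b (ψ k)) (δ (ψ k))
          (Finset.univ.filter (t · < x₀))) atTop (𝓝 (B (Finset.univ.filter (t · < x₀)))) := by
  classical
  let rel : Finset (Fin K) → Prop := fun S =>
    ∃ x₀ ∈ Ioo 0 L, (∀ i, t i ≠ x₀) ∧ S = Finset.univ.filter (t · < x₀)
  -- Boundedness is known only for sets of knots lying to the left of some regular point. All others
  -- get the value 0, so the whole family lies eventually in a bounded subset of a finite product
  -- and one extraction serves all pieces.
  let X : ℕ → Finset (Fin K) → ℝ × ℝ := fun k S =>
    if rel S then (hingeValue (a k) (τ k) (δ k) S, hingeSlope (b k) (δ k) S) else 0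
  have hD : ∀ S, ∃ D, ∀ᶠ k in atTop, X k S ∈ Metric.closedBall (0 : ℝ × ℝ) D := by
    intro S
    by_cases hS : rel S
    · obtain ⟨x₀, hx₀, ht, rfl⟩ := id hS
      obtain ⟨D, hD⟩ := eventually_bounded_hinge hl hfl hfl0 hτ hf hr hfr hx₀ ht
      refine ⟨D, hD.mono fun k hk => ?_⟩
      simp only [X, if_pos hS, mem_closedBall_zero_iff]
      exact norm_prod_le_iff.2 hk
    · refine ⟨0, .of_forall fun k => ?_⟩
      simp [X, if_neg hS]
  choose D hD using hD
  have hbd : Bornology.IsBounded (Set.pi univ fun S => Metric.closedBall (0 : ℝ × ℝ) (D S)) :=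
    Bornology.IsBounded.pi fun S => Metric.isBounded_closedBall
  have hev : ∀ᶠ k in atTop, X k ∈ Set.pi univ fun S => Metric.closedBall (0 : ℝ × ℝ) (D S) := by
    filter_upwards [eventually_all.2 hD] with k hk S _
    exact hk S
  obtain ⟨Y, -, ψ, hψ, hlim⟩ := tendsto_subseq_of_frequently_bounded hbd hev.frequently
  refine ⟨ψ, hψ, fun S => (Y S).1, fun S => (Y S).2, fun x₀ hx₀ ht => ?_⟩
  set S := Finset.univ.filter (t · < x₀) with hS
  have hrel : rel S := ⟨x₀, hx₀, ht, hS⟩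
  have h1 := (tendsto_pi_nhds.1 hlim) S
  simp only [Function.comp_apply, X, if_pos hrel] at h1
  exact ⟨(continuous_fst.tendsto _).comp h1, (continuous_snd.tendsto _).comp h1⟩

/-- Limits of the affine pieces are known only at regular points; the piece just to the right of a
knot is read off at such a `z`, and the next lemma does the same on the left. -/
lemma exists_between_knots {x y : ℝ} (hxy : x < y) (t : Fin K → ℝ) :
    ∃ z ∈ Ioo x y, (∀ i, t i ≠ z) ∧ (∀ i, t i ≤ x ∨ z < t i) := by
  have h1 : ∀ᶠ z in 𝓝[>] x, ∀ i, t i ≠ z ∧ (t i ≤ x ∨ z < t i) := by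
    rw [eventually_all]
    intro i
    rcases le_or_gt (t i) x with h | h
    · filter_upwards [self_mem_nhdsWithin] with z hz
      exact ⟨(h.trans_lt hz).ne, .inl h⟩
    · filter_upwards [nhdsWithin_le_nhds (Iio_mem_nhds h)] with z hz
      exact ⟨(ne_of_gt hz), .inr hz⟩
  obtain ⟨z, hz, hz'⟩ := (h1.and (Ioo_mem_nhdsGT hxy)).exists
  exact ⟨z, hz', fun i => (hz i).1, fun i => (hz i).2⟩

lemma exists_between_knots_left {x y : ℝ} (hxy : x < y) (t : Fin K → ℝ) :
    ∃ z ∈ Ioo x y, (∀ i, t i ≠ z) ∧ (∀ i, t i < z ∨ y ≤ t i) := by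
  have h1 : ∀ᶠ z in 𝓝[<] y, ∀ i, t i ≠ z ∧ (t i < z ∨ y ≤ t i) := by
    rw [eventually_all]
    intro i
    rcases lt_or_ge (t i) y with h | h
    · filter_upwards [nhdsWithin_le_nhds (Ioi_mem_nhds h)] with z hz
      exact ⟨ne_of_lt hz, .inl hz⟩
    · filter_upwards [self_mem_nhdsWithin] with z hz
      exact ⟨(lt_of_lt_of_le hz h).ne', .inr h⟩
  obtain ⟨z, hz, hz'⟩ := (h1.and (Ioo_mem_nhdsLT hxy)).exists
  exact ⟨z, hz', fun i => (hz i).1, fun i => (hz i).2⟩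

/-- The limit of sums of hinges: a piecewise affine function; where only one knot
accumulates, the limit is continuous. -/
lemma exists_hinge_limit (hl : Tendsto l atTop (𝓝 0))
    (hfl : ∀ k, ∀ x, 0 ≤ x → fl k x ≤ x ∧ x < fl k x + l k)
    (hτ : ∀ i, Tendsto (fun k => τ k i) atTop (𝓝 (t i))) {A B : Finset (Fin K) → ℝ}
    (hAB : ∀ x₀ ∈ Ioo 0 L, (∀ i, t i ≠ x₀) →
        Tendsto (fun k => hingeValue (a k) (τ k) (δ k)
          (Finset.univ.filter (t · < x₀))) atTop (𝓝 (A (Finset.univ.filter (t · < x₀)))) ∧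
        Tendsto (fun k => hingeSlope (b k) (δ k)
          (Finset.univ.filter (t · < x₀))) atTop (𝓝 (B (Finset.univ.filter (t · < x₀))))) :
    ∃ (P : Finset ℝ) (s d : ℝ → ℝ) (a' b' : ℝ), (∀ p ∈ P, p ∈ Ioo 0 L) ∧
      (∀ x ∈ Ioo 0 L, (∀ i, t i ≠ x) →
        Tendsto (fun k => hingeSum (a k) (b k) (τ k) (δ k) (fl k x)) atTop
          (𝓝 (pieced (fun x => a' + b' * (x - 0)) P (fun p x => s p + d p * (x - p)) x))) ∧
      ∀ p ∈ P, (∃ i j, i ≠ j ∧ t i = p ∧ t j = p) ∨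
        ∃ i, t i = p ∧ s p = 0 ∧ Tendsto (fun k => δ k i) atTop (𝓝 (d p)) := by
  classical
  -- Knots that accumulate at 0 or `L` create no singularity: those at 0 enter the base function
  -- through `hi 0`, those at `L` never become active.
  set P := (Finset.univ.image t).filter (· ∈ Ioo 0 L) with hP
  set lo : ℝ → Finset (Fin K) := fun x => Finset.univ.filter (t · < x) with hlo
  set hi : ℝ → Finset (Fin K) := fun x => Finset.univ.filter (t · ≤ x) with hhi
  have hPI : ∀ p ∈ P, p ∈ Ioo 0 L := fun p hp => (Finset.mem_filter.1 hp).2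
  have hstep : ∀ x y, 0 ≤ x → x < y → y ≤ L → (∀ p ∈ P, ¬ (x < p ∧ p < y)) → lo y = hi x := by
    intro x y hx hxy hy h
    refine Finset.filter_congr fun i _ => ⟨fun h1 => ?_, fun h1 => h1.trans_lt hxy⟩
    by_contra h2
    refine h (t i) (Finset.mem_filter.2 ⟨Finset.mem_image_of_mem t (Finset.mem_univ i),
      hx.trans_lt (not_le.1 h2), h1.trans_le hy⟩) ⟨not_le.1 h2, h1⟩
  -- This is the difference at `p` of the limiting affine functions to its right and to its left.
  set s : ℝ → ℝ := fun p => (A (hi p) - A (lo p)) + (B (hi p) - B (lo p)) * p with hs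
  set d : ℝ → ℝ := fun p => B (hi p) - B (lo p) with hd
  have htele : ∀ c : Finset (Fin K) → ℝ, ∀ x ∈ Ioo 0 L,
      c (lo x) = c (hi 0) + ∑ p ∈ P, if p < x then c (hi p) - c (lo p) else 0 := fun c x hx =>
    telescope_step (lo := fun y => c (lo y)) (hi := fun y => c (hi y))
      (fun x y h1 h2 h3 h4 => congrArg c (hstep x y h1 h2 h3 h4)) (fun p hp => (hPI p hp).1)
      hx.1 hx.2.le
  have hlo_eq : ∀ p ∈ Ioo 0 L, ∃ z ∈ Ioo 0 L, (∀ i, t i ≠ z) ∧ lo z = lo p := by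
    intro p hp
    obtain ⟨z, hz, h1, h2⟩ := exists_between_knots_left hp.1 t
    refine ⟨z, ⟨hz.1, hz.2.trans hp.2⟩, h1, Finset.filter_congr fun i _ =>
      ⟨fun h => h.trans hz.2, fun h => ?_⟩⟩
    exact (h2 i).resolve_right (not_le.2 h)
  have hhi_eq : ∀ p ∈ Ioo 0 L, ∃ z ∈ Ioo 0 L, (∀ i, t i ≠ z) ∧ lo z = hi p := by
    intro p hp
    obtain ⟨z, hz, h1, h2⟩ := exists_between_knots hp.2 t
    refine ⟨z, ⟨hp.1.trans hz.1, hz.2⟩, h1, Finset.filter_congr fun i _ =>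
      ⟨fun h => ?_, fun h => h.trans_lt hz.1⟩⟩
    exact (h2 i).resolve_right (not_lt.2 h.le)
  refine ⟨P, s, d, A (hi 0), B (hi 0), hPI, ?_, ?_⟩
  · intro x hx hxt
    obtain ⟨η, hη, hη0, -, htη⟩ := exists_gap hx hxt
    obtain ⟨hA, hB⟩ := hAB x hx hxt
    have hflx : Tendsto (fun k => fl k x) atTop (𝓝 x) := by
      have h0 : Tendsto (fun k => x - l k) atTop (𝓝 x) := by
        simpa using tendsto_const_nhds.sub hl
      exact tendsto_of_tendsto_of_tendsto_of_le_of_le h0 tendsto_const_nhds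
        (fun k => by linarith [(hfl k x hx.1.le).2]) (fun k => (hfl k x hx.1.le).1)
    have hlim := hA.add (hB.mul hflx)
    have e : pieced (fun x => A (hi 0) + B (hi 0) * (x - 0)) P
        (fun p x => s p + d p * (x - p)) x = A (lo x) + B (lo x) * x := by
      rw [htele A x hx, htele B x hx, pieced]
      have : ∀ p, (if p < x then s p + d p * (x - p) else 0) =
          (if p < x then A (hi p) - A (lo p) else 0) +
            (if p < x then B (hi p) - B (lo p) else 0) * x := by
        intro p
        split_ifs
        · simp only [hs, hd]; ring
        · ring
      simp_rw [this, Finset.sum_add_distrib, ← Finset.sum_mul]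
      ring
    rw [e]
    refine hlim.congr' ?_
    filter_upwards [eventually_hingeSum_eq (a := a) (b := b) (δ := δ) hl hfl hτ hη hη0 htη]
      with k hk
    exact (hk.2 x (by simp; positivity)).symm
  · intro p hp
    obtain ⟨i, -, hi'⟩ := Finset.mem_image.1 (Finset.mem_filter.1 hp).1
    -- A lone knot changes the slope by `δ` and the intercept by `-δτ`. The slope change converges
    -- to `d p`, hence the intercept change converges to `-(d p * p)`, and the value jump at `p`
    -- cancels.
    by_cases hj : ∃ j, i ≠ j ∧ t j = p
    · obtain ⟨j, h1, h2⟩ := hj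
      exact .inl ⟨i, j, h1, hi', h2⟩
    refine .inr ⟨i, hi', ?_⟩
    push Not at hj
    have hnot : i ∉ lo p := by simp [hlo, hi']
    have hins : hi p = insert i (lo p) := by
      ext j
      simp only [hhi, hlo, Finset.mem_filter, Finset.mem_univ, true_and, Finset.mem_insert]
      constructor
      · intro h
        by_cases hij : j = i
        · exact .inl hij
        · exact .inr (lt_of_le_of_ne h (hj j (Ne.symm hij)))
      · rintro (rfl | h)
        · exact hi'.le
        · exact h.le
    have hpI := hPI p hp
    obtain ⟨z, hz, hzt, hze⟩ := hlo_eq p hpI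
    obtain ⟨z', hz', hzt', hze'⟩ := hhi_eq p hpI
    have h1 := hAB z hz hzt
    have h2 := hAB z' hz' hzt'
    change Tendsto (fun k => hingeValue (a k) (τ k) (δ k) (lo z)) _ (𝓝 (A (lo z))) ∧
      Tendsto (fun k => hingeSlope (b k) (δ k) (lo z)) _ (𝓝 (B (lo z))) at h1
    change Tendsto (fun k => hingeValue (a k) (τ k) (δ k) (lo z')) _ (𝓝 (A (lo z'))) ∧
      Tendsto (fun k => hingeSlope (b k) (δ k) (lo z')) _ (𝓝 (B (lo z'))) at h2
    rw [hze] at h1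
    rw [hze'] at h2
    have hδ : Tendsto (fun k => δ k i) atTop (𝓝 (d p)) := by
      refine (h2.2.sub h1.2).congr fun k => ?_
      rw [hins, hingeSlope, hingeSlope, Finset.sum_insert hnot]
      ring
    have hv1 : Tendsto (fun k => -(δ k i * τ k i)) atTop (𝓝 (A (hi p) - A (lo p))) := by
      refine (h2.1.sub h1.1).congr fun k => ?_
      rw [hins, hingeValue, hingeValue, Finset.sum_insert hnot]
      ring
    have hv2 : Tendsto (fun k => -(δ k i * τ k i)) atTop (𝓝 (-(d p * p))) := by
      have := (hδ.mul (hτ i)).neg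
      rwa [hi'] at this
    have := tendsto_nhds_unique hv1 hv2
    refine ⟨?_, hδ⟩
    simp only [hs, hd] at this ⊢
    linarith

end Hinges

end BlakeZisserman
end

noncomputable section

namespace BlakeZisserman

/-! ### Compactness and the lower bound -/

lemma integral_abs_le_of_sq {L C : ℝ} (hL : 0 ≤ L) {f : ℝ → ℝ} (hf : MemLp f 2 (vol L))
    (hC : ∫ x, f x ^ 2 ∂vol L ≤ C) : ∫ x, |f x| ∂vol L ≤ L + C := by
  have h1 : ∫ x, |f x| ∂vol L ≤ ∫ x, (1 + f x ^ 2) ∂vol L := by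
    refine integral_mono (integrable_of_memLp_two hf).abs
      ((integrable_const 1).add hf.integrable_sq) fun x => ?_
    simp only
    nlinarith [sq_nonneg (|f x| - 1), sq_abs (f x), abs_nonneg (f x)]
  rw [integral_add (integrable_const 1) hf.integrable_sq] at h1
  have h2 : ∫ _, (1:ℝ) ∂vol L = L := by
    simp [vol, hL]
  linarith

/-! ### The kernel of the second primitive and its grid version. -/

section Kernel

variable {L C : ℝ} {n : ℕ} {f : ℝ → ℝ}

lemma measurable_gridFloor (L : ℝ) (n : ℕ) : Measurable (gridFloor L n) :=
  measurable_comp_cell (L := L) (n := n) fun i => (i : ℝ) * mesh L n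

lemma integrable_mul_kernel {h : ℝ → ℝ} {D : ℝ} (hf : Integrable f (vol L)) (hh : Measurable h)
    (hD : ∀ s ∈ Ioo 0 L, |h s| ≤ D) : Integrable (fun s => f s * h s) (vol L) :=
  hf.mul_bdd (c := D) hh.aestronglyMeasurable (ae_restrict_of_forall_mem measurableSet_Ioo hD)

lemma abs_integral_mul_le {h : ℝ → ℝ} {D : ℝ} (hf : Integrable f (vol L))
    (hD : ∀ s ∈ Ioo 0 L, |h s| ≤ D) : |∫ s, f s * h s ∂vol L| ≤ D * ∫ s, |f s| ∂vol L := by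
  rw [← integral_const_mul, ← Real.norm_eq_abs]
  refine norm_integral_le_of_norm_le (hf.abs.const_mul D)
    (ae_restrict_of_forall_mem measurableSet_Ioo fun s hs => ?_)
  rw [norm_mul, Real.norm_eq_abs, Real.norm_eq_abs, mul_comm]
  exact mul_le_mul_of_nonneg_right (hD s hs) (abs_nonneg _)

lemma abs_max_sub_le {x s : ℝ} (hx : x ∈ Ioo 0 L) (hs : s ∈ Ioo 0 L) : |max (x - s) 0| ≤ L := by
  rw [abs_of_nonneg (le_max_right _ _)]
  exact max_le (by linarith [hx.2, hs.1]) (hx.1.trans hx.2).le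

lemma abs_max_gridFloor_le (hL : 0 < L) (hn : 0 < n) {x s : ℝ} (hx : x ∈ Ioo 0 L) :
    |max (gridFloor L n x - gridFloor L n s) 0| ≤ L := by
  rw [abs_of_nonneg (le_max_right _ _)]
  exact max_le (by linarith [hx.2, gridFloor_le hL hn hx.1.le, gridFloor_nonneg hL hn s]) hL.le

/-- The discrete second primitive is close to the continuous one. -/
lemma abs_integral_kernel_sub_le (hL : 0 < L) (hn : 0 < n) (hf : Integrable f (vol L)) {x : ℝ}
    (hx : x ∈ Ioo 0 L) :
    |(∫ s, f s * max (gridFloor L n x - gridFloor L n s) 0 ∂vol L) -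
      ∫ s, f s * max (x - s) 0 ∂vol L| ≤ mesh L n * ∫ s, |f s| ∂vol L := by
  have hm : Measurable fun s => max (gridFloor L n x - gridFloor L n s) 0 :=
    (measurable_const.sub (measurable_gridFloor L n)).max measurable_const
  rw [← integral_sub
    (integrable_mul_kernel hf hm fun s _ => abs_max_gridFloor_le hL hn hx)
    (integrable_mul_kernel hf (by fun_prop) fun s hs => abs_max_sub_le hx hs)]
  simp_rw [← mul_sub]
  exact abs_integral_mul_le hf fun s hs => abs_max_gridFloor_sub_le hL hn hx.1.le hs.1.le

end Kernel

/-- Discrete second primitives of weakly convergent functions converge. -/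
lemma tendsto_integral_kernel {L : ℝ} (hL : 0 < L) {N : ℕ → ℕ} (hN : Tendsto N atTop atTop)
    (hN0 : ∀ k, 0 < N k) {f : ℕ → ℝ → ℝ} (hf : ∀ k, MemLp (f k) 2 (vol L)) {C : ℝ}
    (hC : ∀ k, ∫ x, f k x ^ 2 ∂vol L ≤ C) {w : ℝ → ℝ} (hwi : Integrable w)
    (hlim : ∀ g : ℝ → ℝ, MemLp g 2 (vol L) →
      Tendsto (fun k => ∫ x, f k x * g x ∂vol L) atTop (𝓝 (∫ x, w x * g x ∂vol L)))
    {x : ℝ} (hx : x ∈ Ioo 0 L) :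
    Tendsto (fun k => ∫ s, f k s * max (gridFloor L (N k) x - gridFloor L (N k) s) 0 ∂vol L)
      atTop (𝓝 (doublePrim w x)) := by
  rw [doublePrim_eq_integral hwi ⟨hx.1.le, hx.2.le⟩]
  have hg : MemLp (fun s => max (x - s) 0) 2 (vol L) :=
    MemLp.of_bound (by fun_prop) L (ae_restrict_of_forall_mem measurableSet_Ioo
      fun s hs => abs_max_sub_le hx hs)
  have h1 := hlim _ hg
  have h2 : Tendsto (fun k =>
      (∫ s, f k s * max (gridFloor L (N k) x - gridFloor L (N k) s) 0 ∂vol L) -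
        ∫ s, f k s * max (x - s) 0 ∂vol L) atTop (𝓝 0) := by
    have h3 : Tendsto (fun k => mesh L (N k) * (L + C)) atTop (𝓝 0) := by
      simpa using ((tendsto_mesh L).comp hN).mul_const (L + C)
    refine squeeze_zero_norm (fun k => ?_) h3
    exact (abs_integral_kernel_sub_le hL (hN0 k) (integrable_of_memLp_two (hf k)) hx).trans
      (mul_le_mul_of_nonneg_left (integral_abs_le_of_sq hL.le (hf k) (hC k))
        (mesh_pos hL (hN0 k)).le)
  simpa using h2.add h1

/-- Knot costs dominate the costs of the singularities of the limit. -/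
lemma eventually_sum_cost_ge {α β c₂ : ℝ} (hα : 0 < α) (hαβ : α ≤ β) (hc₂ : 0 < c₂) {K : ℕ}
    {l : ℕ → ℝ} (hl : Tendsto l atTop (𝓝 0)) {δ cost : ℕ → Fin K → ℝ}
    (h1 : ∀ k i, β / 2 ≤ cost k i) (h2 : ∀ k i, |δ k i| * √(l k) ≤ c₂ → α ≤ cost k i)
    {t : Fin K → ℝ} {P : Finset ℝ} {s d : ℝ → ℝ}
    (hP : ∀ p ∈ P, (∃ i j, i ≠ j ∧ t i = p ∧ t j = p) ∨
        ∃ i, t i = p ∧ s p = 0 ∧ Tendsto (fun k => δ k i) atTop (𝓝 (d p))) :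
    ∀ᶠ k in atTop, (∑ p ∈ P, if s p ≠ 0 then β else if d p ≠ 0 then α else 0) ≤ ∑ i, cost k i := by
  classical
  have hβ : 0 < β := hα.trans_le hαβ
  have hpos : ∀ k i, 0 ≤ cost k i := fun k i => (by linarith : 0 ≤ β / 2).trans (h1 k i)
  have key : ∀ᶠ k in atTop, ∀ p ∈ P, (if s p ≠ 0 then β else if d p ≠ 0 then α else 0) ≤
      ∑ i ∈ Finset.univ.filter (t · = p), cost k i := by
    rw [Finset.eventually_all]
    intro p hp
    -- Two knots pay `β / 2` each, enough for any singularity. A lone knot makes no jump and has a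
    -- convergent slope change, so the product with `√(l k)` falls below `c₂` and it pays `α`.
    rcases hP p hp with ⟨i, j, hij, hi, hj⟩ | ⟨i, hi, hs, hd⟩
    · refine .of_forall fun k => ?_
      have hsub : ({i, j} : Finset (Fin K)) ⊆ Finset.univ.filter (t · = p) := by
        intro m hm
        rcases Finset.mem_insert.1 hm with rfl | hm
        · simp [hi]
        · rw [Finset.mem_singleton.1 hm]; simp [hj]
      have h3 := Finset.sum_le_sum_of_subset_of_nonneg hsub (f := cost k)
        fun m _ _ => hpos k m
      rw [Finset.sum_pair hij] at h3
      have h4 : (if s p ≠ 0 then β else if d p ≠ 0 then α else 0) ≤ β := by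
        split_ifs <;> linarith
      linarith [h1 k i, h1 k j]
    · have h3 : Tendsto (fun k => |δ k i| * √(l k)) atTop (𝓝 0) := by
        have := hd.abs.mul ((Real.continuous_sqrt.tendsto 0).comp hl)
        simpa using this
      filter_upwards [h3.eventually_lt_const hc₂] with k hk
      have h4 := Finset.single_le_sum (f := cost k) (s := Finset.univ.filter (t · = p))
        (fun m _ => hpos k m) (a := i) (by simp [hi])
      have h5 := h2 k i hk.le
      rw [if_neg (by simp [hs])]
      split_ifs <;> linarith
  filter_upwards [key] with k hk
  refine (Finset.sum_le_sum hk).trans ?_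
  -- Fibres of `t` over distinct points are disjoint, so no knot is charged twice.
  rw [← Finset.sum_biUnion]
  · exact Finset.sum_le_sum_of_subset_of_nonneg (Finset.subset_univ _) fun i _ _ => hpos k i
  · intro p _ q _ hpq
    simp only [Function.onFun]
    rw [Finset.disjoint_left]
    intro i hi hi'
    exact hpq ((Finset.mem_filter.1 hi).2.symm.trans (Finset.mem_filter.1 hi').2)

lemma discreteEnergy_nonneg {L α β c₁ c₂ : ℝ} (hL : 0 < L) (hα : 0 < α) (hβ : 0 < β) {n : ℕ}
    (u : Grid n) : 0 ≤ discreteEnergy L α β c₁ c₂ n u := by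
  have hm : 0 ≤ mesh L n := div_nonneg hL.le (Nat.cast_nonneg n)
  rw [discreteEnergy_eq]
  refine Finset.sum_nonneg fun i _ => mul_nonneg hm ?_
  unfold psi
  split_ifs <;> positivity

/-- Compactness and the lower bound, along a sequence of meshes. -/
theorem exists_subseq_limit_of_pos {L α β c₁ c₂ : ℝ} (hL : 0 < L) (hα : 0 < α) (hαβ : α ≤ β)
    (hβα : β ≤ 2 * α) (hc₂ : 0 < c₂) (u : (n : ℕ) → Grid n) {N : ℕ → ℕ}
    (hN : StrictMono N) (hN0 : ∀ k, 0 < N k) {C M : ℝ}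
    (hE : ∀ k, discreteEnergy L α β c₁ c₂ (N k) (u (N k)) ≤ C)
    (hM : ∀ k, eLpNorm (step L (N k) (u (N k))) 2 (vol L) ≤ ENNReal.ofReal M) :
    ∃ ψ : ℕ → ℕ, StrictMono ψ ∧ ∃ v : ℝ → ℝ, MemPiecewiseH2 L v ∧
      (∀ᵐ x ∂vol L,
        Tendsto (fun k => step L (N (ψ k)) (u (N (ψ k))) x) atTop (𝓝 (v x))) ∧
      TendstoLp 1 L (fun k => step L (N (ψ k)) (u (N (ψ k)))) v ∧
      ∀ e < energy L α β v,
        ∀ᶠ k in atTop, e < discreteEnergy L α β c₁ c₂ (N (ψ k)) (u (N (ψ k))) := by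
  classical
  have hβ : 0 < β := hα.trans_le hαβ
  -- a subsequence with a constant number of knots
  let Dec : ℕ → ℕ → Prop := fun K k => ∃ (a b : ℝ) (τ δ cost : Fin K → ℝ) (F : ℕ → ℝ),
      (∀ i, τ i ∈ Icc 0 L) ∧ (∀ i, β / 2 ≤ cost i) ∧
      (∀ i, |δ i| * √(mesh L (N k)) ≤ c₂ → α ≤ cost i) ∧
      discreteEnergy L α β c₁ c₂ (N k) (u (N k)) =
        (∫ x, F (cell L (N k) x) ^ 2 ∂vol L) + ∑ i, cost i ∧
      ∀ x ∈ Ico 0 L, step L (N k) (u (N k)) x =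
        hingeSum a b τ δ (gridFloor L (N k) x) +
        ∫ s, F (cell L (N k) s) * max (gridFloor L (N k) x - gridFloor L (N k) s) 0 ∂vol L
  -- Each knot costs at least `β / 2`, so the energy bound allows at most `2 * C / β` of them.
  obtain ⟨K₀, hK₀⟩ := exists_nat_ge (2 * C / β)
  have hdec : ∀ k, ∃ K ∈ Finset.range (K₀ + 1), Dec K k := by
    intro k
    obtain ⟨K, hK⟩ := exists_decomposition (c₁ := c₁) (c₂ := c₂) hL hβα (hN0 k) (u (N k))
    refine ⟨K, ?_, hK⟩
    obtain ⟨a, b, τ, δ, cost, F, -, hc, -, hen, -⟩ := hK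
    have h1 : K * (β / 2) ≤ ∑ i, cost i := by
      have := Finset.card_nsmul_le_sum Finset.univ cost (β / 2) fun i _ => hc i
      simpa using this
    have h2 : 0 ≤ ∫ x, F (cell L (N k) x) ^ 2 ∂vol L := integral_nonneg fun x => sq_nonneg _
    have h3 : (K : ℝ) ≤ K₀ := by
      refine le_trans ?_ hK₀
      rw [le_div_iff₀ hβ]
      linarith [hE k]
    rw [Finset.mem_range]
    have : K ≤ K₀ := by exact_mod_cast h3
    omega
  obtain ⟨K, hK⟩ : ∃ K, ∃ᶠ k in atTop, Dec K k := by
    by_contra! hcon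
    have h1 : ∀ᶠ k in atTop, ∀ K ∈ Finset.range (K₀ + 1), ¬ Dec K k := by
      rw [Finset.eventually_all]
      intro K _
      exact hcon K
    obtain ⟨k, hk⟩ := h1.exists
    obtain ⟨K, hK, hd⟩ := hdec k
    exact hk K hK hd
  obtain ⟨φ₁, hφ₁, hd⟩ := extraction_of_frequently_atTop hK
  choose a b τ δ cost F hτI hc1 hc2 hen hst using hd
  -- convergent knots
  obtain ⟨t, -, φ₂, hφ₂, hτ⟩ := tendsto_subseq_of_bounded (s := Set.pi univ fun _ => Icc 0 L)
    (Bornology.IsBounded.pi fun _ => Metric.isBounded_Icc 0 L) (x := τ)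
    (fun k i _ => hτI k i)
  have hτ' := tendsto_pi_nhds.1 hτ
  -- weakly convergent second derivatives
  have hwk : ∀ k, MemLp (fun x => F (φ₂ k) (cell L (N (φ₁ (φ₂ k))) x)) 2 (vol L) := fun k =>
    memLp_comp_cell hL (hN0 _) _ 2
  have hwC : ∀ k, ∫ x, F k (cell L (N (φ₁ k)) x) ^ 2 ∂vol L ≤ C := fun k => by
    have h1 : 0 ≤ ∑ i, cost k i :=
      Finset.sum_nonneg fun i _ => (by linarith : 0 ≤ β / 2).trans (hc1 k i)
    linarith [hen k, hE (φ₁ k)]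
  obtain ⟨φ₃, hφ₃, w₀, hw₀, hweak⟩ := exists_subseq_weak_tendsto hwk (fun k => hwC (φ₂ k))
  set w := (Ioo 0 L).indicator w₀ with hwdef
  have hww : w =ᵐ[vol L] w₀ := indicator_ae_eq_vol w₀
  have hw : MemLp w 2 (vol L) := (memLp_congr_ae hww).2 hw₀
  have hwi : Integrable w := integrable_indicator_of_memLp hw₀
  -- convergent affine pieces
  set θ : ℕ → ℕ := fun k => φ₂ (φ₃ k) with hθ
  have hθm : StrictMono θ := hφ₂.comp hφ₃
  set n : ℕ → ℕ := fun k => N (φ₁ (θ k)) with hn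
  have hnm : StrictMono n := hN.comp (hφ₁.comp hθm)
  have hn0 : ∀ k, 0 < n k := fun k => hN0 _
  set wn : ℕ → ℝ → ℝ := fun k x => F (θ k) (cell L (n k) x) with hwn
  have hwn2 : ∀ k, MemLp (wn k) 2 (vol L) := fun k => hwk (φ₃ k)
  have hwnC : ∀ k, ∫ x, wn k x ^ 2 ∂vol L ≤ C := fun k => hwC (θ k)
  have hweak' : ∀ g : ℝ → ℝ, MemLp g 2 (vol L) →
      Tendsto (fun k => ∫ x, wn k x * g x ∂vol L) atTop (𝓝 (∫ x, w x * g x ∂vol L)) := by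
    intro g hg
    have e : ∫ x, w x * g x ∂vol L = ∫ x, w₀ x * g x ∂vol L :=
      integral_congr_ae (hww.mul .rfl)
    rw [e]
    exact hweak g hg
  set r : ℕ → ℝ → ℝ := fun k x =>
    ∫ s, wn k s * max (gridFloor L (n k) x - gridFloor L (n k) s) 0 ∂vol L with hr
  have hrC : ∀ k, ∀ x ∈ Ioo 0 L, |r k x| ≤ L * (L + C) := fun k x hx =>
    (abs_integral_mul_le (integrable_of_memLp_two (hwn2 k))
      fun s _ => abs_max_gridFloor_le hL (hn0 k) hx).trans
      (mul_le_mul_of_nonneg_left (integral_abs_le_of_sq hL.le (hwn2 k) (hwnC k)) hL.le)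
  have hl : Tendsto (fun k => mesh L (n k)) atTop (𝓝 0) :=
    (tendsto_mesh L).comp hnm.tendsto_atTop
  have hfl : ∀ k, ∀ x, 0 ≤ x → gridFloor L (n k) x ≤ x ∧ x < gridFloor L (n k) x + mesh L (n k) :=
    fun k x hx => ⟨gridFloor_le hL (hn0 k) hx, lt_gridFloor_add hL (hn0 k) x⟩
  have hτθ : ∀ i, Tendsto (fun k => τ (θ k) i) atTop (𝓝 (t i)) := fun i =>
    (hτ' i).comp hφ₃.tendsto_atTop
  have hstep : ∀ k, ∀ x ∈ Ioo 0 L, step L (n k) (u (n k)) x =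
      hingeSum (a (θ k)) (b (θ k)) (τ (θ k)) (δ (θ k)) (gridFloor L (n k) x) + r k x :=
    fun k x hx => hst (θ k) x ⟨hx.1.le, hx.2⟩
  obtain ⟨φ₄, hφ₄, A, B, hAB⟩ := exists_subseq_tendsto_hinge
    (a := fun k => a (θ k)) (b := fun k => b (θ k)) (δ := fun k => δ (θ k)) hl hfl
    (fun k x => gridFloor_nonneg hL (hn0 k) x) hτθ (fun k => hM (φ₁ (θ k))) hrC hstep
  have hl4 := hl.comp hφ₄.tendsto_atTop
  obtain ⟨P, s, d, a', b', hPI, hlim, hPc⟩ := exists_hinge_limit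
    (a := fun k => a (θ (φ₄ k))) (b := fun k => b (θ (φ₄ k))) (δ := fun k => δ (θ (φ₄ k)))
    hl4 (fun k => hfl (φ₄ k)) (fun i => (hτθ i).comp hφ₄.tendsto_atTop) hAB
  set v := repFun w P s d a' b' with hv
  have hrep : IsRep L v w P s d a' b' := ⟨hw, hwi, hPI, .rfl⟩
  have hpt : ∀ x ∈ Ioo 0 L, (∀ i, t i ≠ x) →
      Tendsto (fun k => step L (n (φ₄ k)) (u (n (φ₄ k))) x) atTop (𝓝 (v x)) := by
    intro x hx hxt
    have h1 := hlim x hx hxt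
    have h2 := (tendsto_integral_kernel hL hnm.tendsto_atTop hn0 hwn2 hwnC hwi hweak' hx).comp
      hφ₄.tendsto_atTop
    have e : v x = pieced (fun x => a' + b' * (x - 0)) P (fun p x => s p + d p * (x - p)) x +
        doublePrim w x := by
      simp only [hv, repFun, pieced]; ring
    rw [e]
    exact (h1.add h2).congr fun k => (hstep (φ₄ k) x hx).symm
  have hae : ∀ᵐ x ∂vol L,
      Tendsto (fun k => step L (n (φ₄ k)) (u (n (φ₄ k))) x) atTop (𝓝 (v x)) := by
    refine ae_vol_of_ae_diff (P := Finset.univ.image t) (.of_forall fun x hx => ?_)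
    refine hpt x hx.1 fun i hi => hx.2 ?_
    simp [← hi]
  refine ⟨fun k => φ₁ (θ (φ₄ k)), hφ₁.comp (hθm.comp hφ₄), v, hrep.memPiecewiseH2 hL.le, hae, ?_,
    ?_⟩
  · exact tendstoLp_one_of_ae (fun k => (measurable_step L _).aestronglyMeasurable)
      (fun k => hM (φ₁ (θ (φ₄ k)))) (memLp_repFun hwi 1) hae
  · intro e he
    rw [hrep.energy_eq hL.le] at he
    have h1 := eventually_sum_cost_ge (cost := fun k => cost (θ (φ₄ k))) hα hαβ hc₂ hl4
      (fun k => hc1 (θ (φ₄ k))) (fun k => hc2 (θ (φ₄ k))) hPc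
    -- Weak lower semicontinuity of the norm through `2fw - w² ≤ f²`, whose left side is affine in
    -- `f`.
    have h2 : Tendsto (fun k => 2 * (∫ x, wn (φ₄ k) x * w x ∂vol L) - ∫ x, w x ^ 2 ∂vol L) atTop
        (𝓝 (∫ x, w x ^ 2 ∂vol L)) := by
      have := (((hweak' w hw).comp hφ₄.tendsto_atTop).const_mul 2).sub_const
        (∫ x, w x ^ 2 ∂vol L)
      convert! this using 2
      simp only [← sq]
      ring
    have h3 := h2.eventually_const_lt (u := e -
      ∑ p ∈ P, if s p ≠ 0 then β else if d p ≠ 0 then α else 0) (by linarith)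
    filter_upwards [h1, h3] with k hk1 hk3
    rw [hen (θ (φ₄ k))]
    have h4 : 2 * (∫ x, wn (φ₄ k) x * w x ∂vol L) - ∫ x, w x ^ 2 ∂vol L ≤
        ∫ x, wn (φ₄ k) x ^ 2 ∂vol L := by
      have hi1 := (hwn2 (φ₄ k)).integrable_sq
      have hi2 := hw.integrable_sq
      have hi3 : Integrable (fun x => wn (φ₄ k) x * w x) (vol L) :=
        (hwn2 (φ₄ k)).integrable_mul hw
      rw [← integral_const_mul, ← integral_sub (hi3.const_mul 2) hi2]
      refine integral_mono ((hi3.const_mul 2).sub hi2) hi1 fun x => ?_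
      simp only
      nlinarith [sq_nonneg (wn (φ₄ k) x - w x)]
    simp only [hwn, hn] at h4 hk3
    linarith

/-- Compactness and the lower bound, along a sequence of meshes. -/
theorem exists_subseq_limit {L α β c₁ c₂ : ℝ} (hL : 0 < L) (hα : 0 < α) (hαβ : α ≤ β)
    (hβα : β ≤ 2 * α) (hc₂ : 0 < c₂) (u : (n : ℕ) → Grid n) {N : ℕ → ℕ}
    (hN : StrictMono N) {C M : ℝ}
    (hE : ∀ k, discreteEnergy L α β c₁ c₂ (N k) (u (N k)) ≤ C)
    (hM : ∀ k, eLpNorm (step L (N k) (u (N k))) 2 (vol L) ≤ ENNReal.ofReal M) :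
    ∃ ψ : ℕ → ℕ, StrictMono ψ ∧ ∃ v : ℝ → ℝ, MemPiecewiseH2 L v ∧
      (∀ᵐ x ∂vol L,
        Tendsto (fun k => step L (N (ψ k)) (u (N (ψ k))) x) atTop (𝓝 (v x))) ∧
      TendstoLp 1 L (fun k => step L (N (ψ k)) (u (N (ψ k)))) v ∧
      ∀ e < energy L α β v,
        ∀ᶠ k in atTop, e < discreteEnergy L α β c₁ c₂ (N (ψ k)) (u (N (ψ k))) := by
  -- `N 0` may be 0, where the mesh degenerates; dropping the first term makes all indices positive.
  have hs : StrictMono fun k : ℕ => k + 1 := fun _ _ h => Nat.succ_lt_succ h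
  obtain ⟨ψ, hψ, h⟩ := exists_subseq_limit_of_pos hL hα hαβ hβα hc₂ u (hN.comp hs)
    (fun k => (Nat.zero_le _).trans_lt (hN (Nat.lt_succ_self k))) (fun k => hE (k + 1))
    (fun k => hM (k + 1))
  exact ⟨fun k => ψ k + 1, hs.comp hψ, h⟩

end BlakeZisserman
end

noncomputable section

namespace BlakeZisserman

/-! ### Recovery sequences -/

/-- The `i`-th grid cell. -/
def cellSet (L : ℝ) (n i : ℕ) : Set ℝ := Ico (i * mesh L n) ((i + 1) * mesh L n)

/-- The values at the grid points of a canonical representative whose singular points have been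
moved to the grid. -/
def recovery (L : ℝ) (w : ℝ → ℝ) (P : Finset ℝ) (s d : ℝ → ℝ) (a b : ℝ) (n i : ℕ) : ℝ :=
  (∫ r, w r * max (i * mesh L n - gridFloor L n r) 0 ∂vol L) + (a + b * (i * mesh L n)) +
    ∑ p ∈ P, if cell L n p < i then s p + d p * (i * mesh L n - gridFloor L n p) else 0

variable {L : ℝ} {w : ℝ → ℝ} {P : Finset ℝ} {s d : ℝ → ℝ} {a b : ℝ} {n : ℕ}

lemma measurableSet_cellSet (L : ℝ) (n i : ℕ) : MeasurableSet (cellSet L n i) :=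
  measurableSet_Ico

lemma vol_cellSet_le (L : ℝ) (n i : ℕ) :
    vol L (cellSet L n i) ≤ ENNReal.ofReal (mesh L n) := by
  refine (Measure.restrict_apply_le _ _).trans ?_
  rw [cellSet, Real.volume_Ico]
  exact ENNReal.ofReal_le_ofReal (by ring_nf; rfl)

lemma restrict_vol_cellSet (hL : 0 < L) (hn : 0 < n) {i : ℕ} (hi : i < n) :
    (vol L).restrict (cellSet L n i) = volume.restrict (cellSet L n i) := by
  rw [vol_eq_Ico, Measure.restrict_restrict (measurableSet_cellSet L n i)]
  congr 1
  exact inter_eq_left.2 (Ico_subset_Ico hL hn hi)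

lemma integrableOn_cellSet (hL : 0 < L) (hn : 0 < n) {i : ℕ} (hi : i < n) {f : ℝ → ℝ}
    (hf : Integrable f (vol L)) : IntegrableOn f (cellSet L n i) := by
  rw [IntegrableOn, ← restrict_vol_cellSet hL hn hi]
  exact hf.restrict

/-- Jensen's inequality on a cell. -/
lemma sq_integral_cellSet_le (hL : 0 < L) (hn : 0 < n) {i : ℕ} (hi : i < n)
    (hw : MemLp w 2 (vol L)) :
    (∫ x in cellSet L n i, w x) ^ 2 ≤ mesh L n * ∫ x in cellSet L n i, w x ^ 2 := by
  have hl := mesh_pos hL hn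
  set y := ∫ x in cellSet L n i, w x with hy
  have i1 := integrableOn_cellSet hL hn hi (integrable_of_memLp_two hw)
  have i2 := integrableOn_cellSet hL hn hi hw.integrable_sq
  have hvol : volume.real (cellSet L n i) = mesh L n := by
    rw [cellSet, Real.volume_real_Ico, max_eq_left (by nlinarith)]
    ring
  have hfin : volume (cellSet L n i) ≠ ⊤ := by rw [cellSet, Real.volume_Ico]; simp
  have hc : IntegrableOn (fun _ : ℝ => (y / mesh L n) ^ 2) (cellSet L n i) :=
    integrableOn_const hfin
  have h0 : 0 ≤ ∫ x in cellSet L n i, (w x - y / mesh L n) ^ 2 :=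
    integral_nonneg fun x => sq_nonneg _
  have e : ∫ x in cellSet L n i, (w x - y / mesh L n) ^ 2 =
      (∫ x in cellSet L n i, w x ^ 2) - y ^ 2 / mesh L n := by
    have e1 : ∀ x, (w x - y / mesh L n) ^ 2 =
        (w x ^ 2 - 2 * (y / mesh L n) * w x) + (y / mesh L n) ^ 2 := fun x => by ring
    have i3 : IntegrableOn (fun x => w x ^ 2 - 2 * (y / mesh L n) * w x) (cellSet L n i) :=
      i2.sub (i1.const_mul _)
    simp_rw [e1]
    rw [integral_add i3 hc, integral_sub i2 (i1.const_mul _),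
      integral_const_mul, ← hy, setIntegral_const, hvol, smul_eq_mul]
    field_simp
    ring
  rw [e, sub_nonneg, div_le_iff₀ hl] at h0
  linarith

lemma abs_integral_cellSet_le (hL : 0 < L) (hn : 0 < n) {i : ℕ} (hi : i < n)
    (hw : Integrable w (vol L)) :
    |∫ x in cellSet L n i, w x| ≤ ∫ x, |w x| ∂vol L := by
  rw [← restrict_vol_cellSet hL hn hi]
  refine (abs_integral_le_integral_abs).trans ?_
  exact setIntegral_le_integral hw.abs (.of_forall fun x => abs_nonneg _)

lemma sum_integral_cellSet_le (hL : 0 < L) (hn : 0 < n) (hw : MemLp w 2 (vol L)) :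
    ∑ j ∈ Finset.range (n - 1), ∫ x in cellSet L n (j + 1), w x ^ 2 ≤ ∫ x, w x ^ 2 ∂vol L := by
  have h := integral_comp_cell_mul hL hn (fun _ => 1) hw.integrable_sq
  simp only [one_mul] at h
  obtain ⟨m, rfl⟩ : ∃ m, n = m + 1 := ⟨n - 1, by omega⟩
  rw [h, Finset.sum_range_succ', Nat.add_sub_cancel]
  refine le_add_of_le_of_nonneg le_rfl (integral_nonneg fun x => sq_nonneg _)

/-- Absolute continuity of the integral of `w ^ 2`: cells have measure at most the mesh size,
uniformly in `i`. -/
lemma eventually_integral_cellSet_le (hL : 0 < L) (hw : MemLp w 2 (vol L)) {c : ℝ} (hc : 0 < c) :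
    ∀ᶠ n in atTop, ∀ i < n, ∫ x in cellSet L n i, w x ^ 2 ≤ c := by
  have h1 : MemLp (fun x => w x ^ 2) 1 (vol L) := memLp_one_iff_integrable.2 hw.integrable_sq
  obtain ⟨δ, hδ, h⟩ := h1.eLpNorm_indicator_le le_rfl (by simp) hc
  filter_upwards [(tendsto_mesh L).eventually_lt_const hδ, eventually_gt_atTop 0] with n hn hn0 i hi
  have h2 := h (cellSet L n i) (measurableSet_cellSet L n i) ((vol_cellSet_le L n i).trans
    (ENNReal.ofReal_le_ofReal hn.le))
  rw [eLpNorm_indicator_eq_eLpNorm_restrict (measurableSet_cellSet L n i), eLpNorm_one_eq_lintegral_enorm,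
    restrict_vol_cellSet hL hn0 hi, ← ofReal_integral_norm_eq_lintegral_enorm
      (integrableOn_cellSet hL hn0 hi hw.integrable_sq),
    ENNReal.ofReal_le_ofReal_iff hc.le] at h2
  refine le_trans (le_of_eq ?_) h2
  congr 1
  ext x
  rw [Real.norm_of_nonneg (sq_nonneg _)]

/-- Hinges with knots on the grid are fundamental solutions of the discrete second difference. -/
lemma secondDiff_max (hl : 0 ≤ mesh L n) (j c : ℕ) :
    max (((j + 2 : ℕ) : ℝ) * mesh L n - c * mesh L n) 0 + max ((j : ℝ) * mesh L n - c * mesh L n) 0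
      - 2 * max (((j + 1 : ℕ) : ℝ) * mesh L n - c * mesh L n) 0 =
      if c = j + 1 then mesh L n else 0 := by
  rw [← natCast_sub_mul hl, ← natCast_sub_mul hl, ← natCast_sub_mul hl]
  rcases lt_trichotomy c (j + 1) with h | h | h
  · rw [if_neg h.ne, Nat.cast_sub (by omega), Nat.cast_sub (by omega), Nat.cast_sub (by omega)]
    push_cast; ring
  · rw [if_pos h, show j + 2 - c = 1 by omega, show j - c = 0 by omega,
      show j + 1 - c = 0 by omega]
    simp
  · rw [if_neg h.ne', show j + 2 - c = 0 by omega, show j - c = 0 by omega,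
      show j + 1 - c = 0 by omega]
    simp

/-- A jump moved to the grid is seen from the two centres `cell L n p` and `cell L n p + 1`, with
opposite signs; a slope change is seen only from the first. This is why each jump is paid in two
halves. -/
lemma secondDiff_recovery (hL : 0 < L) (hn : 0 < n) (hw : Integrable w (vol L)) {j : ℕ}
    (hj : j + 1 < n) :
    secondDiff (recovery L w P s d a b n) j = mesh L n * (∫ x in cellSet L n (j + 1), w x) +
      ∑ p ∈ P, ((if cell L n p = j + 1 then s p + d p * mesh L n else 0) +
        if cell L n p = j then - s p else 0) := by
  have hl := mesh_pos hL hn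
  set l := mesh L n with hldef
  have hi : ∀ i : ℕ, Integrable (fun r => w r * max (i * l - gridFloor L n r) 0) (vol L) := by
    intro i
    have hm : Measurable fun r => max (i * l - gridFloor L n r) 0 :=
      (measurable_const.sub (measurable_gridFloor L n)).max measurable_const
    refine integrable_mul_kernel (D := i * l) hw hm fun r _ => ?_
    rw [abs_of_nonneg (le_max_right _ _)]
    exact max_le (by linarith [gridFloor_nonneg hL hn r]) (by positivity)
  have h1 : (∫ r, w r * max ((j + 2 : ℕ) * l - gridFloor L n r) 0 ∂vol L) +
      (∫ r, w r * max (j * l - gridFloor L n r) 0 ∂vol L) -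
      2 * (∫ r, w r * max ((j + 1 : ℕ) * l - gridFloor L n r) 0 ∂vol L) =
      l * (∫ x in cellSet L n (j + 1), w x) := by
    have hi2 : Integrable (fun r => w r * max ((j + 2 : ℕ) * l - gridFloor L n r) 0 +
        w r * max (j * l - gridFloor L n r) 0) (vol L) := (hi _).add (hi _)
    rw [← integral_add (hi _) (hi _), ← integral_const_mul,
      ← integral_sub hi2 ((hi _).const_mul 2)]
    have e : ∀ r, w r * max ((j + 2 : ℕ) * l - gridFloor L n r) 0 +
        w r * max (j * l - gridFloor L n r) 0 -
        2 * (w r * max ((j + 1 : ℕ) * l - gridFloor L n r) 0) =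
        (fun c => if c = j + 1 then l else 0) (cell L n r) * w r := by
      intro r
      have := secondDiff_max (L := L) (n := n) hl.le j (cell L n r)
      simp only [gridFloor]
      rw [← this]
      ring
    simp_rw [e]
    rw [integral_comp_cell_mul hL hn (fun c => if c = j + 1 then l else 0) hw,
      Finset.sum_eq_single (j + 1)]
    · simp [cellSet]
    · intro i _ hi'
      simp [hi']
    · intro h
      exact absurd (Finset.mem_range.2 hj) h
  have h2 : ∀ p, (if cell L n p < j + 2 then s p + d p * ((j + 2 : ℕ) * l - gridFloor L n p) else 0)
      + (if cell L n p < j then s p + d p * (j * l - gridFloor L n p) else 0)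
      - 2 * (if cell L n p < j + 1 then s p + d p * ((j + 1 : ℕ) * l - gridFloor L n p) else 0) =
      (if cell L n p = j + 1 then s p + d p * l else 0) + if cell L n p = j then - s p else 0 := by
    intro p
    simp only [gridFloor, ← hldef]
    rcases Nat.lt_trichotomy (cell L n p) j with h | h | h
    · rw [if_pos (by omega), if_pos h, if_pos (by omega), if_neg (by omega), if_neg (by omega)]
      push_cast; ring
    · rw [if_pos (by omega), if_neg (by omega), if_pos (by omega), if_neg (by omega),
        if_pos (by omega), h]
      push_cast; ring
    · by_cases h' : cell L n p = j + 1
      · rw [if_pos (by omega), if_neg (by omega), if_neg (by omega), if_pos (by omega),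
          if_neg (by omega), h']
        push_cast; ring
      · rw [if_neg (by omega), if_neg (by omega), if_neg (by omega), if_neg (by omega),
          if_neg (by omega)]
        ring
  simp_rw [← h2, Finset.sum_sub_distrib, Finset.sum_add_distrib, ← Finset.mul_sum]
  rw [← h1]
  simp only [secondDiff, recovery, ← hldef]
  push_cast
  ring

/-- The smallness of the mesh required for the energy estimate of the recovery sequence. -/
structure FineMesh (L c₁ c₂ : ℝ) (w : ℝ → ℝ) (P : Finset ℝ) (s d : ℝ → ℝ) (n : ℕ) : Prop where
  pos : 0 < n
  -- No two singular points act on the same second difference.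
  separated : ∀ p ∈ P, ∀ q ∈ P, p < q → 3 * mesh L n ≤ q - p
  -- By Jensen's inequality this keeps regular differences in the quadratic regime.
  integral_le : ∀ i < n, ∫ x in cellSet L n i, w x ^ 2 ≤ c₁ ^ 2
  -- The first bound leaves a second difference larger than `|s p| / 2`; the other two put that
  -- above both thresholds.
  jump : ∀ p ∈ P, s p ≠ 0 → mesh L n * ((∫ x, |w x| ∂vol L) + |d p|) < |s p| / 2 ∧
    c₂ * √(mesh L n) < |s p| / 2 ∧ c₁ * (mesh L n * √(mesh L n)) < |s p| / 2
  -- The regular part is at most `c₁ * √(mesh L n)`; the factor 2 leaves as much after subtracting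
  -- it.
  crease : ∀ p ∈ P, d p ≠ 0 → 2 * c₁ * √(mesh L n) < |d p|

lemma eventually_fineMesh (hL : 0 < L) {c₁ : ℝ} (hc₁ : 0 < c₁) (c₂ : ℝ) (hw : MemLp w 2 (vol L)) :
    ∀ᶠ n in atTop, FineMesh L c₁ c₂ w P s d n := by
  have hl := tendsto_mesh L
  have hs : Tendsto (fun n => √(mesh L n)) atTop (𝓝 0) := by
    simpa [Function.comp_def] using (Real.continuous_sqrt.tendsto 0).comp hl
  have small : ∀ {g : ℕ → ℝ}, Tendsto g atTop (𝓝 0) → ∀ (c : ℝ) {e : ℝ}, 0 < e →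
      ∀ᶠ n in atTop, c * g n < e := by
    intro g hg c e he
    have := hg.const_mul c
    rw [mul_zero] at this
    exact this.eventually_lt_const he
  have h1 : ∀ᶠ n in atTop, ∀ p ∈ P, ∀ q ∈ P, p < q → 3 * mesh L n ≤ q - p := by
    simp only [Finset.eventually_all, eventually_imp_distrib_left]
    intro p _ q _ hpq
    exact (small hl 3 (sub_pos.2 hpq)).mono fun n h => h.le
  have h2 : ∀ᶠ n in atTop, ∀ p ∈ P, s p ≠ 0 →
      mesh L n * ((∫ x, |w x| ∂vol L) + |d p|) < |s p| / 2 ∧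
      c₂ * √(mesh L n) < |s p| / 2 ∧ c₁ * (mesh L n * √(mesh L n)) < |s p| / 2 := by
    simp only [Finset.eventually_all, eventually_imp_distrib_left]
    intro p _ hp
    have hp' : 0 < |s p| / 2 := by positivity
    have hls : Tendsto (fun n => mesh L n * √(mesh L n)) atTop (𝓝 0) := by
      simpa using hl.mul hs
    filter_upwards [small hl ((∫ x, |w x| ∂vol L) + |d p|) hp', small hs c₂ hp', small hls c₁ hp']
      with n a1 a2 a3
    exact ⟨by rwa [mul_comm], a2, a3⟩
  have h3 : ∀ᶠ n in atTop, ∀ p ∈ P, d p ≠ 0 → 2 * c₁ * √(mesh L n) < |d p| := by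
    simp only [Finset.eventually_all, eventually_imp_distrib_left]
    intro p _ hp
    exact small hs (2 * c₁) (abs_pos.2 hp)
  filter_upwards [eventually_gt_atTop 0, h1, h2, h3,
    eventually_integral_cellSet_le hL hw (pow_pos hc₁ 2)] with n a1 a2 a3 a4 a5
  exact ⟨a1, a2, a5, a3, a4⟩

lemma psi_le_of_lt {L α β c₁ c₂ : ℝ} {n : ℕ} (hl : 0 < mesh L n) (hβα : β ≤ 2 * α) {z : ℝ}
    (hz : c₁ / √(mesh L n) < |z|) : mesh L n * psi L α β c₁ c₂ n z ≤ α := by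
  unfold psi
  rw [if_neg (not_le.2 hz)]
  split_ifs
  · exact le_of_eq (by field_simp)
  · have : mesh L n * (β / (2 * mesh L n)) = β / 2 := by field_simp
    rw [this]; linarith

lemma psi_le_of_lt_of_lt {L α β c₁ c₂ : ℝ} {n : ℕ} (hl : 0 < mesh L n) {z : ℝ}
    (hz : c₁ / √(mesh L n) < |z|) (hz' : c₂ / (mesh L n * √(mesh L n)) < |z|) :
    mesh L n * psi L α β c₁ c₂ n z ≤ β / 2 := by
  unfold psi
  rw [if_neg (not_le.2 hz), if_neg (not_le.2 hz')]
  exact le_of_eq (by field_simp)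

namespace FineMesh

variable {α β c₁ c₂ : ℝ}

lemma cell_add_two_lt (hL : 0 < L) (h : FineMesh L c₁ c₂ w P s d n)
    (hP : ∀ p ∈ P, p ∈ Ioo 0 L) {p q : ℝ} (hp : p ∈ P) (hq : q ∈ P) (hpq : p < q) :
    cell L n p + 2 < cell L n q + 1 := by
  have hl := mesh_pos hL h.pos
  have h1 := h.separated p hp q hq hpq
  have h2 := gridFloor_le hL h.pos (hP p hp).1.le
  have h3 := lt_gridFloor_add hL h.pos q
  have h4 : ((cell L n p : ℝ) + 2) * mesh L n < (cell L n q + 1) * mesh L n := by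
    unfold gridFloor at h2 h3
    linarith
  have := lt_of_mul_lt_mul_right h4 hl.le
  exact_mod_cast this

lemma eq_of_cell (hL : 0 < L) (h : FineMesh L c₁ c₂ w P s d n) (hP : ∀ p ∈ P, p ∈ Ioo 0 L)
    {p q : ℝ} (hp : p ∈ P) (hq : q ∈ P) {j : ℕ} (hpj : cell L n p = j + 1 ∨ cell L n p = j)
    (hqj : cell L n q = j + 1 ∨ cell L n q = j) : q = p := by
  rcases lt_trichotomy p q with hlt | heq | hlt
  · have := h.cell_add_two_lt hL hP hp hq hlt; omega
  · exact heq.symm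
  · have := h.cell_add_two_lt hL hP hq hp hlt; omega

/-- Energy of a single second difference of the recovery sequence. -/
lemma mesh_mul_psi_le (hL : 0 < L) (hα : 0 < α) (hαβ : α ≤ β) (hβα : β ≤ 2 * α) (hc₁ : 0 < c₁)
    (h : FineMesh L c₁ c₂ w P s d n) (hP : ∀ p ∈ P, p ∈ Ioo 0 L) (hw : MemLp w 2 (vol L))
    {j : ℕ} (hj : j + 1 < n) :
    mesh L n * psi L α β c₁ c₂ n (secondDiff (recovery L w P s d a b n) j / mesh L n ^ 2) ≤
      (∫ x in cellSet L n (j + 1), w x ^ 2) +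
      ∑ p ∈ P, ((if cell L n p = j + 1 then
          (if s p ≠ 0 then β / 2 else if d p ≠ 0 then α else 0) else 0) +
        if cell L n p = j then (if s p ≠ 0 then β / 2 else 0) else 0) := by
  classical
  have hβ : 0 < β := hα.trans_le hαβ
  have hn := h.pos
  have hl := mesh_pos hL hn
  have hwi := integrable_of_memLp_two hw
  rw [secondDiff_recovery hL hn hwi hj]
  have hJ := sq_integral_cellSet_le hL hn hj hw
  have hY := abs_integral_cellSet_le hL hn hj hwi
  have hI := h.integral_le (j + 1) hj
  have hI0 : 0 ≤ ∫ x in cellSet L n (j + 1), w x ^ 2 := integral_nonneg fun x => sq_nonneg _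
  set l := mesh L n with hldef
  set y := ∫ x in cellSet L n (j + 1), w x with hy
  set I := ∫ x in cellSet L n (j + 1), w x ^ 2 with hIdef
  have hsl : 0 < √l := Real.sqrt_pos.2 hl
  have hsq : √l * √l = l := Real.mul_self_sqrt hl.le
  have hyc : |y| ≤ c₁ * √l := by
    apply abs_le_of_sq_le_sq _ (by positivity)
    calc y ^ 2 ≤ l * I := hJ
      _ ≤ l * c₁ ^ 2 := by gcongr
      _ = (c₁ * √l) ^ 2 := by rw [mul_pow, Real.sq_sqrt hl.le]; ring
  set cost : ℝ → ℝ := fun p => (if cell L n p = j + 1 then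
          (if s p ≠ 0 then β / 2 else if d p ≠ 0 then α else 0) else 0) +
        if cell L n p = j then (if s p ≠ 0 then β / 2 else 0) else 0 with hcost
  have hcost0 : ∀ p ∈ P, 0 ≤ cost p := by
    intro p _
    simp only [hcost]
    refine add_nonneg ?_ ?_ <;> split_ifs <;> positivity
  set T : ℝ → ℝ := fun p => (if cell L n p = j + 1 then s p + d p * l else 0) +
        if cell L n p = j then - s p else 0 with hT
  -- Separation leaves at most one active singular point at this centre; without one, the difference
  -- is purely regular and is paid by the integral over the cell.
  by_cases hact : ∃ p ∈ P, T p ≠ 0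
  · obtain ⟨p, hp, hTp⟩ := hact
    have hpj : cell L n p = j + 1 ∨ cell L n p = j := by
      by_contra hcon
      push Not at hcon
      exact hTp (by simp [hT, hcon.1, hcon.2])
    have hsum : ∑ q ∈ P, T q = T p := by
      refine Finset.sum_eq_single p (fun q hq hqp => ?_) (fun h' => absurd hp h')
      by_contra hTq
      have hqj : cell L n q = j + 1 ∨ cell L n q = j := by
        by_contra hcon
        push Not at hcon
        exact hTq (by simp [hT, hcon.1, hcon.2])
      exact hqp (h.eq_of_cell hL hP hp hq hpj hqj)
    have hcostp : cost p ≤ ∑ q ∈ P, cost q := Finset.single_le_sum hcost0 hp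
    change l * psi L α β c₁ c₂ n ((l * y + ∑ q ∈ P, T q) / l ^ 2) ≤ I + ∑ q ∈ P, cost q
    rw [hsum]
    by_cases hs : s p = 0
    · have hcell : cell L n p = j + 1 := by
        rcases hpj with h' | h'
        · exact h'
        · exact absurd (by simp [hT, h', hs]) hTp
      have hd : d p ≠ 0 := fun hd => hTp (by simp [hT, hs, hd])
      have hTe : T p = d p * l := by simp [hT, hcell, hs]
      have hce : cost p = α := by simp [hcost, hcell, hs, hd]
      have hcr := h.crease p hp hd
      refine le_trans (psi_le_of_lt hl hβα ?_) (by linarith)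
      have e : (l * y + T p) / l ^ 2 = (y + d p) / l := by
        rw [hTe]; field_simp
      rw [← hldef, e, abs_div, abs_of_pos hl, div_lt_div_iff₀ hsl hl]
      have h1 : c₁ * √l < |y + d p| := by
        have := abs_sub_abs_le_abs_sub (d p) (-y)
        rw [abs_neg, sub_neg_eq_add, add_comm (d p)] at this
        linarith
      calc c₁ * l = c₁ * √l * √l := by rw [mul_assoc, hsq]
        _ < |y + d p| * √l := by gcongr
    · obtain ⟨hj1, hj2, hj3⟩ := h.jump p hp hs
      have hce : cost p = β / 2 := by
        rcases hpj with h' | h' <;> simp [hcost, h', hs]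
      have hTe : |s p| - |d p| * l ≤ |T p| := by
        rcases hpj with h' | h'
        · have : T p = s p + d p * l := by simp [hT, h']
          rw [this]
          have := abs_sub_abs_le_abs_sub (s p) (-(d p * l))
          rw [abs_neg, sub_neg_eq_add, abs_mul, abs_of_pos hl] at this
          exact this
        · have : T p = - s p := by simp [hT, h']
          rw [this, abs_neg]
          have : 0 ≤ |d p| * l := by positivity
          linarith
      have hbig : |s p| / 2 < |l * y + T p| := by
        have h1 := abs_sub_abs_le_abs_sub (T p) (-(l * y))
        rw [abs_neg, sub_neg_eq_add, add_comm (T p), abs_mul, abs_of_pos hl] at h1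
        have h2 : l * |y| ≤ l * ∫ x, |w x| ∂vol L := by gcongr
        have h3 : l * ((∫ x, |w x| ∂vol L) + |d p|) =
          l * (∫ x, |w x| ∂vol L) + |d p| * l := by ring
        linarith
      refine le_trans (psi_le_of_lt_of_lt hl ?_ ?_) (by linarith)
      · rw [← hldef, abs_div, abs_of_pos (show 0 < l ^ 2 by positivity),
          div_lt_div_iff₀ hsl (by positivity)]
        calc c₁ * l ^ 2 = c₁ * (l * √l) * √l := by
              rw [mul_assoc, mul_assoc, hsq]; ring
          _ < |l * y + T p| * √l := by gcongr; linarith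
      · rw [← hldef, abs_div, abs_of_pos (show 0 < l ^ 2 by positivity),
          div_lt_div_iff₀ (by positivity) (by positivity)]
        calc c₂ * l ^ 2 = c₂ * √l * (l * √l) := by
              rw [show c₂ * √l * (l * √l) = c₂ * l * (√l * √l) by ring, hsq]; ring
          _ < |l * y + T p| * (l * √l) := by gcongr; linarith
  · push Not at hact
    change l * psi L α β c₁ c₂ n ((l * y + ∑ q ∈ P, T q) / l ^ 2) ≤ I + ∑ q ∈ P, cost q
    rw [Finset.sum_eq_zero hact, add_zero]
    have e : l * y / l ^ 2 = y / l := by field_simp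
    rw [e, psi, if_pos]
    · have h1 : l * (y / l) ^ 2 ≤ I := by
        rw [show l * (y / l) ^ 2 = y ^ 2 / l by field_simp, div_le_iff₀ hl]
        linarith
      linarith [Finset.sum_nonneg hcost0]
    · rw [abs_div, abs_of_pos hl, div_le_div_iff₀ hl hsl]
      calc |y| * √l ≤ c₁ * √l * √l := by gcongr
        _ = c₁ * l := by rw [mul_assoc, hsq]

/-- The energy of the recovery sequence. -/
lemma sum_mesh_mul_psi_le (hL : 0 < L) (hα : 0 < α) (hαβ : α ≤ β) (hβα : β ≤ 2 * α) (hc₁ : 0 < c₁)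
    (h : FineMesh L c₁ c₂ w P s d n) (hP : ∀ p ∈ P, p ∈ Ioo 0 L) (hw : MemLp w 2 (vol L)) :
    ∑ j ∈ Finset.range (n - 1),
      mesh L n * psi L α β c₁ c₂ n (secondDiff (recovery L w P s d a b n) j / mesh L n ^ 2) ≤
      (∫ x, w x ^ 2 ∂vol L) + ∑ p ∈ P, if s p ≠ 0 then β else if d p ≠ 0 then α else 0 := by
  have hβ : 0 < β := hα.trans_le hαβ
  have single : ∀ (m c : ℕ) {e : ℝ}, 0 ≤ e →
      ∑ j ∈ Finset.range m, (if c = j then e else 0) ≤ e := by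
    intro m c e he
    rw [Finset.sum_ite_eq]
    split_ifs
    · exact le_rfl
    · exact he
  have single' : ∀ (m c : ℕ) {e : ℝ}, 0 ≤ e →
      ∑ j ∈ Finset.range m, (if c = j + 1 then e else 0) ≤ e := by
    intro m c e he
    rcases c with _ | c
    · simpa using he
    · simp only [Nat.add_right_cancel_iff]
      exact single m c he
  refine (Finset.sum_le_sum fun j hj => h.mesh_mul_psi_le hL hα hαβ hβα hc₁ hP hw
    (by have := Finset.mem_range.1 hj; omega)).trans ?_
  rw [Finset.sum_add_distrib]
  refine add_le_add (sum_integral_cellSet_le hL h.pos hw) ?_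
  rw [Finset.sum_comm]
  refine Finset.sum_le_sum fun p _ => ?_
  rw [Finset.sum_add_distrib]
  by_cases hs : s p = 0
  · by_cases hd : d p = 0
    · simp [hs, hd]
    · simpa [hs, hd] using single' (n - 1) (cell L n p) hα.le
  · simp only [ne_eq, hs, not_false_eq_true, if_true]
    linarith [single' (n - 1) (cell L n p) (by linarith : 0 ≤ β / 2),
      single (n - 1) (cell L n p) (by linarith : 0 ≤ β / 2)]

end FineMesh

/-- The recovery sequence converges pointwise. -/
lemma tendsto_recovery (hL : 0 < L) (hwi : Integrable w) {x : ℝ} (hP : ∀ p ∈ P, p ∈ Ioo 0 L)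
    (hx : x ∈ Ioo 0 L) :
    Tendsto (fun n => recovery L w P s d a b n (cell L n x)) atTop
      (𝓝 (repFun w P s d a b x)) := by
  have hl := tendsto_mesh L
  have hg : ∀ y, 0 ≤ y → Tendsto (fun n => gridFloor L n y) atTop (𝓝 y) := by
    intro y hy
    have h0 : Tendsto (fun n => y - mesh L n) atTop (𝓝 y) := by
      simpa using tendsto_const_nhds.sub hl
    refine tendsto_of_tendsto_of_tendsto_of_le_of_le' h0 tendsto_const_nhds ?_ ?_
    · filter_upwards [eventually_gt_atTop 0] with n hn
      linarith [lt_gridFloor_add hL hn y]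
    · filter_upwards [eventually_gt_atTop 0] with n hn
      exact gridFloor_le hL hn hy
  have hwv : Integrable w (vol L) := hwi.restrict
  have h1 : Tendsto (fun n => ∫ r, w r * max (gridFloor L n x - gridFloor L n r) 0 ∂vol L) atTop
      (𝓝 (doublePrim w x)) := by
    rw [doublePrim_eq_integral hwi ⟨hx.1.le, hx.2.le⟩, tendsto_iff_norm_sub_tendsto_zero]
    have h3 : Tendsto (fun n => mesh L n * ∫ s, |w s| ∂vol L) atTop (𝓝 0) := by
      simpa using hl.mul_const (∫ s, |w s| ∂vol L)
    refine squeeze_zero' (.of_forall fun n => norm_nonneg _) ?_ h3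
    filter_upwards [eventually_gt_atTop 0] with n hn
    exact abs_integral_kernel_sub_le hL hn hwv hx
  have h2 : ∀ p ∈ P, Tendsto (fun n => if cell L n p < cell L n x then
      s p + d p * (gridFloor L n x - gridFloor L n p) else 0) atTop
      (𝓝 (if p < x then s p + d p * (x - p) else 0)) := by
    intro p hp
    have hp0 := (hP p hp).1.le
    rcases lt_or_ge p x with hpx | hpx
    · rw [if_pos hpx]
      refine (((hg x hx.1.le).sub (hg p hp0)).const_mul (d p) |>.const_add (s p)).congr' ?_
      filter_upwards [eventually_gt_atTop 0, hl.eventually_lt_const (sub_pos.2 hpx)] with n hn hn'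
      rw [if_pos]
      have h3 : gridFloor L n p < gridFloor L n x := by
        linarith [gridFloor_le hL hn hp0, lt_gridFloor_add hL hn x]
      exact_mod_cast lt_of_mul_lt_mul_right h3 (mesh_pos hL hn).le
    · rw [if_neg (not_lt.2 hpx)]
      refine tendsto_const_nhds.congr' ?_
      filter_upwards [eventually_gt_atTop 0] with n hn
      rw [if_neg (not_lt.2 (cell_mono hL hn hpx))]
  have h3 := (h1.add ((hg x hx.1.le).const_mul b |>.const_add a)).add (tendsto_finsetSum P h2)
  simp only [repFun, pieced, sub_zero]
  exact h3

lemma abs_recovery_le (hL : 0 < L) (hn : 0 < n) (hwi : Integrable w) {x : ℝ}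
    (hx : x ∈ Ioo 0 L) :
    |recovery L w P s d a b n (cell L n x)| ≤
      L * (∫ r, |w r| ∂vol L) + (|a| + |b| * L) + ∑ p ∈ P, (|s p| + |d p| * L) := by
  have hwv : Integrable w (vol L) := hwi.restrict
  have hx0 := gridFloor_nonneg hL hn x
  have hxL : gridFloor L n x ≤ L := (gridFloor_le hL hn hx.1.le).trans hx.2.le
  refine (abs_add_le _ _).trans (add_le_add ((abs_add_le _ _).trans (add_le_add ?_ ?_)) ?_)
  · exact abs_integral_mul_le hwv fun r _ => abs_max_gridFloor_le hL hn hx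
  · refine (abs_add_le _ _).trans ?_
    rw [abs_mul]
    gcongr
    rw [abs_of_nonneg (by exact hx0)]
    exact hxL
  · refine (Finset.abs_sum_le_sum_abs _ _).trans (Finset.sum_le_sum fun p _ => ?_)
    split_ifs with hlt
    · refine (abs_add_le _ _).trans ?_
      rw [abs_mul]
      have h1 : gridFloor L n p ≤ gridFloor L n x :=
        mul_le_mul_of_nonneg_right (by exact_mod_cast hlt.le) (mesh_pos hL hn).le
      have h2 := gridFloor_nonneg hL hn p
      change |s p| + |d p| * |gridFloor L n x - gridFloor L n p| ≤ _
      rw [abs_of_nonneg (sub_nonneg.2 h1)]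
      gcongr
      linarith
    · rw [abs_zero]; positivity

/-- Bounded almost everywhere convergence implies convergence in `L²`. -/
lemma tendstoLp_two_of_bounded {f : ℕ → ℝ → ℝ} {v : ℝ → ℝ} {C : ℝ}
    (hf : ∀ k, AEStronglyMeasurable (f k) (vol L)) (hC : ∀ k, ∀ x ∈ Ioo 0 L, |f k x| ≤ C)
    (hv : MemLp v 2 (vol L)) (h : ∀ᵐ x ∂vol L, Tendsto (fun k => f k x) atTop (𝓝 (v x))) :
    TendstoLp 2 L f v := by
  refine tendsto_Lp_finite_of_tendsto_ae (by norm_num) (by norm_num) hf hv ?_ h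
  -- Beyond the threshold `C + 1` the truncated functions vanish on `(0, L)`, so the tails are zero.
  refine unifIntegrable_of (by norm_num) (by norm_num) hf fun ε _ => ⟨Real.toNNReal (C + 1), ?_⟩
  intro k
  rw [eLpNorm_congr_ae (g := 0)]
  · simp
  · refine ae_restrict_of_forall_mem measurableSet_Ioo fun x hx => indicator_of_notMem ?_ _
    intro hx'
    have h1 : (C + 1).toNNReal ≤ ‖f k x‖₊ := hx'
    rw [Real.toNNReal_le_iff_le_coe, coe_nnnorm, Real.norm_eq_abs] at h1
    linarith [hC k x hx]

/-- Existence of recovery sequences. -/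
theorem exists_recovery {α β c₁ c₂ : ℝ} (hL : 0 < L) (hα : 0 < α) (hαβ : α ≤ β)
    (hβα : β ≤ 2 * α) (hc₁ : 0 < c₁) {v : ℝ → ℝ} (hv : MemPiecewiseH2 L v) :
    ∃ u : (n : ℕ) → Grid n, TendstoLp 2 L (fun n => step L n (u n)) v ∧
      ∀ᶠ n in atTop, discreteEnergy L α β c₁ c₂ n (u n) ≤ energy L α β v := by
  obtain ⟨w, P, s, d, a, b, hrep⟩ := hv.exists_isRep hL.le
  have hwi := hrep.integrable
  set u : (n : ℕ) → Grid n := fun n i => recovery L w P s d a b n i with hu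
  have hext : ∀ n i, i ≤ n → gridExt (u n) i = recovery L w P s d a b n i := by
    intro n i hi
    rw [gridExt, dif_pos (by omega)]
  have hstep : ∀ n, 0 < n → ∀ x ∈ Ioo 0 L,
      step L n (u n) x = recovery L w P s d a b n (cell L n x) := by
    intro n hn x hx
    rw [step_eq hL hn (u n) ⟨hx.1.le, hx.2⟩, hext n _ (cell_lt hL hn hx.2).le]
  refine ⟨u, ?_, ?_⟩
  · have hae : ∀ᵐ x ∂vol L, Tendsto (fun n => step L n (u n) x) atTop (𝓝 (v x)) := by
      have h1 : ∀ᵐ x ∂vol L, x ∈ Ioo 0 L := ae_restrict_mem measurableSet_Ioo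
      filter_upwards [h1, hrep.ae_eq] with x hx hxv
      rw [hxv]
      refine (tendsto_recovery hL hwi hrep.mem_Ioo hx).congr' ?_
      filter_upwards [eventually_gt_atTop 0] with n hn
      rw [hstep n hn x hx]
    have hv2 : MemLp v 2 (vol L) := (memLp_congr_ae hrep.ae_eq).2 (memLp_repFun hwi 2)
    refine tendstoLp_two_of_bounded (C := L * (∫ r, |w r| ∂vol L) + (|a| + |b| * L) +
      ∑ p ∈ P, (|s p| + |d p| * L)) (fun n => (measurable_step L _).aestronglyMeasurable) ?_ hv2 hae
    intro n x hx
    rcases Nat.eq_zero_or_pos n with rfl | hn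
    · have : step L 0 (u 0) x = 0 := by simp [step]
      rw [this, abs_zero]
      have : 0 ≤ ∫ r, |w r| ∂vol L := integral_nonneg fun r => abs_nonneg _
      have h2 : 0 ≤ ∑ p ∈ P, (|s p| + |d p| * L) := Finset.sum_nonneg fun p _ => by positivity
      positivity
    · rw [hstep n hn x hx]
      exact abs_recovery_le hL hn hwi hx
  · filter_upwards [eventually_fineMesh (s := s) (d := d) (P := P) hL hc₁ c₂ hrep.memLp] with n hn
    rw [discreteEnergy_eq, hrep.energy_eq hL.le]
    refine le_trans (le_of_eq ?_) (hn.sum_mesh_mul_psi_le (a := a) (b := b) hL hα hαβ hβα hc₁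
      hrep.mem_Ioo hrep.memLp)
    refine Finset.sum_congr rfl fun j hj => ?_
    have hj' := Finset.mem_range.1 hj
    simp only [secondDiff]
    rw [hext n _ (by omega), hext n _ (by omega), hext n _ (by omega)]

end BlakeZisserman
end

noncomputable section

namespace BlakeZisserman

/-! ### Convergence of minimum problems -/

variable {L : ℝ}

lemma IsRep.congr {v v' w : ℝ → ℝ} {P : Finset ℝ} {s d : ℝ → ℝ} {a b : ℝ}
    (h : IsRep L v w P s d a b) (hv : v' =ᵐ[vol L] v) : IsRep L v' w P s d a b :=
  ⟨h.memLp, h.integrable, h.mem_Ioo, hv.trans h.ae_eq⟩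

lemma MemPiecewiseH2.congr (hL : 0 ≤ L) {v v' : ℝ → ℝ} (h : MemPiecewiseH2 L v)
    (hv : v' =ᵐ[vol L] v) : MemPiecewiseH2 L v' := by
  obtain ⟨w, P, s, d, a, b, hrep⟩ := h.exists_isRep hL
  exact (hrep.congr hv).memPiecewiseH2 hL

lemma MemPiecewiseH2.energy_congr (hL : 0 ≤ L) {v v' : ℝ → ℝ} (h : MemPiecewiseH2 L v)
    (hv : v' =ᵐ[vol L] v) (α β : ℝ) : energy L α β v' = energy L α β v := by
  obtain ⟨w, P, s, d, a, b, hrep⟩ := h.exists_isRep hL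
  rw [hrep.energy_eq hL, (hrep.congr hv).energy_eq hL]

lemma MemPiecewiseH2.memLp {v : ℝ → ℝ} (h : MemPiecewiseH2 L v) : MemLp v 2 (vol L) := by
  obtain ⟨P, h, -⟩ := h
  rwa [restrict_diff_finset] at h

lemma TendstoLp.unique {f : ℕ → ℝ → ℝ} {v v' : ℝ → ℝ}
    (hf : ∀ k, AEStronglyMeasurable (f k) (vol L)) (hv : AEStronglyMeasurable v (vol L))
    (hv' : AEStronglyMeasurable v' (vol L)) (h : TendstoLp 1 L f v) (h' : TendstoLp 1 L f v') :
    v =ᵐ[vol L] v' := by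
  have h0 : eLpNorm (v - v') 1 (vol L) = 0 := by
    have hsum : Tendsto (fun k => eLpNorm (f k - v) 1 (vol L) + eLpNorm (f k - v') 1 (vol L))
        atTop (𝓝 0) := by
      have := Tendsto.add (M := ENNReal) h h'
      rwa [add_zero] at this
    refine le_antisymm (ge_of_tendsto' hsum fun k => ?_) zero_le
    have e : v - v' = (f k - v') - (f k - v) := by abel
    rw [e, add_comm]
    exact eLpNorm_sub_le ((hf k).sub hv') ((hf k).sub hv) le_rfl
  rw [eLpNorm_eq_zero_iff (hv.sub hv') one_ne_zero] at h0
  filter_upwards [h0] with x hx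
  simpa [sub_eq_zero] using hx

lemma norm_sq_toLp {f : ℝ → ℝ} (hf : MemLp f 2 (vol L)) :
    ‖hf.toLp f‖ ^ 2 = ∫ x, f x ^ 2 ∂vol L := by
  rw [← real_inner_self_eq_norm_sq, integral_sq_toLp]
  simp [sq]

lemma integral_sub_sq_eq {g f : ℝ → ℝ} (hg : MemLp g 2 (vol L)) (hf : MemLp f 2 (vol L)) :
    ∫ x, (g x - f x) ^ 2 ∂vol L = ‖hg.toLp g - hf.toLp f‖ ^ 2 := by
  rw [← MemLp.toLp_sub, norm_sq_toLp]
  rfl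

/-- The fidelity term is continuous in `L²`. -/
lemma tendsto_integral_sub_sq {g v : ℝ → ℝ} {f : ℕ → ℝ → ℝ} (hg : MemLp g 2 (vol L))
    (hf : ∀ k, MemLp (f k) 2 (vol L)) (hv : MemLp v 2 (vol L)) (h : TendstoLp 2 L f v) :
    Tendsto (fun k => ∫ x, (g x - f k x) ^ 2 ∂vol L) atTop
      (𝓝 (∫ x, (g x - v x) ^ 2 ∂vol L)) := by
  simp_rw [integral_sub_sq_eq hg (hf _), integral_sub_sq_eq hg hv]
  have := (Lp.tendsto_Lp_iff_tendsto_eLpNorm'' f hf v hv).2 h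
  exact ((tendsto_const_nhds.sub this).norm).pow 2

/-- The fidelity term is lower semicontinuous under almost everywhere convergence. -/
lemma eventually_lt_integral_sub_sq {g v : ℝ → ℝ} {f : ℕ → ℝ → ℝ} (hg : MemLp g 2 (vol L))
    (hf : ∀ k, MemLp (f k) 2 (vol L)) (hv : MemLp v 2 (vol L))
    (h : ∀ᵐ x ∂vol L, Tendsto (fun k => f k x) atTop (𝓝 (v x))) {e : ℝ}
    (he : e < ∫ x, (g x - v x) ^ 2 ∂vol L) :
    ∀ᶠ k in atTop, e < ∫ x, (g x - f k x) ^ 2 ∂vol L := by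
  rcases lt_or_ge e 0 with he0 | he0
  · exact .of_forall fun k => he0.trans_le (integral_nonneg fun x => sq_nonneg _)
  have conv : ∀ z : ℝ → ℝ, MemLp z 2 (vol L) → ENNReal.ofReal (∫ x, (g x - z x) ^ 2 ∂vol L) =
      ∫⁻ x, ENNReal.ofReal ((g x - z x) ^ 2) ∂vol L := fun z hz =>
    ofReal_integral_eq_lintegral_ofReal (hg.sub hz).integrable_sq (.of_forall fun x => sq_nonneg _)
  have h1 : ENNReal.ofReal e < ∫⁻ x, ENNReal.ofReal ((g x - v x) ^ 2) ∂vol L := by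
    rw [← conv v hv]
    exact (ENNReal.ofReal_lt_ofReal_iff_of_nonneg he0).2 he
  -- Fatou's lemma, which is why the integrals are passed to `ENNReal`.
  have h2 : ∫⁻ x, ENNReal.ofReal ((g x - v x) ^ 2) ∂vol L ≤
      liminf (fun k => ∫⁻ x, ENNReal.ofReal ((g x - f k x) ^ 2) ∂vol L) atTop := by
    refine le_trans (le_of_eq ?_) (lintegral_liminf_le' fun k => ?_)
    · refine lintegral_congr_ae ?_
      filter_upwards [h] with x hx
      have : Tendsto (fun k => ENNReal.ofReal ((g x - f k x) ^ 2)) atTop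
          (𝓝 (ENNReal.ofReal ((g x - v x) ^ 2))) :=
        (ENNReal.continuous_ofReal.tendsto _).comp ((tendsto_const_nhds.sub hx).pow 2)
      exact this.liminf_eq.symm
    · exact ((hg.sub (hf k)).integrable_sq.aestronglyMeasurable.aemeasurable).ennreal_ofReal
  filter_upwards [eventually_lt_of_lt_liminf (h1.trans_le h2)] with k hk
  rw [← conv (f k) (hf k)] at hk
  exact (ENNReal.ofReal_lt_ofReal_iff_of_nonneg he0).1 hk

lemma eLpNorm_le_of_integral_sub_sq {g f : ℝ → ℝ} {C : ℝ} (hg : MemLp g 2 (vol L))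
    (hf : MemLp f 2 (vol L)) (h : ∫ x, (g x - f x) ^ 2 ∂vol L ≤ C) :
    eLpNorm f 2 (vol L) ≤ ENNReal.ofReal (‖hg.toLp g‖ + √C) := by
  rw [integral_sub_sq_eq hg hf] at h
  have h1 : ‖hg.toLp g - hf.toLp f‖ ≤ √C := Real.le_sqrt_of_sq_le h
  have h2 : ‖hf.toLp f‖ ≤ ‖hg.toLp g‖ + √C := by
    have := norm_sub_norm_le (hf.toLp f) (hg.toLp g)
    rw [norm_sub_rev] at this
    linarith
  rw [Lp.norm_toLp] at h2
  rw [← ENNReal.ofReal_toReal hf.2.ne]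
  exact ENNReal.ofReal_le_ofReal h2

/-! ### Total energies and asymptotic minimizers. -/

section Minimum

variable {α β c₁ c₂ : ℝ} {g : ℝ → ℝ}

lemma discreteTotal_nonneg (hL : 0 < L) (hα : 0 < α) (hβ : 0 < β) (g : ℝ → ℝ) {n : ℕ}
    (u : Grid n) : 0 ≤ discreteTotal L α β c₁ c₂ g n u :=
  add_nonneg (discreteEnergy_nonneg hL hα hβ u) (integral_nonneg fun _ => sq_nonneg _)

lemma discreteInf_le (hL : 0 < L) (hα : 0 < α) (hβ : 0 < β) (g : ℝ → ℝ) {n : ℕ}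
    (u : Grid n) : discreteInf L α β c₁ c₂ g n ≤ discreteTotal L α β c₁ c₂ g n u :=
  ciInf_le ⟨0, by rintro _ ⟨u, rfl⟩; exact discreteTotal_nonneg hL hα hβ g u⟩ u

/-- The zero function is the competitor that bounds all discrete minimum values uniformly in `n`. -/
lemma discreteTotal_zero (hL : 0 < L) (hc₁ : 0 < c₁) (g : ℝ → ℝ) (n : ℕ) :
    discreteTotal L α β c₁ c₂ g n 0 = ∫ x, g x ^ 2 ∂vol L := by
  have hm : 0 ≤ mesh L n := div_nonneg hL.le (Nat.cast_nonneg n)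
  have h1 : psi L α β c₁ c₂ n 0 = 0 := by
    rw [psi, if_pos]
    · simp
    · rw [abs_zero]; positivity
  simp [discreteTotal, discreteEnergy, step, h1]

/-- Upper bound for the discrete minimum values. -/
lemma eventually_discreteInf_lt (hL : 0 < L) (hα : 0 < α) (hαβ : α ≤ β) (hβα : β ≤ 2 * α)
    (hc₁ : 0 < c₁) (hg : MemLp g 2 (vol L)) {v : ℝ → ℝ} (hv : MemPiecewiseH2 L v) {e : ℝ}
    (he : total L α β g v < e) : ∀ᶠ n in atTop, discreteInf L α β c₁ c₂ g n < e := by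
  obtain ⟨u, hu, hE⟩ := exists_recovery (c₂ := c₂) hL hα hαβ hβα hc₁ hv
  have h1 := tendsto_integral_sub_sq hg (fun n => memLp_step L (u n) 2) hv.memLp hu
  have h2 := h1.eventually_lt_const (u := e - energy L α β v) (by unfold total at he; linarith)
  filter_upwards [hE, h2] with n hn hn2
  have := discreteInf_le (c₁ := c₁) (c₂ := c₂) hL hα (hα.trans_le hαβ) g (u n)
  unfold discreteTotal at this
  linarith

/-- Compactness and the lower bound for the total energies. -/
lemma exists_subseq_limit_total (hL : 0 < L) (hα : 0 < α) (hαβ : α ≤ β) (hβα : β ≤ 2 * α)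
    (hc₂ : 0 < c₂) (hg : MemLp g 2 (vol L)) (u : (n : ℕ) → Grid n) {N : ℕ → ℕ}
    (hN : StrictMono N) {C : ℝ} (hC : ∀ k, discreteTotal L α β c₁ c₂ g (N k) (u (N k)) ≤ C) :
    ∃ ψ : ℕ → ℕ, StrictMono ψ ∧ ∃ v : ℝ → ℝ, MemPiecewiseH2 L v ∧
      TendstoLp 1 L (fun k => step L (N (ψ k)) (u (N (ψ k)))) v ∧
      ∀ e < total L α β g v,
        ∀ᶠ k in atTop, e < discreteTotal L α β c₁ c₂ g (N (ψ k)) (u (N (ψ k))) := by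
  have hE : ∀ k, discreteEnergy L α β c₁ c₂ (N k) (u (N k)) ≤ C := fun k => by
    have h1 := hC k
    have h2 : 0 ≤ ∫ x, (g x - step L (N k) (u (N k)) x) ^ 2 ∂vol L :=
      integral_nonneg fun x => sq_nonneg _
    unfold discreteTotal at h1
    linarith
  have hI : ∀ k, ∫ x, (g x - step L (N k) (u (N k)) x) ^ 2 ∂vol L ≤ C := fun k => by
    have h1 := hC k
    have h2 := discreteEnergy_nonneg (c₁ := c₁) (c₂ := c₂) hL hα (hα.trans_le hαβ) (u (N k))
    unfold discreteTotal at h1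
    linarith
  obtain ⟨ψ, hψ, v, hv, hae, h1, hlow⟩ := exists_subseq_limit hL hα hαβ hβα hc₂ u hN hE
    (fun k => eLpNorm_le_of_integral_sub_sq hg (memLp_step L _ 2) (hI k))
  refine ⟨ψ, hψ, v, hv, h1, fun e he => ?_⟩
  set η := total L α β g v - e with hη
  have hη0 : 0 < η := sub_pos.2 he
  filter_upwards [hlow (energy L α β v - η / 2) (by linarith),
    eventually_lt_integral_sub_sq hg (fun k => memLp_step L _ 2) hv.memLp hae
      (e := (∫ x, (g x - v x) ^ 2 ∂vol L) - η / 2) (by linarith)] with k a1 a2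
  unfold discreteTotal
  unfold total at hη
  linarith

/-- Limits of asymptotic minimizers are minimizers. -/
lemma exists_subseq_minimizer (hL : 0 < L) (hα : 0 < α) (hαβ : α ≤ β) (hβα : β ≤ 2 * α)
    (hc₁ : 0 < c₁) (hc₂ : 0 < c₂) (hg : MemLp g 2 (vol L)) (u : (n : ℕ) → Grid n)
    (hu : Tendsto (fun n => discreteTotal L α β c₁ c₂ g n (u n) - discreteInf L α β c₁ c₂ g n)
      atTop (𝓝 0)) {N : ℕ → ℕ} (hN : StrictMono N) :
    ∃ ψ : ℕ → ℕ, StrictMono ψ ∧ ∃ v : ℝ → ℝ, MemPiecewiseH2 L v ∧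
      TendstoLp 1 L (fun k => step L (N (ψ k)) (u (N (ψ k)))) v ∧
      (∀ v', MemPiecewiseH2 L v' → total L α β g v ≤ total L α β g v') ∧
      Tendsto (fun k => discreteInf L α β c₁ c₂ g (N (ψ k))) atTop (𝓝 (total L α β g v)) := by
  obtain ⟨B, hB⟩ := hu.bddAbove_range
  have hC : ∀ n, discreteTotal L α β c₁ c₂ g n (u n) ≤ (∫ x, g x ^ 2 ∂vol L) + B := by
    intro n
    have h1 := hB ⟨n, rfl⟩
    have h2 := discreteInf_le (c₁ := c₁) (c₂ := c₂) hL hα (hα.trans_le hαβ) g (0 : Grid n)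
    rw [discreteTotal_zero hL hc₁] at h2
    simp only at h1
    linarith
  obtain ⟨ψ, hψ, v, hv, h1, hlow⟩ := exists_subseq_limit_total hL hα hαβ hβα hc₂ hg u hN
    fun k => hC (N k)
  have hNψ : Tendsto (fun k => N (ψ k)) atTop atTop := (hN.comp hψ).tendsto_atTop
  have hu' := hu.comp hNψ
  have hup : ∀ v', MemPiecewiseH2 L v' → ∀ e, total L α β g v' < e →
      ∀ᶠ k in atTop, discreteInf L α β c₁ c₂ g (N (ψ k)) < e := fun v' hv' e he =>
    hNψ.eventually (eventually_discreteInf_lt hL hα hαβ hβα hc₁ hg hv' he)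
  have hlow' : ∀ e < total L α β g v,
      ∀ᶠ k in atTop, e < discreteInf L α β c₁ c₂ g (N (ψ k)) := by
    intro e he
    set η := total L α β g v - e with hη
    have hη0 : 0 < η := sub_pos.2 he
    filter_upwards [hlow (total L α β g v - η / 2) (by linarith),
      hu'.eventually_lt_const (half_pos hη0)] with k a1 a2
    simp only [Function.comp_apply] at a2
    linarith
  refine ⟨ψ, hψ, v, hv, h1, fun v' hv' => ?_, ?_⟩
  -- For `e` strictly between the two totals, a recovery sequence for `v'` pushes the discrete
  -- infima below `e` while the lower bound for `v` keeps them above.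
  · by_contra! hlt
    obtain ⟨e, he1, he2⟩ := exists_between hlt
    obtain ⟨k, hk1, hk2⟩ := ((hup v' hv' e he1).and (hlow' e he2)).exists
    exact lt_asymm hk1 hk2
  · exact tendsto_order.2 ⟨hlow', hup v hv⟩

end Minimum

end BlakeZisserman
end

/-! ### Assembly of the main theorem. -/

open BlakeZisserman
theorem mainTheorem1 (L α β c₁ c₂ : ℝ) (hL : 0 < L) (hα : 0 < α) (hαβ : α ≤ β)
    (hβα : β ≤ 2 * α) (hc₁ : 0 < c₁) (hc₂ : 0 < c₂) :
    -- (i) compactness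
    (∀ u : (n : ℕ) → Grid n,
      BoundedL2 L (fun n => step L n (u n)) →
      BddAbove (Set.range fun n => discreteEnergy L α β c₁ c₂ n (u n)) →
      PrecompactL1 L (fun n => step L n (u n))) ∧
    -- (ii) liminf inequality
    (∀ (u : (n : ℕ) → Grid n) (v : ℝ → ℝ),
      BoundedL2 L (fun n => step L n (u n)) →
      MemLp v 1 (vol L) →
      TendstoLp 1 L (fun n => step L n (u n)) v →
      liminf (fun n => ((discreteEnergy L α β c₁ c₂ n (u n) : ℝ) : EReal)) atTop < ⊤ →
      MemPiecewiseH2 L v ∧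
        ((energy L α β v : ℝ) : EReal) ≤
          liminf (fun n => ((discreteEnergy L α β c₁ c₂ n (u n) : ℝ) : EReal)) atTop) ∧
    -- (iii) recovery sequences
    (∀ v : ℝ → ℝ, MemPiecewiseH2 L v →
      ∃ u : (n : ℕ) → Grid n,
        TendstoLp 2 L (fun n => step L n (u n)) v ∧
        limsup (fun n => ((discreteEnergy L α β c₁ c₂ n (u n) : ℝ) : EReal)) atTop ≤
          ((energy L α β v : ℝ) : EReal)) ∧
    -- convergence of minimum values and of minimizers
    (∀ g : ℝ → ℝ, MemLp g 2 (vol L) →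
      ∃ m : ℝ,
        IsLeast (total L α β g '' {v | MemPiecewiseH2 L v}) m ∧
        Tendsto (fun n => discreteInf L α β c₁ c₂ g n) atTop (𝓝 m) ∧
        -- sequences of exact minimizers
        (∀ u : (n : ℕ) → Grid n,
          (∀ n, 1 ≤ n → ∀ w : Grid n,
            discreteTotal L α β c₁ c₂ g n (u n) ≤ discreteTotal L α β c₁ c₂ g n w) →
          ∃ φ : ℕ → ℕ, StrictMono φ ∧ ∃ v : ℝ → ℝ,
            MemPiecewiseH2 L v ∧ total L α β g v = m ∧
            TendstoLp 1 L (fun k => step L (φ k) (u (φ k))) v) ∧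
        -- sequences of asymptotic minimizers
        (∀ u : (n : ℕ) → Grid n,
          Tendsto (fun n => discreteTotal L α β c₁ c₂ g n (u n) - discreteInf L α β c₁ c₂ g n)
            atTop (𝓝 0) →
          ∃ φ : ℕ → ℕ, StrictMono φ ∧ ∃ v : ℝ → ℝ,
            MemPiecewiseH2 L v ∧ total L α β g v = m ∧
            TendstoLp 1 L (fun k => step L (φ k) (u (φ k))) v)) := by
  refine ⟨?_, ?_, ?_, ?_⟩
  · rintro u ⟨M, hM⟩ ⟨C, hC⟩ φ hφ
    obtain ⟨ψ, hψ, v, hv, -, h1, -⟩ := exists_subseq_limit hL hα hαβ hβα hc₂ u hφ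
      (fun k => hC ⟨φ k, rfl⟩) (fun k => hM (φ k))
    exact ⟨ψ, hψ, v, hv.memLp.mono_exponent (by norm_num), h1⟩
  · rintro u v ⟨M, hM⟩ hv1 hlim hfin
    -- For each real `c` above the liminf, some subsequence has energies below `c`; its compactness
    -- limit must be `v` almost everywhere, so the energy of `v` is at most `c`.
    have key : ∀ c : ℝ,
        liminf (fun n => ((discreteEnergy L α β c₁ c₂ n (u n) : ℝ) : EReal)) atTop < c →
        MemPiecewiseH2 L v ∧ energy L α β v ≤ c := by
      intro c hc
      obtain ⟨N, hN, hNc⟩ := extraction_of_frequently_atTop (frequently_lt_of_liminf_lt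
        (by isBoundedDefault) hc)
      have hNc' : ∀ k, discreteEnergy L α β c₁ c₂ (N k) (u (N k)) ≤ c := fun k =>
        (EReal.coe_lt_coe_iff.1 (hNc k)).le
      obtain ⟨ψ, hψ, v', hv', -, h1, hlow⟩ := exists_subseq_limit hL hα hαβ hβα hc₂ u hN hNc'
        (fun k => hM (N k))
      have hlim' : TendstoLp 1 L (fun k => step L (N (ψ k)) (u (N (ψ k)))) v :=
        (show Tendsto (fun n => eLpNorm (step L n (u n) - v) 1 (vol L)) atTop (𝓝 0) from
          hlim).comp (hN.comp hψ).tendsto_atTop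
      have hae : v =ᵐ[vol L] v' := TendstoLp.unique
        (fun k => (measurable_step L _).aestronglyMeasurable) hv1.1 hv'.memLp.1 hlim' h1
      refine ⟨hv'.congr hL.le hae, ?_⟩
      rw [hv'.energy_congr hL.le hae]
      by_contra! hlt
      obtain ⟨k, hk⟩ := (hlow c hlt).exists
      exact absurd (hNc' (ψ k)) (not_le.2 hk)
    obtain ⟨c, hc, -⟩ := EReal.lt_iff_exists_real_btwn.1 hfin
    refine ⟨(key c hc).1, ?_⟩
    by_contra! hlt
    obtain ⟨c, hc1, hc2⟩ := EReal.lt_iff_exists_real_btwn.1 hlt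
    exact absurd (key c hc1).2 (not_le.2 (EReal.coe_lt_coe_iff.1 hc2))
  · intro v hv
    obtain ⟨u, hu, hE⟩ := exists_recovery (c₂ := c₂) hL hα hαβ hβα hc₁ hv
    exact ⟨u, hu, limsup_le_of_le (by isBoundedDefault)
      (hE.mono fun n hn => EReal.coe_le_coe_iff.2 hn)⟩
  · intro g hg
    have hβ : 0 < β := hα.trans_le hαβ
    -- Near minimizers with error `1 / (n + 1)` suffice, so the existence of exact discrete
    -- minimizers is never needed.
    have hex : ∀ n, ∃ u : Grid n, discreteTotal L α β c₁ c₂ g n u <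
        discreteInf L α β c₁ c₂ g n + 1 / ((n : ℝ) + 1) := fun n =>
      exists_lt_of_ciInf_lt (lt_add_of_pos_right _ (by positivity))
    choose u₀ hu₀ using hex
    have hu₀' : Tendsto (fun n => discreteTotal L α β c₁ c₂ g n (u₀ n) -
        discreteInf L α β c₁ c₂ g n) atTop (𝓝 0) :=
      squeeze_zero (fun n => sub_nonneg.2 (discreteInf_le hL hα hβ g (u₀ n)))
        (fun n => by linarith [hu₀ n]) tendsto_one_div_add_atTop_nhds_zero_nat
    obtain ⟨-, -, v₀, hv₀, -, hmin₀, -⟩ := exists_subseq_minimizer hL hα hαβ hβα hc₁ hc₂ hg u₀ hu₀'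
      strictMono_id
    have hasy : ∀ u : (n : ℕ) → Grid n,
        Tendsto (fun n => discreteTotal L α β c₁ c₂ g n (u n) - discreteInf L α β c₁ c₂ g n)
          atTop (𝓝 0) →
        ∃ φ : ℕ → ℕ, StrictMono φ ∧ ∃ v : ℝ → ℝ,
          MemPiecewiseH2 L v ∧ total L α β g v = total L α β g v₀ ∧
          TendstoLp 1 L (fun k => step L (φ k) (u (φ k))) v := by
      intro u hu
      obtain ⟨ψ, hψ, v, hv, h1, hmin, -⟩ := exists_subseq_minimizer hL hα hαβ hβα hc₁ hc₂ hg u hu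
        strictMono_id
      exact ⟨ψ, hψ, v, hv, le_antisymm (hmin v₀ hv₀) (hmin₀ v hv), h1⟩
    refine ⟨total L α β g v₀, ⟨⟨v₀, hv₀, rfl⟩, ?_⟩, ?_, ?_, hasy⟩
    · rintro _ ⟨v, hv, rfl⟩
      exact hmin₀ v hv
    -- Every subsequence of the infima has a further one converging to the total of some minimizer,
    -- and all minimizers share the value attained at `v₀`.
    · refine tendsto_of_subseq_tendsto fun N hN => ?_
      obtain ⟨χ, -, hχ⟩ := strictMono_subseq_of_tendsto_atTop hN
      obtain ⟨ψ, -, v, hv, -, hmin, hlim⟩ := exists_subseq_minimizer hL hα hαβ hβα hc₁ hc₂ hg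
        u₀ hu₀' hχ
      refine ⟨fun k => χ (ψ k), ?_⟩
      rw [le_antisymm (hmin₀ v hv) (hmin v₀ hv₀)]
      exact hlim
    · intro u hu
      refine hasy u (tendsto_const_nhds.congr' ?_)
      filter_upwards [eventually_ge_atTop 1] with n hn
      exact (sub_eq_zero.2 (le_antisymm (le_ciInf (hu n hn)) (discreteInf_le hL hα hβ g _))).symm
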